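/- Let $V = V^- \sqcup V^+$ be a finite set of $\nu \ge 1$ elements, partitioned into negative and positive elements, and let $T$ be a tree with vertex set $V$ (a signed tree). **Signed nested complex.** View $T$ as a one-dimensional space. An open subtree of $T$ is a connected component $Z$ of $T \setminus U$ for some $U \subseteq V$; its boundary $\partial Z \subseteq V$ is the set of its excluded leaves. A signed tube is a pair $W = (W^-, W^+)$ of open subtrees with $\partial W^- \subseteq V^- \cap W^+$ and $\partial W^+ \subseteq V^+ \cap W^-$; it is irrelevant if it is $(Z, T)$ with $Z$ a component of $T \setminus V^-$ or $(T, Z)$ with $Z$ a component of $T \setminus V^+$, and relevant otherwise. Two signed tubes $W_1, W_2$ are compatible if ($W_1^- \subseteq W_2^-$ and $W_1^+ \supseteq W_2^+$), or ($W_1^- \supseteq W_2^-$ and $W_1^+ \subseteq W_2^+$), or ($W_1^- \cap W_2^- = \emptyset$ and $W_1^+ \cup W_2^+ = T$), or ($W_1^- \cup W_2^- = T$ and $W_1^+ \cap W_2^+ = \emptyset$). The signed nested complex $\mathcal{N}(T)$ is the simplicial complex of all sets of pairwise compatible relevant signed tubes. **Signed building blocks.** A subset $B \subseteq V$ is a signed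 building block if every negative vertex on the path of $T$ between two vertices of $B$ is in $B$, and every positive vertex on the path of $T$ between two vertices of $V \setminus B$ is in $V \setminus B$. Let $\mathbb{H} = \{x \in \mathbb{R}^V : \sum_{v \in V} x_v = \binom{\nu+1}{2}\}$ and $\mathbf{H}^{\ge}(B) = \{x \in \mathbb{R}^V : \sum_{v \in B} x_v \ge \binom{|B|+1}{2}\}$. **Signed spines.** A signed spine on $T$ is a directed tree $S$ whose nodes are labeled by the parts of a partition of $V$ into non-empty sets, such that, at each node with label $U$, the source label sets of the different incoming arcs lie in distinct connected components of $T \setminus (U \cap V^-)$, and the sink label sets of the different outgoing arcs lie in distinct connected components of $T \setminus (U \cap V^+)$. (The source, resp. sink, label set of an arc $r$ is the union of the labels in the component of $S \setminus r$ containing the source, resp. the sink, of $r$.) Signed spines are partially ordered by arc contraction, contracted spines being smaller. Put $$C(S) = \{x \in \mathbb{H} : x_u \le x_v \text{ whenever there is a directed path in } S \text{ from the node of } u \text{ to the node of } v\}.$$ The spine fan $\mathcal{F}(T)$ is the collection of the cones $C(S)$ for all signed spines $S$ on $T$. In a maximal signed spine $S$ every node is labeled by a single element $v$; let $r_v$ be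 its outgoing arc if $v \in V^-$ and its incoming arc if $v \in V^+$ (there is at most one). Let $n_S(v)$ be the number of undirected simple paths of $S$ (trivial paths included) that contain $v$ but do not contain $r_v$ (the last condition being void if $r_v$ does not exist), and let $\mathbf{a}(S) \in \mathbb{R}^V$ be the point with $\mathbf{a}(S)_v = n_S(v)$ if $v \in V^-$ and $\mathbf{a}(S)_v = \nu + 1 - n_S(v)$ if $v \in V^+$. **Theorem.** 1. The convex hull of the points $\mathbf{a}(S)$, over all maximal signed spines $S$ on $T$, equals the intersection of the hyperplane $\mathbb{H}$ with the half-spaces $\mathbf{H}^{\ge}(B)$, over all signed building blocks $B$ of $T$. This polytope is the signed tree associahedron $\mathrm{Asso}(T)$. 2. The normal fan of $\mathrm{Asso}(T)$, that is, the collection of the cones $\{g \in \mathbb{H} : \langle g, \cdot\rangle \text{ is maximal on } \mathrm{Asso}(T) \text{ at every point of } F\}$ over all non-empty faces $F$ of $\mathrm{Asso}(T)$, is the spine fan $\mathcal{F}(T)$. 3. For every point $o$ in the relative interior of $\mathrm{Asso}(T)$, the boundary complex (the complex of proper faces, including the empty face) of the polar of $\mathrm{Asso}(T) - o$, taken in the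 linear span of $\mathrm{Asso}(T) - o$, is isomorphic to the signed nested complex $\mathcal{N}(T)$, i.e. their posets of faces are isomorphic. -/

import Mathlib

open Set

/-- A signed ground tree on `V`: a tree with vertex set `V = V⁻ ⊔ V⁺`, where `neg` is `V⁻`. -/
structure SignedTree (V : Type*) where
  graph : SimpleGraph V
  isTree : graph.IsTree
  neg : Set V

namespace SignedTree

/-- The set `V⁺` of positive vertices. -/
def pos {V : Type*} (T : SignedTree V) : Set V := T.negᶜ

/-! ### Open subtrees and signed tubes -/

/-- The tree `T`, as a one-dimensional space, is the disjoint union of its vertices and of its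
open edges. A subset of `T` that is a union of such cells is a `Set T.Cell`. -/
abbrev Cell {V : Type*} (T : SignedTree V) : Type _ := V ⊕ T.graph.edgeSet

/-- A vertex and an open edge touch when the vertex is an endpoint of the edge. -/
def incidence {V : Type*} (T : SignedTree V) : SimpleGraph T.Cell :=
  SimpleGraph.fromRel fun x y => ∃ v : V, ∃ e : T.graph.edgeSet,
    x = Sum.inl v ∧ y = Sum.inr e ∧ v ∈ e.1

/-- `Z` is a connected component of the complement `T ∖ U` of a set `U` of vertices. -/
def IsComponent {V : Type*} (T : SignedTree V) (U : Set V) (Z : Set T.Cell) : Prop :=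
  ∃ C : (T.incidence.induce (Sum.inl '' U)ᶜ).ConnectedComponent, Z = Subtype.val '' C.supp

/-- Open subtrees of `T`. -/
def IsOpenSubtree {V : Type*} (T : SignedTree V) (Z : Set T.Cell) : Prop :=
  ∃ U : Set V, T.IsComponent U Z

/-- The boundary `∂Z`: the vertices outside `Z` which are endpoints of an edge of `Z`. -/
def boundary {V : Type*} (T : SignedTree V) (Z : Set T.Cell) : Set V :=
  {v | Sum.inl v ∉ Z ∧ ∃ e : T.graph.edgeSet, Sum.inr e ∈ Z ∧ v ∈ e.1}

/-- Signed tubes `W = (W⁻, W⁺)` of `T`. -/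
def IsSignedTube {V : Type*} (T : SignedTree V) (W : Set T.Cell × Set T.Cell) : Prop :=
  T.IsOpenSubtree W.1 ∧ T.IsOpenSubtree W.2 ∧
    (∀ v ∈ T.boundary W.1, v ∈ T.neg ∧ Sum.inl v ∈ W.2) ∧
    (∀ v ∈ T.boundary W.2, v ∈ T.pos ∧ Sum.inl v ∈ W.1)

/-- Irrelevant signed tubes: the pairs `(Z, T)` with `Z` a component of `T ∖ V⁻`, and the pairs
`(T, Z)` with `Z` a component of `T ∖ V⁺`. -/
def IsIrrelevantTube {V : Type*} (T : SignedTree V) (W : Set T.Cell × Set T.Cell) : Prop :=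
  (T.IsComponent T.neg W.1 ∧ W.2 = univ) ∨ (T.IsComponent T.pos W.2 ∧ W.1 = univ)

/-- Relevant signed tubes. -/
def IsRelevantTube {V : Type*} (T : SignedTree V) (W : Set T.Cell × Set T.Cell) : Prop :=
  T.IsSignedTube W ∧ ¬ T.IsIrrelevantTube W

/-- `W₁` is negative nested in `W₂` (equivalently, `W₂` is positive nested in `W₁`). -/
def NegNested {V : Type*} (T : SignedTree V) (W₁ W₂ : Set T.Cell × Set T.Cell) : Prop :=
  W₁.1 ⊆ W₂.1 ∧ W₂.2 ⊆ W₁.2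

/-- `W₁` and `W₂` are negative disjoint. -/
def NegDisjoint {V : Type*} (T : SignedTree V) (W₁ W₂ : Set T.Cell × Set T.Cell) : Prop :=
  W₁.1 ∩ W₂.1 = ∅ ∧ W₁.2 ∪ W₂.2 = univ

/-- `W₁` and `W₂` are positive disjoint. -/
def PosDisjoint {V : Type*} (T : SignedTree V) (W₁ W₂ : Set T.Cell × Set T.Cell) : Prop :=
  W₁.1 ∪ W₂.1 = univ ∧ W₁.2 ∩ W₂.2 = ∅

/-- Signed compatibility: signed nested or signed disjoint. -/
def Compatible {V : Type*} (T : SignedTree V) (W₁ W₂ : Set T.Cell × Set T.Cell) : Prop :=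
  (T.NegNested W₁ W₂ ∨ T.NegNested W₂ W₁) ∨ (T.NegDisjoint W₁ W₂ ∨ T.PosDisjoint W₁ W₂)

/-- The signed nested complex `N(T)`: the collections of pairwise compatible relevant signed
tubes (the empty collection included). -/
def signedNestedComplex {V : Type*} (T : SignedTree V) :
    Set (Set (Set T.Cell × Set T.Cell)) :=
  {N | (∀ W ∈ N, T.IsRelevantTube W) ∧ ∀ W₁ ∈ N, ∀ W₂ ∈ N, T.Compatible W₁ W₂}

/-! ### Signed building blocks -/

/-- `B` is convex in `T` with respect to the vertices in `X`: every vertex of `X` on the path of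
`T` between two vertices of `B` belongs to `B`. -/
def ConvexFor {V : Type*} (T : SignedTree V) (X B : Set V) : Prop :=
  ∀ u ∈ B, ∀ w ∈ B, ∀ p : T.graph.Walk u w, p.IsPath → ∀ v ∈ p.support, v ∈ X → v ∈ B

/-- The signed building set `B(T)`: the negative convex subsets with positive convex complement. -/
def buildingSet {V : Type*} (T : SignedTree V) : Set (Finset V) :=
  {B | T.ConvexFor T.neg (B : Set V) ∧ T.ConvexFor T.pos (B : Set V)ᶜ}

end SignedTree

/-! ### Signed spines -/

/-- The undirected graph on a set `P` of labels underlying a set of arcs. -/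
def arcGraph {V : Type*} (P : Finset (Finset V)) (arc : Finset V → Finset V → Prop) :
    SimpleGraph {U : Finset V // U ∈ P} :=
  SimpleGraph.fromRel fun s t => arc s.1 t.1

/-- A directed tree whose nodes are labeled by the parts of a partition of `V`; each node is
identified with its label. -/
structure LabeledDirectedTree (V : Type*) [Fintype V] [DecidableEq V] where
  nodes : Finpartition (Finset.univ : Finset V)
  arc : Finset V → Finset V → Prop
  mem_of_arc : ∀ s t, arc s t → s ∈ nodes.parts ∧ t ∈ nodes.parts
  arc_asymm : ∀ s t, arc s t → ¬ arc t s
  isTree : (arcGraph nodes.parts arc).IsTree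

namespace LabeledDirectedTree

abbrev Node {V : Type*} [Fintype V] [DecidableEq V] (S : LabeledDirectedTree V) : Type _ :=
  {U : Finset V // U ∈ S.nodes.parts}

abbrev graph {V : Type*} [Fintype V] [DecidableEq V] (S : LabeledDirectedTree V) :
    SimpleGraph S.Node :=
  arcGraph S.nodes.parts S.arc

/-- The node whose label contains `v`. -/
def nodeOf {V : Type*} [Fintype V] [DecidableEq V] (S : LabeledDirectedTree V) (v : V) : S.Node :=
  ⟨S.nodes.part v, S.nodes.part_mem.2 (Finset.mem_univ v)⟩

/-- The union of the labels in the connected component of `S ∖ {s, t}` containing `n`, where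
`{s, t}` is an edge of `S`. -/
def sideLabels {V : Type*} [Fintype V] [DecidableEq V] (S : LabeledDirectedTree V)
    (s t n : S.Node) : Set V :=
  {v | (S.graph.deleteEdges {s(s, t)}).Reachable n (S.nodeOf v)}

/-- The source label set of the arc `s → t`. -/
def source {V : Type*} [Fintype V] [DecidableEq V] (S : LabeledDirectedTree V)
    (s t : S.Node) : Set V :=
  S.sideLabels s t s

/-- The sink label set of the arc `s → t`. -/
def sink {V : Type*} [Fintype V] [DecidableEq V] (S : LabeledDirectedTree V)
    (s t : S.Node) : Set V :=
  S.sideLabels s t t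

/-- The local condition at a node `n` labeled by `U`: the source label sets of the different
incoming arcs lie in distinct connected components of `T ∖ U⁻`, and the sink label sets of the
different outgoing arcs lie in distinct connected components of `T ∖ U⁺`. -/
def LocalCondition {V : Type*} [Fintype V] [DecidableEq V] (S : LabeledDirectedTree V)
    (T : SignedTree V) (n : S.Node) : Prop :=
  (∃ f : {s : S.Node // S.arc s.1 n.1} → {Z : Set T.Cell // T.IsComponent ((n.1 : Set V) ∩ T.neg) Z},
    Function.Injective f ∧ ∀ s, ∀ v ∈ S.source s.1 n, Sum.inl v ∈ (f s).1) ∧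
  (∃ f : {t : S.Node // S.arc n.1 t.1} → {Z : Set T.Cell // T.IsComponent ((n.1 : Set V) ∩ T.pos) Z},
    Function.Injective f ∧ ∀ t, ∀ v ∈ S.sink n t.1, Sum.inl v ∈ (f t).1)

/-- `S` is obtained from `S'` by contracting a set of arcs: the labels of `S` are the unions of the
labels over connected pieces of `S'`, and the arcs of `S` are the remaining arcs of `S'`. -/
def IsContractionOf {V : Type*} [Fintype V] [DecidableEq V] (S S' : LabeledDirectedTree V) :
    Prop :=
  S'.nodes ≤ S.nodes ∧
  (∀ n : S.Node, (S'.graph.induce {n' : S'.Node | n'.1 ⊆ n.1}).Connected) ∧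
  (∀ m n : S.Node, S.arc m.1 n.1 ↔
    m ≠ n ∧ ∃ m' n' : S'.Node, m'.1 ⊆ m.1 ∧ n'.1 ⊆ n.1 ∧ S'.arc m'.1 n'.1)

/-- The undirected simple paths of `S` (as subgraphs), trivial paths included. -/
def paths {V : Type*} [Fintype V] [DecidableEq V] (S : LabeledDirectedTree V) :
    Set S.graph.Subgraph :=
  {π | ∃ (s t : S.Node) (p : S.graph.Walk s t), p.IsPath ∧ π = p.toSubgraph}

/-- `u ≤ v` in the preposet on `V` generated by `S`: there is a directed path in `S`, possibly
trivial, from the node of `u` to the node of `v`. -/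
def Below {V : Type*} [Fintype V] [DecidableEq V] (S : LabeledDirectedTree V) (u v : V) : Prop :=
  Relation.ReflTransGen (fun s t : S.Node => S.arc s.1 t.1) (S.nodeOf u) (S.nodeOf v)

end LabeledDirectedTree

/-- Signed spines on `T`. -/
structure SignedSpine {V : Type*} [Fintype V] [DecidableEq V] (T : SignedTree V) extends
    LabeledDirectedTree V where
  local_condition : ∀ n, toLabeledDirectedTree.LocalCondition T n

/-! ### Half-spaces, spine fan and signed tree associahedron -/

/-- The hyperplane `H` of `ℝ^V` where the sum of the coordinates is `binom (ν + 1) 2`. -/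
def hyperplane (V : Type*) [Fintype V] : Set (V → ℝ) :=
  {x | ∑ v, x v = ((Fintype.card V + 1).choose 2 : ℝ)}

/-- The half-space `H^≥(U)`. -/
def halfSpace {V : Type*} (U : Finset V) : Set (V → ℝ) :=
  {x | ((U.card + 1).choose 2 : ℝ) ≤ ∑ u ∈ U, x u}

namespace SignedSpine

/-- Maximal elements of the poset of arc contractions on the signed spines on `T`. -/
def IsMaximal {V : Type*} [Fintype V] [DecidableEq V] {T : SignedTree V} (S : SignedSpine T) :
    Prop :=
  ∀ S' : SignedSpine T, S.toLabeledDirectedTree.IsContractionOf S'.toLabeledDirectedTree → S' = S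

/-- The paths of `S` through the node of `v` that avoid the outgoing arc at this node if `v` is
negative, and that avoid the incoming arc at this node if `v` is positive (there is at most one
such arc if `S` is maximal; if there is none, then the path is only asked to contain the node). -/
def avoidingPaths {V : Type*} [Fintype V] [DecidableEq V] {T : SignedTree V} (S : SignedSpine T)
    (v : V) : Set S.graph.Subgraph :=
  {π | π ∈ S.paths ∧ S.nodeOf v ∈ π.verts ∧
    (v ∈ T.neg → ∀ n : S.Node, S.arc (S.nodeOf v).1 n.1 → ¬ π.Adj (S.nodeOf v) n) ∧
    (v ∈ T.pos → ∀ n : S.Node, S.arc n.1 (S.nodeOf v).1 → ¬ π.Adj n (S.nodeOf v))}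

open Classical in
/-- The point `a(S)` of `ℝ^V`. -/
noncomputable def point {V : Type*} [Fintype V] [DecidableEq V] {T : SignedTree V}
    (S : SignedSpine T) : V → ℝ := fun v =>
  if v ∈ T.neg then ((S.avoidingPaths v).ncard : ℝ)
  else (Fintype.card V : ℝ) + 1 - ((S.avoidingPaths v).ncard : ℝ)

/-- The cone `C(S)` in `H`. -/
def cone {V : Type*} [Fintype V] [DecidableEq V] {T : SignedTree V} (S : SignedSpine T) :
    Set (V → ℝ) :=
  {x | x ∈ hyperplane V ∧ ∀ u v, S.Below u v → x u ≤ x v}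

end SignedSpine

namespace SignedTree

/-- The spine fan `F(T)`. -/
def spineFan {V : Type*} [Fintype V] [DecidableEq V] (T : SignedTree V) : Set (Set (V → ℝ)) :=
  {C | ∃ S : SignedSpine T, C = S.cone}

/-- The vertex description of `Asso(T)`: the convex hull of the points `a(S)` for all maximal
signed spines `S` on `T`. -/
def asso {V : Type*} [Fintype V] [DecidableEq V] (T : SignedTree V) : Set (V → ℝ) :=
  convexHull ℝ {x | ∃ S : SignedSpine T, S.IsMaximal ∧ x = S.point}

/-- The facet description of `Asso(T)`: the intersection of `H` with the half-spaces `H^≥(B)` for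
all signed building blocks `B` of `T`. -/
def assoFacets {V : Type*} [Fintype V] (T : SignedTree V) : Set (V → ℝ) :=
  hyperplane V ∩ ⋂ B ∈ T.buildingSet, halfSpace B

end SignedTree

/-! ### Normal fan, polar and boundary complex of a polytope -/

/-- The (outer) normal cone, inside `H`, of a face `F` of `P`: the vectors `g` in `H` for which
the linear functional `⟨g, ·⟩` is maximal on `P` at all points of `F`. -/
def normalCone {V : Type*} [Fintype V] (P F : Set (V → ℝ)) : Set (V → ℝ) :=
  {g | g ∈ hyperplane V ∧ ∀ x ∈ F, ∀ y ∈ P, g ⬝ᵥ y ≤ g ⬝ᵥ x}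

/-- The normal fan of `P`, inside `H`: the normal cones of the non-empty faces of `P`. -/
def normalFan {V : Type*} [Fintype V] (P : Set (V → ℝ)) : Set (Set (V → ℝ)) :=
  {C | ∃ F, IsExposed ℝ P F ∧ F.Nonempty ∧ C = normalCone P F}

/-- The polar of `P`, in the linear span of `P - o`, after moving the point `o` to the origin. -/
def polarAt {V : Type*} [Fintype V] (o : V → ℝ) (P : Set (V → ℝ)) : Set (V → ℝ) :=
  {g | g ∈ (affineSpan ℝ P).direction ∧ ∀ x ∈ P, g ⬝ᵥ (x - o) ≤ 1}

/-- The boundary complex of a polytope `Q`: its proper faces, the empty face included. -/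
def boundaryComplex {V : Type*} [Fintype V] (Q : Set (V → ℝ)) : Set (Set (V → ℝ)) :=
  {F | IsExposed ℝ Q F ∧ F ≠ Q}

/-!
Everything is reduced to *nested families* (`SignedTree.IsNested`): sets of pairwise compatible
proper signed building blocks, where two blocks are compatible if one contains the other, if they
are separated by a negative vertex outside both, or if their complements are separated by a positive
vertex in both. Replacing every block by its complement and exchanging the signs is a symmetry
(`SignedTree.dual`), which halves the case distinctions.

**Combinatorics.** A signed spine is the same thing as a nested family, namely that of the source
label sets of its arcs (`SignedSpine.isNested_family`, `SignedTree.IsNested.exists_signedSpine`);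
the spine is recovered as the tree dual to the family, whose nodes are the classes of vertices that
the family does not separate. The spine is maximal if and only if the family separates any two
vertices (`isMaximal_iff`), and every family extends to a separating one
(`IsNested.exists_isSeparating`). A relevant signed tube is the same thing as a proper block, with
the same compatibility relation, so that the signed nested complex is the complex of nested families
(`exists_signedNestedComplex_iso`). The blocks needed for these constructions come from a sweep:
when the vertices of a set `P` are swept already, the strand through an edge is stopped at the
negative vertices outside `P` and at the positive vertices in `P`, and it cuts out a block
`cutBlock`; blocks of earlier strands are compatible with those of later ones
(`blockCompatible_cutBlock`). Sweeping by increasing values of a vector `g` yields a maximal family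
whose cone contains `g` (`exists_isNested_monotone`).

**Facets and vertices.** Let `𝓑` be a separating nested family. The point `vertexPoint 𝓑` is the
point `a(S)` of the corresponding maximal spine, since the paths counted by `a(S)` correspond to
pairs of vertices that do not lie in a common branch (`IsTree.ncard_paths_eq`, `point_eq`). For a
block `C`, the difference of the two sides of the inequality of `C` at `vertexPoint 𝓑` is a sum over
the pairs of vertices (`sum_vertexPoint'`) of terms which count the arcs that enter and leave `C` on
a path of the dual tree. They are non-negative (`path_sum_nonneg`), so the point satisfies all
inequalities, and it attains equality only for the members of `𝓑` (`mem_of_tight`). If `g` weakly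
increases along the arcs of the dual tree, then `g` is a constant minus a non-negative combination
of the indicators of the members of `𝓑` (`exists_decomposition`), and hence `g` is maximal at
`vertexPoint 𝓑` among all points that satisfy the inequalities (`dotProduct_le`). As the sweep
provides such an `𝓑` for every `g`, the Hahn–Banach theorem gives the first claim
(`convexHull_vertexPoint`). The points where `g` is maximal are those where the inequalities of the
arcs on which `g` strictly increases are tight, which determines the normal cones
(`normalFan_assoFacets`).

**The polar.** The inequalities that are tight at a point form a nested family, and every nested
family arises in this way (`isNested_tightBlocks`, `IsNested.exists_tightBlocks_eq`). The
corresponding faces of the polar are all its non-empty proper faces (`exists_eq_polarFace`), and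
each of them is determined by the vertices `polarVertex o B` it contains
(`exists_boundaryComplex_iso`).
-/

set_option linter.unusedSectionVars false

/-! ### Betweenness in trees -/

namespace SimpleGraph

variable {V : Type*} {G : SimpleGraph V} {x y z w w' : V}

/-- `w` lies between `x` and `y`: every walk from `x` to `y` passes through `w`. In a tree, this
means that `w` is a vertex of the path from `x` to `y`. -/
def Btw (G : SimpleGraph V) (x w y : V) : Prop := ∀ p : G.Walk x y, w ∈ p.support

theorem Btw.symm (h : G.Btw x w y) : G.Btw y w x := fun p => by
  simpa using h p.reverse

theorem btw_comm : G.Btw x w y ↔ G.Btw y w x := ⟨Btw.symm, Btw.symm⟩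

theorem btw_left : G.Btw x x y := fun p => p.start_mem_support

theorem btw_right : G.Btw x y y := fun p => p.end_mem_support

theorem Btw.eq_of_self (h : G.Btw x w x) : w = x := by
  simpa using h Walk.nil

theorem Btw.split (h : G.Btw x w y) (z : V) : G.Btw x w z ∨ G.Btw z w y := by
  by_contra! hc
  obtain ⟨h1, h2⟩ := hc
  simp only [Btw, not_forall] at h1 h2
  obtain ⟨p, hp⟩ := h1
  obtain ⟨q, hq⟩ := h2
  have := h (p.append q)
  rw [Walk.mem_support_append_iff] at this
  tauto

theorem Btw.eq_or_of_adj (h : G.Btw x w y) (ha : G.Adj x y) : w = x ∨ w = y := by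
  simpa using h ha.toWalk

theorem Btw.trans (h : G.Btw x w y) (h' : G.Btw x w' w) : G.Btw x w' y := fun p => by
  classical
  exact p.support_takeUntil_subset_support (h p) (h' (p.takeUntil w (h p)))

theorem Btw.dist_lt (hG : G.Connected) (h : G.Btw x w y) (hne : w ≠ y) :
    G.dist x w < G.dist x y := by
  classical
  obtain ⟨p, hp⟩ := hG.exists_walk_length_eq_dist x y
  rw [← hp]
  exact (dist_le _).trans_lt (Walk.length_takeUntil_lt_length (h p) hne)

theorem Btw.antisymm (hG : G.Connected) (h : G.Btw x w y) (h' : G.Btw x y w) : w = y := by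
  by_contra hne
  have h1 := h.dist_lt hG hne
  have h2 := h'.dist_lt hG (Ne.symm hne)
  omega

/-- If `x, w', w` and `x, w, y` are in this order, then so are `w', w, y`. -/
theorem Btw.drop (hG : G.Connected) (h : G.Btw x w y) (h' : G.Btw x w' w) : G.Btw w' w y := by
  rcases h.split w' with h1 | h1
  · rw [h1.antisymm hG h']
    exact btw_left
  · exact h1

theorem IsTree.mem_support_iff_btw (hG : G.IsTree) {p : G.Walk x y} (hp : p.IsPath) :
    w ∈ p.support ↔ G.Btw x w y := by
  classical
  refine ⟨fun h q => ?_, fun h => h p⟩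
  have := (hG.isAcyclic.subsingleton_path x y).elim ⟨p, hp⟩ q.toPath
  have h2 : p = q.bypass := congrArg Subtype.val this
  rw [h2] at h
  exact q.support_bypass_subset_support h

/-- Two vertices of the path from `x` to `y` are ordered along the path. -/
theorem IsTree.btw_total (hG : G.IsTree) (h : G.Btw x w y) (h' : G.Btw x w' y) :
    G.Btw x w w' ∨ G.Btw x w' w := by
  classical
  obtain ⟨p, hp, -⟩ := hG.existsUnique_path x y
  have hw' := h' p
  have hw := h p
  rw [← p.take_spec hw', Walk.mem_support_append_iff] at hw
  rcases hw with hw | hw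
  · left
    exact (hG.mem_support_iff_btw (hp.takeUntil hw')).1 hw
  · have h1 := (hG.mem_support_iff_btw (hp.dropUntil hw')).1 hw
    rcases h'.split w with h2 | h2
    · exact Or.inr h2
    · have := h1.symm.antisymm hG.connected h2.symm
      rw [this]
      exact Or.inr btw_right

/-- The first step of the path from `x` to `y`. -/
theorem IsTree.exists_adj_btw (hG : G.IsTree) (hne : x ≠ y) :
    ∃ z, G.Adj x z ∧ G.Btw x z y ∧ ¬ G.Btw z x y := by
  obtain ⟨p, hp⟩ := hG.connected.exists_isPath x y
  have hz := fun w => hG.mem_support_iff_btw (w := w) hp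
  cases p with
  | nil => exact absurd rfl hne
  | cons h q =>
    rw [Walk.cons_isPath_iff] at hp
    exact ⟨_, h, (hz _).1 (by simp), fun hb => hp.2 (hb q)⟩

end SimpleGraph

/-! ### Signed building blocks and their compatibility -/

namespace SignedTree

section Edge

variable {V : Type*} (T : SignedTree V) {p q x y w w' : V}

theorem connected : T.graph.Connected := T.isTree.connected

/-- The signed tree with the same underlying tree and with opposite signs. -/
def dual : SignedTree V := ⟨T.graph, T.isTree, T.negᶜ⟩

/-- `w` lies on the path that joins the edge `{p, q}` to `x`. For a fixed edge this is the order of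
the tree rooted at the edge. -/
def EdgeBtw (p q w x : V) : Prop := T.graph.Btw p w x ∧ T.graph.Btw q w x

variable {T}

theorem EdgeBtw.trans (h : T.EdgeBtw p q w x) (h' : T.EdgeBtw p q w' w) : T.EdgeBtw p q w' x :=
  ⟨h.1.trans h'.1, h.2.trans h'.2⟩

theorem EdgeBtw.antisymm (h : T.EdgeBtw p q w x) (h' : T.EdgeBtw p q x w) : w = x :=
  h.1.antisymm T.connected h'.1

theorem edgeBtw_self : T.EdgeBtw p q x x := ⟨SimpleGraph.btw_right, SimpleGraph.btw_right⟩

theorem EdgeBtw.total (ha : T.graph.Adj p q) (h : T.EdgeBtw p q w x) (h' : T.EdgeBtw p q w' x) :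
    T.EdgeBtw p q w w' ∨ T.EdgeBtw p q w' w := by
  have key : ∀ {p q w w' : V}, T.graph.Adj p q → T.EdgeBtw p q w x → T.EdgeBtw p q w' x →
      T.graph.Btw p w w' → T.EdgeBtw p q w w' := by
    intro p q w w' ha h h' h1
    refine ⟨h1, ?_⟩
    rcases h1.split q with h2 | h2
    · rcases h2.eq_or_of_adj ha with rfl | rfl
      · rcases T.isTree.btw_total h.2 h'.2 with h3 | h3
        · exact h3
        · rcases h3.eq_or_of_adj ha.symm with rfl | rfl
          · exact absurd (h.2.symm.antisymm T.connected h'.1.symm) ha.ne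
          · exact SimpleGraph.btw_right
      · exact SimpleGraph.btw_left
    · exact h2
  rcases T.isTree.btw_total h.1 h'.1 with h1 | h1
  · exact Or.inl (key ha h h' h1)
  · exact Or.inr (key ha h' h h1)

/-- A vertex of the path from `x` to `y` separates `x` or `y` from the edge `{p, q}`. -/
theorem edgeBtw_or (ha : T.graph.Adj p q) (h : T.graph.Btw x w y) :
    T.EdgeBtw p q w x ∨ T.EdgeBtw p q w y := by
  by_contra! hc
  simp only [EdgeBtw, not_and_or] at hc
  have e1 := h.split p
  have e2 := h.split q
  rw [SimpleGraph.btw_comm (x := x)] at e1 e2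
  obtain ⟨h1 | h1, h2 | h2⟩ := hc
  · tauto
  · have h3 : T.graph.Btw q w x := by tauto
    rcases h3.symm.split p with h4 | h4
    · exact h1 h4.symm
    rcases h4.eq_or_of_adj ha with rfl | rfl
    · exact h1 SimpleGraph.btw_left
    · exact h2 SimpleGraph.btw_left
  · have h3 : T.graph.Btw p w x := by tauto
    rcases h3.symm.split q with h4 | h4
    · exact h1 h4.symm
    rcases h4.eq_or_of_adj ha.symm with rfl | rfl
    · exact h1 SimpleGraph.btw_left
    · exact h2 SimpleGraph.btw_left
  · tauto

/-- If `w` separates the edge `{p', q'}` from `x`, but not the edge `{p, q}`, then it separates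
the two edges. -/
theorem EdgeBtw.btw_of_not (ha : T.graph.Adj p q) {p' q' : V} (h : T.EdgeBtw p' q' w x)
    (h' : ¬ T.EdgeBtw p q w x) : (T.EdgeBtw p' q' w p ∧ T.EdgeBtw p' q' w q) := by
  have key : ∀ {p q : V}, T.graph.Adj p q → ¬ T.graph.Btw p w x →
      T.EdgeBtw p' q' w p ∧ T.EdgeBtw p' q' w q := by
    intro p q ha hp
    have h1 : ∀ r, T.graph.Btw r w x → T.graph.Btw r w p := fun r hr =>
      (hr.split p).resolve_right hp
    have h2 : ∀ r, T.graph.Btw r w x → T.graph.Btw r w q := by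
      intro r hr
      rcases (h1 r hr).split q with h3 | h3
      · exact h3
      · rcases h3.eq_or_of_adj ha.symm with rfl | rfl
        · exact SimpleGraph.btw_right
        · exact absurd SimpleGraph.btw_left hp
    exact ⟨⟨h1 _ h.1, h1 _ h.2⟩, ⟨h2 _ h.1, h2 _ h.2⟩⟩
  simp only [EdgeBtw, not_and_or] at h'
  rcases h' with h' | h'
  · exact key ha h'
  · exact (key ha.symm h').symm

/-- If `w` separates two edges, `x` is on the side of the first one and `y` on the side of the
second one, then `w` separates `x` and `y`. -/
theorem btw_of_edges {p' q' : V} (h : T.EdgeBtw p' q' w p ∧ T.EdgeBtw p' q' w q)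
    (hx : ¬ T.EdgeBtw p q w x) (hy : ¬ T.EdgeBtw p' q' w y) : T.graph.Btw x w y := by
  obtain ⟨⟨h1, h2⟩, ⟨h3, h4⟩⟩ := h
  simp only [EdgeBtw, not_and_or] at hx hy
  have key : ∀ {r r' : V}, T.graph.Btw r' w r → ¬ T.graph.Btw r w x → ¬ T.graph.Btw r' w y →
      T.graph.Btw x w y := by
    intro r r' h hx hy
    have := (h.split y).resolve_left hy
    exact ((this.split x).resolve_right fun h => hx h.symm).symm
  rcases hx with hx | hx <;> rcases hy with hy | hy <;> apply key _ hx hy <;> assumption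

end Edge

section Blocks

variable {V : Type*} (T : SignedTree V)

theorem convexFor_iff {X B : Set V} :
    T.ConvexFor X B ↔ ∀ u ∈ B, ∀ w ∈ B, ∀ v ∈ X, T.graph.Btw u v w → v ∈ B := by
  classical
  constructor
  · intro h u hu w hw v hv hb
    obtain ⟨p, hp⟩ := T.connected.exists_isPath u w
    exact h u hu w hw p hp v (hb p) hv
  · intro h u hu w hw p hp v hv hX
    exact h u hu w hw v hX ((T.isTree.mem_support_iff_btw hp).1 hv)

variable [Fintype V] [DecidableEq V] {B B₁ B₂ : Finset V}

theorem mem_buildingSet_iff : B ∈ T.buildingSet ↔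
    (∀ x ∈ B, ∀ y ∈ B, ∀ w ∈ T.neg, T.graph.Btw x w y → w ∈ B) ∧
    (∀ x ∉ B, ∀ y ∉ B, ∀ w ∉ T.neg, T.graph.Btw x w y → w ∉ B) := by
  simp [buildingSet, convexFor_iff, pos]

theorem compl_mem_buildingSet_dual : Bᶜ ∈ T.dual.buildingSet ↔ B ∈ T.buildingSet := by
  simp only [mem_buildingSet_iff, dual, Finset.mem_compl, Set.mem_compl_iff, not_not]
  exact and_comm

/-- The signed building blocks other than `∅` and `V`. -/
def IsProperBlock (B : Finset V) : Prop := B ∈ T.buildingSet ∧ B.Nonempty ∧ Bᶜ.Nonempty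

theorem isProperBlock_dual : T.dual.IsProperBlock Bᶜ ↔ T.IsProperBlock B := by
  simp only [IsProperBlock, compl_mem_buildingSet_dual, compl_compl]
  tauto

variable {T}

theorem IsProperBlock.neg_mem (h : T.IsProperBlock B) {x y w : V} (hx : x ∈ B) (hy : y ∈ B)
    (hw : w ∈ T.neg) (hb : T.graph.Btw x w y) : w ∈ B :=
  (T.mem_buildingSet_iff.1 h.1).1 x hx y hy w hw hb

theorem IsProperBlock.pos_notMem (h : T.IsProperBlock B) {x y w : V} (hx : x ∉ B) (hy : y ∉ B)
    (hw : w ∉ T.neg) (hb : T.graph.Btw x w y) : w ∉ B :=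
  (T.mem_buildingSet_iff.1 h.1).2 x hx y hy w hw hb

variable (T)

/-- Two sets are separated by a negative vertex that belongs to neither of them. -/
def NegSep (B₁ B₂ : Finset V) : Prop :=
  ∃ w ∈ T.neg, w ∉ B₁ ∧ w ∉ B₂ ∧ ∀ x ∈ B₁, ∀ y ∈ B₂, T.graph.Btw x w y

/-- The complements of two sets are separated by a positive vertex that belongs to both sets. -/
def PosSep (B₁ B₂ : Finset V) : Prop :=
  ∃ w ∉ T.neg, w ∈ B₁ ∧ w ∈ B₂ ∧ ∀ x ∉ B₁, ∀ y ∉ B₂, T.graph.Btw x w y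

/-- The compatibility relation on signed building blocks. -/
def BlockCompatible (B₁ B₂ : Finset V) : Prop :=
  B₁ ⊆ B₂ ∨ B₂ ⊆ B₁ ∨ T.NegSep B₁ B₂ ∨ T.PosSep B₁ B₂

variable {T}

theorem NegSep.symm (h : T.NegSep B₁ B₂) : T.NegSep B₂ B₁ := by
  obtain ⟨w, h1, h2, h3, h4⟩ := h
  exact ⟨w, h1, h3, h2, fun x hx y hy => (h4 y hy x hx).symm⟩

theorem PosSep.symm (h : T.PosSep B₁ B₂) : T.PosSep B₂ B₁ := by
  obtain ⟨w, h1, h2, h3, h4⟩ := h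
  exact ⟨w, h1, h3, h2, fun x hx y hy => (h4 y hy x hx).symm⟩

theorem NegSep.notMem (h : T.NegSep B₁ B₂) {x : V} (hx : x ∈ B₁) : x ∉ B₂ := by
  obtain ⟨w, h1, h2, h3, h4⟩ := h
  intro hx'
  rw [(h4 x hx x hx').eq_of_self] at h2
  exact h2 hx

theorem PosSep.mem (h : T.PosSep B₁ B₂) {x : V} (hx : x ∉ B₁) : x ∈ B₂ := by
  obtain ⟨w, h1, h2, h3, h4⟩ := h
  by_contra hx'
  rw [(h4 x hx x hx').eq_of_self] at h2
  exact hx h2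

theorem BlockCompatible.symm (h : T.BlockCompatible B₁ B₂) : T.BlockCompatible B₂ B₁ := by
  rcases h with h | h | h | h
  · exact Or.inr (Or.inl h)
  · exact Or.inl h
  · exact Or.inr (Or.inr (Or.inl h.symm))
  · exact Or.inr (Or.inr (Or.inr h.symm))

theorem negSep_dual : T.dual.NegSep B₁ᶜ B₂ᶜ ↔ T.PosSep B₁ B₂ := by
  simp [NegSep, PosSep, dual]

theorem posSep_dual : T.dual.PosSep B₁ᶜ B₂ᶜ ↔ T.NegSep B₁ B₂ := by
  simp [NegSep, PosSep, dual]

theorem blockCompatible_dual : T.dual.BlockCompatible B₁ᶜ B₂ᶜ ↔ T.BlockCompatible B₁ B₂ := by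
  simp only [BlockCompatible, negSep_dual, posSep_dual, Finset.compl_subset_compl]
  tauto

end Blocks

section CutBlock

variable {V : Type*} [Fintype V] [DecidableEq V] (T : SignedTree V) {P : Finset V}
  {p q x y a b w : V}

/-- The vertices at which the strands stop when the vertices of `P` are swept already: the
negative vertices outside `P` and the positive vertices in `P`. -/
def IsWall (P : Finset V) (w : V) : Prop := w ∈ T.neg ↔ w ∉ P

/-- `y` is the first wall on the path from the edge `{p, q}` to `x`, or `x` if there is none. -/
def IsFirstWall (p q : V) (P : Finset V) (y x : V) : Prop :=
  T.EdgeBtw p q y x ∧ (y = x ∨ T.IsWall P y) ∧ ∀ w, T.IsWall P w → T.EdgeBtw p q w y → w = y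

open Classical in
/-- The signed building block cut out by the strand through the edge `{p, q}` at the moment where
the vertices of `P` are swept: it contains `x` if and only if `P` contains the first wall from
`{p, q}` to `x`. -/
noncomputable def cutBlock (p q : V) (P : Finset V) : Finset V :=
  {x | ∃ y ∈ P, T.IsFirstWall p q P y x}

theorem isWall_dual : T.dual.IsWall Pᶜ w ↔ T.IsWall P w := by
  simp [IsWall, dual]; tauto

theorem isFirstWall_dual : T.dual.IsFirstWall p q Pᶜ y x ↔ T.IsFirstWall p q P y x := by
  simp only [IsFirstWall, isWall_dual]; rfl

variable {T}

theorem exists_isFirstWall (P : Finset V) (p q x : V) : ∃ y, T.IsFirstWall p q P y x := by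
  classical
  by_cases h : ∃ w, T.IsWall P w ∧ T.EdgeBtw p q w x
  · obtain ⟨y, hy, hmin⟩ := Finset.exists_min_image
      (Finset.univ.filter fun w => T.IsWall P w ∧ T.EdgeBtw p q w x) (T.graph.dist p)
      (by obtain ⟨w, hw⟩ := h; exact ⟨w, by simpa using hw⟩)
    simp only [Finset.mem_filter, Finset.mem_univ, true_and] at hy hmin
    refine ⟨y, hy.2, Or.inr hy.1, fun w hw hwy => ?_⟩
    by_contra hne
    exact absurd (hwy.1.dist_lt T.connected hne) (not_lt.2 (hmin w ⟨hw, hy.2.trans hwy⟩))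
  · push Not at h
    exact ⟨x, edgeBtw_self, Or.inl rfl, fun w hw hwx => absurd hwx (h w hw)⟩

/-- The walls on the path from an edge to a vertex are linearly ordered, so there is only one first
wall. -/
theorem IsFirstWall.unique (ha : T.graph.Adj p q) (h : T.IsFirstWall p q P y x)
    (h' : T.IsFirstWall p q P w x) : y = w := by
  have key : ∀ {y w}, T.IsFirstWall p q P y x → T.IsFirstWall p q P w x → T.EdgeBtw p q y w →
      y = w := by
    intro y w h h' hE
    rcases h.2.1 with rfl | hw
    · exact hE.antisymm h'.1
    · exact h'.2.2 y hw hE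
  rcases h.1.total ha h'.1 with hE | hE
  · exact key h h' hE
  · exact (key h' h hE).symm

theorem mem_cutBlock (ha : T.graph.Adj p q) (h : T.IsFirstWall p q P y x) :
    x ∈ T.cutBlock p q P ↔ y ∈ P := by
  simp only [cutBlock, Finset.mem_filter, Finset.mem_univ, true_and]
  exact ⟨fun ⟨z, hz, hzx⟩ => (hzx.unique ha h) ▸ hz, fun hy => ⟨y, hy, h⟩⟩

theorem cutBlock_dual (ha : T.graph.Adj p q) : T.dual.cutBlock p q Pᶜ = (T.cutBlock p q P)ᶜ := by
  ext x
  obtain ⟨y, hy⟩ := exists_isFirstWall (T := T) P p q x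
  rw [Finset.mem_compl, mem_cutBlock ha hy,
    mem_cutBlock (T := T.dual) ha (T.isFirstWall_dual.2 hy), Finset.mem_compl]

theorem neg_mem_cutBlock (ha : T.graph.Adj p q) (hx : x ∈ T.cutBlock p q P)
    (hy : y ∈ T.cutBlock p q P) (hw : w ∈ T.neg) (hb : T.graph.Btw x w y) :
    w ∈ T.cutBlock p q P := by
  obtain ⟨z, hz⟩ := exists_isFirstWall (T := T) P p q w
  have key : ∀ x, T.EdgeBtw p q w x → x ∈ T.cutBlock p q P → w ∈ T.cutBlock p q P := by
    intro x hE hx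
    by_contra hc
    rw [mem_cutBlock ha hz] at hc
    have hwall : T.IsWall P z := by
      rcases hz.2.1 with rfl | h
      · simp [IsWall, hw, hc]
      · exact h
    exact hc ((mem_cutBlock ha ⟨hE.trans hz.1, Or.inr hwall, hz.2.2⟩).1 hx)
  rcases edgeBtw_or ha hb with h | h
  · exact key x h hx
  · exact key y h hy

theorem cutBlock_mem_buildingSet (ha : T.graph.Adj p q) :
    T.cutBlock p q P ∈ T.buildingSet := by
  rw [mem_buildingSet_iff]
  refine ⟨fun x hx y hy w hw hb => neg_mem_cutBlock ha hx hy hw hb, fun x hx y hy w hw hb => ?_⟩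
  rw [← Finset.mem_compl, ← cutBlock_dual ha] at *
  exact neg_mem_cutBlock (T := T.dual) ha hx hy hw hb

/-- A vertex in `P` and a vertex outside `P` are separated by the block of some strand through an
edge of the path that joins them. -/
theorem exists_cutBlock_separating (P : Finset V) : ∀ {a b : V}, a ∈ P → b ∉ P →
    ∃ p q, T.graph.Adj p q ∧ T.graph.Btw a p b ∧ T.graph.Btw a q b ∧
      a ∈ T.cutBlock p q P ∧ b ∉ T.cutBlock p q P := by
  suffices H : ∀ n : ℕ, ∀ {a b : V}, T.graph.dist a b = n → a ∈ P → b ∉ P →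
      ∃ p q, T.graph.Adj p q ∧ T.graph.Btw a p b ∧ T.graph.Btw a q b ∧
      a ∈ T.cutBlock p q P ∧ b ∉ T.cutBlock p q P from @fun _ _ ha hb => H _ rfl ha hb
  intro n
  induction n using Nat.strong_induction_on with
  | _ n ih =>
  intro a b hn ha hb
  have hC := T.connected
  have hne : a ≠ b := fun h => hb (h ▸ ha)
  by_cases hw : ∃ w, T.IsWall P w ∧ T.graph.Btw a w b ∧ w ≠ a ∧ w ≠ b
  · obtain ⟨w, hwall, hbtw, hwa, hwb⟩ := hw
    have h1 : T.graph.dist a w < n := hn ▸ hbtw.dist_lt hC hwb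
    have h2 : T.graph.dist w b < n := by
      rw [SimpleGraph.dist_comm, ← hn, SimpleGraph.dist_comm (u := a)]
      exact hbtw.symm.dist_lt hC hwa
    by_cases hwP : w ∈ P
    · obtain ⟨p, q, hadj, hp, hq, hwm, hbm⟩ := ih _ h2 rfl hwP hb
      refine ⟨p, q, hadj, (hbtw.symm.trans hp.symm).symm, (hbtw.symm.trans hq.symm).symm, ?_, hbm⟩
      obtain ⟨y, hy⟩ := exists_isFirstWall (T := T) P p q w
      have hyP := (mem_cutBlock hadj hy).1 hwm
      have hE : T.EdgeBtw p q w a :=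
        ⟨hbtw.symm.drop hC hp.symm, hbtw.symm.drop hC hq.symm⟩
      refine (mem_cutBlock hadj ⟨hE.trans hy.1, Or.inr ?_, hy.2.2⟩).2 hyP
      rcases hy.2.1 with rfl | h
      · exact hwall
      · exact h
    · obtain ⟨p, q, hadj, hp, hq, ham, hwm⟩ := ih _ h1 rfl ha hwP
      refine ⟨p, q, hadj, hbtw.trans hp, hbtw.trans hq, ham, ?_⟩
      obtain ⟨y, hy⟩ := exists_isFirstWall (T := T) P p q w
      rw [mem_cutBlock hadj hy] at hwm
      have hE : T.EdgeBtw p q w b := ⟨hbtw.drop hC hp, hbtw.drop hC hq⟩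
      rw [mem_cutBlock hadj ⟨hE.trans hy.1, Or.inr ?_, hy.2.2⟩]
      · exact hwm
      rcases hy.2.1 with rfl | h
      · exact hwall
      · exact h
  · push Not at hw
    obtain ⟨q, hadj, hq', hq⟩ := T.isTree.exists_adj_btw hne
    refine ⟨a, q, hadj, SimpleGraph.btw_left, hq', ?_, ?_⟩
    · refine (mem_cutBlock hadj ⟨edgeBtw_self, Or.inl rfl, ?_⟩).2 ha
      exact fun w _ h => h.1.eq_of_self
    · rw [mem_cutBlock (y := b) hadj ⟨edgeBtw_self, Or.inl rfl, ?_⟩]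
      · exact hb
      · intro w hwall hE
        by_contra hne
        have : w ≠ a := by rintro rfl; exact hq hE.2
        exact hne (hw w hwall hE.1 this)

/-- The blocks of two strands are compatible when the first strand is taken before the second. -/
theorem blockCompatible_cutBlock {P' : Finset V} {p' q' : V} (ha : T.graph.Adj p q)
    (ha' : T.graph.Adj p' q') (hP : P ⊆ P') :
    T.BlockCompatible (T.cutBlock p q P) (T.cutBlock p' q' P') := by
  -- A negative wall for both strands that stops the second one on its way to the first one.
  have key : ∀ {T : SignedTree V} {P P' : Finset V} {p q p' q' : V}, T.graph.Adj p q →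
      T.graph.Adj p' q' → P ⊆ P' → ∀ {x y : V}, T.IsFirstWall p' q' P' y x → y ∉ P' →
      y ∈ T.neg → ¬ T.EdgeBtw p q y x →
      T.NegSep (T.cutBlock p q P) (T.cutBlock p' q' P') ∨
        T.cutBlock p' q' P' ⊆ T.cutBlock p q P := by
    intro T P P' p q p' q' ha ha' hP x y hy hyP hyn hyE
    have hyP1 : y ∉ P := fun h => hyP (hP h)
    have hwall : T.IsWall P y := by simp [IsWall, hyn, hyP1]
    have hwall' : T.IsWall P' y := by simp [IsWall, hyn, hyP]
    have hsep := hy.1.btw_of_not ha hyE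
    have h2 : ∀ z ∈ T.cutBlock p' q' P', ¬ T.EdgeBtw p' q' y z := fun z hz hE =>
      hyP ((mem_cutBlock ha' ⟨hE, Or.inr hwall', hy.2.2⟩).1 hz)
    obtain ⟨b, hb⟩ := exists_isFirstWall (T := T) P p q y
    have hbw : T.IsWall P b := by
      rcases hb.2.1 with rfl | h
      · exact hwall
      · exact h
    by_cases hbP : b ∈ P
    · right
      intro z hz
      refine (mem_cutBlock ha ⟨?_, Or.inr hbw, hb.2.2⟩).2 hbP
      by_contra hc
      have hc' : ¬ T.EdgeBtw p q y z := fun h => hc (h.trans hb.1)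
      have := btw_of_edges hsep hc' (h2 z hz)
      rw [this.eq_of_self] at hc'
      exact hc' edgeBtw_self
    · left
      have h1 : ∀ z ∈ T.cutBlock p q P, ¬ T.EdgeBtw p q y z := fun z hz hE =>
        hbP ((mem_cutBlock ha ⟨hE.trans hb.1, Or.inr hbw, hb.2.2⟩).1 hz)
      exact ⟨y, hyn, fun h => h1 y h edgeBtw_self, fun h => h2 y h edgeBtw_self,
        fun z hz z' hz' => btw_of_edges hsep (h1 z hz) (h2 z' hz')⟩
  by_cases hsub : T.cutBlock p q P ⊆ T.cutBlock p' q' P'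
  · exact Or.inl hsub
  obtain ⟨x, hx, hx'⟩ := Finset.not_subset.1 hsub
  obtain ⟨y, hy⟩ := exists_isFirstWall (T := T) P p q x
  obtain ⟨y', hy'⟩ := exists_isFirstWall (T := T) P' p' q' x
  rw [mem_cutBlock ha hy] at hx
  rw [mem_cutBlock ha' hy'] at hx'
  have hx1 : y ∈ P' := hP hx
  have hx1' : y' ∉ P := fun h => hx' (hP h)
  by_cases hc : y' ∈ T.neg ∧ ¬ T.EdgeBtw p q y' x
  · rcases key ha ha' hP hy' hx' hc.1 hc.2 with h | h
    · exact Or.inr (Or.inr (Or.inl h))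
    · exact Or.inr (Or.inl h)
  by_cases hc' : y ∉ T.neg ∧ ¬ T.EdgeBtw p' q' y x
  · have := key (T := T.dual) ha' ha (Finset.compl_subset_compl.2 hP) (T.isFirstWall_dual.2 hy)
      (by simpa using hx) hc'.1 hc'.2
    rw [cutBlock_dual ha, cutBlock_dual ha', negSep_dual, Finset.compl_subset_compl] at this
    rcases this with h | h
    · exact Or.inr (Or.inr (Or.inr h.symm))
    · exact Or.inr (Or.inl h)
  exfalso
  have hxx : y ≠ y' := fun h => hx1' (h ▸ hx)
  have hyw : y = x ∨ (y ∉ T.neg ∧ T.EdgeBtw p' q' y x ∧ T.IsWall P' y) := by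
    by_cases h : y = x
    · exact Or.inl h
    · have h1 := hy.2.1.resolve_left h
      have h2 : y ∉ T.neg := by simpa [IsWall, hx] using h1
      exact Or.inr ⟨h2, by tauto, by simp [IsWall, h2, hx1]⟩
  have hyw' : y' = x ∨ (y' ∈ T.neg ∧ T.EdgeBtw p q y' x ∧ T.IsWall P y') := by
    by_cases h : y' = x
    · exact Or.inl h
    · have h1 := hy'.2.1.resolve_left h
      have h2 : y' ∈ T.neg := by simpa [IsWall, hx'] using h1
      exact Or.inr ⟨h2, by tauto, by simp [IsWall, h2, hx1']⟩
  rcases hyw with rfl | ⟨hn, hE, hw⟩ <;> rcases hyw' with rfl | ⟨hn', hE', hw'⟩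
  · exact hxx rfl
  · exact hxx (hy.2.2 _ hw' hE').symm
  · exact hxx (hy'.2.2 _ hw hE)
  · have e1 : T.EdgeBtw p q y y' := by
      rcases hy.1.total ha hE' with h | h
      · exact h
      · exact absurd (hy.2.2 _ hw' h).symm hxx
    have e2 : T.EdgeBtw p' q' y' y := by
      rcases hy'.1.total ha' hE with h | h
      · exact h
      · exact absurd (hy'.2.2 _ hw h) hxx
    have f1 := hE'.1.drop T.connected e1.1
    have f2 := hE.1.drop T.connected e2.1
    exact hxx (f1.symm.antisymm T.connected f2.symm).symm

/-- Every proper block is the block of a strand, for the vertices of the block itself. -/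
theorem IsProperBlock.exists_eq_cutBlock {B : Finset V} (hB : T.IsProperBlock B) :
    ∃ p q, T.graph.Adj p q ∧ B = T.cutBlock p q B := by
  obtain ⟨hB1, ⟨u, hu⟩, ⟨v, hv⟩⟩ := id hB
  rw [Finset.mem_compl] at hv
  obtain ⟨p, q, ha, hp, hq, hu', hv'⟩ := exists_cutBlock_separating (T := T) B hu hv
  refine ⟨p, q, ha, ?_⟩
  have key : ∀ {T : SignedTree V} {B : Finset V} {u p q : V}, T.IsProperBlock B →
      T.graph.Adj p q → u ∈ B → u ∈ T.cutBlock p q B → B ⊆ T.cutBlock p q B := by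
    intro T B u p q hB ha hu hu' x hx
    obtain ⟨y, hy⟩ := exists_isFirstWall (T := T) B p q x
    rw [mem_cutBlock ha hy]
    by_contra hyB
    have hw : T.IsWall B y := by
      rcases hy.2.1 with rfl | h
      · exact absurd hx hyB
      · exact h
    have hn : y ∈ T.neg := by simpa [IsWall, hyB] using hw
    have hE : ¬ T.EdgeBtw p q y u := fun hE =>
      hyB ((mem_cutBlock ha ⟨hE, Or.inr hw, hy.2.2⟩).1 hu')
    have hb : T.graph.Btw u y x := by
      obtain ⟨h1, h2⟩ := hy.1
      rw [EdgeBtw, not_and_or] at hE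
      rcases hE with hE | hE
      · exact ((h1.split u).resolve_left hE)
      · exact ((h2.split u).resolve_left hE)
    exact hyB (hB.neg_mem hu hx hn hb)
  apply (key hB ha hu hu').antisymm
  have := key (T := T.dual) (T.isProperBlock_dual.2 hB) ha (Finset.mem_compl.2 hv)
    (by rw [cutBlock_dual ha]; exact Finset.mem_compl.2 hv')
  rwa [cutBlock_dual ha, Finset.compl_subset_compl] at this

end CutBlock

end SignedTree

/-! ### Nested families of signed building blocks -/

namespace SignedTree

variable {V : Type*} [Fintype V] [DecidableEq V] {T : SignedTree V} {𝓑 : Set (Finset V)}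
  {B B₁ B₂ : Finset V} {u v x y z a : V}

variable (T) in
/-- A nested family: a set of pairwise compatible proper signed building blocks. -/
def IsNested (𝓑 : Set (Finset V)) : Prop :=
  (∀ B ∈ 𝓑, T.IsProperBlock B) ∧ ∀ B₁ ∈ 𝓑, ∀ B₂ ∈ 𝓑, T.BlockCompatible B₁ B₂

theorem IsNested.dual (h : T.IsNested 𝓑) : T.dual.IsNested (compl ⁻¹' 𝓑) := by
  refine ⟨fun B hB => ?_, fun B₁ h₁ B₂ h₂ => ?_⟩
  · have := T.isProperBlock_dual.2 (h.1 _ hB)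
    rwa [compl_compl] at this
  · have := blockCompatible_dual.2 (h.2 _ h₁ _ h₂)
    rwa [compl_compl, compl_compl] at this

theorem IsNested.subset {𝓑' : Set (Finset V)} (h : T.IsNested 𝓑) (hs : 𝓑' ⊆ 𝓑) :
    T.IsNested 𝓑' :=
  ⟨fun B hB => h.1 B (hs hB), fun B₁ h₁ B₂ h₂ => h.2 B₁ (hs h₁) B₂ (hs h₂)⟩

/-- The vertex `z` lies on the path from `x` to `y` in the tree that is dual to the family `𝓑`. -/
def OnPath (𝓑 : Set (Finset V)) (x z y : V) : Prop :=
  ∀ B ∈ 𝓑, (x ∈ B ↔ y ∈ B) → (z ∈ B ↔ x ∈ B)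

theorem OnPath.symm (h : OnPath 𝓑 x z y) : OnPath 𝓑 y z x := fun B hB hxy =>
  (h B hB hxy.symm).trans hxy.symm

theorem OnPath.dual (h : OnPath (compl ⁻¹' 𝓑) x z y) : OnPath 𝓑 x z y := fun B hB hxy => by
  have := h Bᶜ (by simpa using hB)
  simp only [Finset.mem_compl] at this
  tauto

/-- If `B₁` and `B₂` are separated by a negative vertex, then the first negative vertex outside `B₁`
on the path of `T` from `x ∈ B₁` to `y ∈ B₂` also lies on the path from `x` to `y` in the dual tree,
and it belongs to neither set. -/
theorem IsNested.onPath_of_negSep (h : T.IsNested 𝓑) (h₁ : B₁ ∈ 𝓑)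
    (hs : T.NegSep B₁ B₂) (hx : x ∈ B₁) (hy : y ∈ B₂) :
    ∃ z ∈ T.neg, T.graph.Btw x z y ∧ z ∉ B₁ ∧ z ∉ B₂ ∧ OnPath 𝓑 x z y := by
  classical
  have hC := T.connected
  obtain ⟨w, hwn, hw1, hw2, hw⟩ := id hs
  -- The first negative vertex outside `B₁` on the path from `x` to `y`.
  obtain ⟨z, hz, hmin⟩ := Finset.exists_min_image
    (Finset.univ.filter fun z => z ∈ T.neg ∧ z ∉ B₁ ∧ T.graph.Btw x z y) (T.graph.dist x)
    ⟨w, by simpa using ⟨hwn, hw1, hw x hx y hy⟩⟩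
  simp only [Finset.mem_filter, Finset.mem_univ, true_and] at hz hmin
  obtain ⟨hzn, hz1, hzb⟩ := hz
  have hfirst : ∀ w ∈ T.neg, w ∉ B₁ → T.graph.Btw x w z → w = z := fun w hwn hw1 hb => by
    by_contra hne
    exact absurd (hb.dist_lt hC hne) (not_lt.2 (hmin w ⟨hwn, hw1, hzb.trans hb⟩))
  refine ⟨z, hzn, hzb, hz1, fun hz2 => ?_, fun B hB hxy => ⟨fun hzB => ?_, fun hxB => ?_⟩⟩
  · rw [hfirst w hwn hw1 (hw x hx z hz2)] at hw2
    exact hw2 hz2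
  · by_contra hxB
    have hyB : y ∉ B := fun hyB => hxB (hxy.2 hyB)
    rcases h.2 B hB B₁ h₁ with hc | hc | hc | hc
    · exact hz1 (hc hzB)
    · exact hxB (hc hx)
    · obtain ⟨w', hwn', hwB', hw1', hw'⟩ := hc
      rw [hfirst w' hwn' hw1' (hw' z hzB x hx).symm] at hwB'
      exact hwB' hzB
    · exact hs.notMem (hc.mem hyB) hy
  · exact (h.1 B hB).neg_mem hxB (hxy.1 hxB) hzn hzb

theorem IsNested.onPath_of_posSep (h : T.IsNested 𝓑) (h₁ : B₁ ∈ 𝓑)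
    (hs : T.PosSep B₁ B₂) (hx : x ∉ B₁) (hy : y ∉ B₂) :
    ∃ z ∉ T.neg, T.graph.Btw x z y ∧ z ∈ B₁ ∧ z ∈ B₂ ∧ OnPath 𝓑 x z y := by
  obtain ⟨z, h1, h2, h3, h4, h5⟩ := h.dual.onPath_of_negSep (B₁ := B₁ᶜ) (B₂ := B₂ᶜ)
    (by simpa using h₁) (negSep_dual.2 hs) (Finset.mem_compl.2 hx)
    (Finset.mem_compl.2 hy)
  exact ⟨z, h1, h2, by simpa using h3, by simpa using h4, h5.dual⟩

/-- Between an element of the smaller block and an element outside the larger one, the path of the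
dual tree meets the difference of two nested blocks. -/
theorem IsNested.onPath_of_ssubset (h : T.IsNested 𝓑) (h₁ : B₁ ∈ 𝓑) (h₂ : B₂ ∈ 𝓑)
    (hs : B₁ ⊂ B₂) (hx : x ∈ B₁) (hy : y ∉ B₂) : ∃ z ∈ B₂, z ∉ B₁ ∧ OnPath 𝓑 x z y := by
  classical
  have hC := T.connected
  have hy1 : y ∉ B₁ := fun h => hy (hs.1 h)
  -- Each obstruction to `z` being on the path provides another candidate.
  have type1 : ∀ z ∈ B₂, z ∉ B₁ → ∀ B ∈ 𝓑, z ∈ B → x ∉ B → y ∉ B →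
      ∃ w ∈ T.neg, w ∈ B₂ ∧ w ∉ B₁ ∧ w ≠ z ∧ T.graph.Btw z w x := by
    intro z hz2 hz1 B hB hzB hxB hyB
    rcases h.2 B hB B₁ h₁ with hc | hc | hc | hc
    · exact absurd (hc hzB) hz1
    · exact absurd (hc hx) hxB
    · obtain ⟨w, hwn, hwB, hw1, hw⟩ := hc
      have hb := hw z hzB x hx
      exact ⟨w, hwn, (h.1 _ h₂).neg_mem hz2 (hs.1 hx) hwn hb, hw1, fun e => hwB (e ▸ hzB), hb⟩
    · exact absurd (hc.mem hyB) hy1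
  have type2 : ∀ z ∈ B₂, z ∉ B₁ → ∀ B ∈ 𝓑, z ∉ B → x ∈ B → y ∈ B →
      ∃ w ∉ T.neg, w ∈ B₂ ∧ w ∉ B₁ ∧ w ≠ z ∧ T.graph.Btw z w y := by
    intro z hz2 hz1 B hB hzB hxB hyB
    rcases h.2 B hB B₂ h₂ with hc | hc | hc | hc
    · exact absurd (hc hyB) hy
    · exact absurd (hc hz2) hzB
    · exact absurd (hs.1 hx) (hc.notMem hxB)
    · obtain ⟨w, hwn, hwB, hw2, hw⟩ := hc
      have hb := hw z hzB y hy
      exact ⟨w, hwn, hw2, (h.1 _ h₁).pos_notMem hz1 hy1 hwn hb, fun e => hzB (e ▸ hwB), hb⟩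
  have fin : ∀ z ∈ B₂, z ∉ B₁ → (∀ B ∈ 𝓑, z ∈ B → x ∉ B → y ∉ B → False) →
      (∀ B ∈ 𝓑, z ∉ B → x ∈ B → y ∈ B → False) → ∃ z ∈ B₂, z ∉ B₁ ∧ OnPath 𝓑 x z y := by
    intro z hz2 hz1 f1 f2
    refine ⟨z, hz2, hz1, fun B hB hxy => ?_⟩
    have e1 := f1 B hB
    have e2 := f2 B hB
    tauto
  by_cases hneg : ∃ z ∈ T.neg, z ∈ B₂ ∧ z ∉ B₁ ∧ T.graph.Btw x z y
  · obtain ⟨z, hz, hmin⟩ := Finset.exists_min_image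
      (Finset.univ.filter fun z => z ∈ T.neg ∧ z ∈ B₂ ∧ z ∉ B₁ ∧ T.graph.Btw x z y)
      (T.graph.dist x) (by obtain ⟨z, hz⟩ := hneg; exact ⟨z, by simpa using hz⟩)
    simp only [Finset.mem_filter, Finset.mem_univ, true_and] at hz hmin
    obtain ⟨hzn, hz2, hz1, hzb⟩ := hz
    refine fin z hz2 hz1 (fun B hB hzB hxB hyB => ?_) (fun B hB hzB hxB hyB => ?_)
    · obtain ⟨w, hwn, hw2, hw1, hwz, hwb⟩ := type1 z hz2 hz1 B hB hzB hxB hyB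
      exact absurd (hwb.symm.dist_lt hC hwz)
        (not_lt.2 (hmin w ⟨hwn, hw2, hw1, hzb.trans hwb.symm⟩))
    · exact hzB ((h.1 B hB).neg_mem hxB hyB hzn hzb)
  by_cases hpos : ∃ z ∉ T.neg, z ∈ B₂ ∧ z ∉ B₁ ∧ T.graph.Btw x z y
  · obtain ⟨z, hz, hmin⟩ := Finset.exists_min_image
      (Finset.univ.filter fun z => z ∉ T.neg ∧ z ∈ B₂ ∧ z ∉ B₁ ∧ T.graph.Btw x z y)
      (T.graph.dist y) (by obtain ⟨z, hz⟩ := hpos; exact ⟨z, by simpa using hz⟩)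
    simp only [Finset.mem_filter, Finset.mem_univ, true_and] at hz hmin
    obtain ⟨hzn, hz2, hz1, hzb⟩ := hz
    refine fin z hz2 hz1 (fun B hB hzB hxB hyB => ?_) (fun B hB hzB hxB hyB => ?_)
    · exact (h.1 B hB).pos_notMem hxB hyB hzn hzb hzB
    · obtain ⟨w, hwn, hw2, hw1, hwz, hwb⟩ := type2 z hz2 hz1 B hB hzB hxB hyB
      exact absurd (hwb.symm.dist_lt hC hwz)
        (not_lt.2 (hmin w ⟨hwn, hw2, hw1, (hzb.symm.trans hwb.symm).symm⟩))
  -- No candidate lies between `x` and `y`: the obstructions bring us closer to both of them.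
  have hno : ∀ z ∈ B₂, z ∉ B₁ → ¬ T.graph.Btw x z y := fun z hz2 hz1 hzb => by
    by_cases hzn : z ∈ T.neg
    · exact hneg ⟨z, hzn, hz2, hz1, hzb⟩
    · exact hpos ⟨z, hzn, hz2, hz1, hzb⟩
  obtain ⟨z, hz, hmin⟩ := Finset.exists_min_image (B₂ \ B₁) (T.graph.dist x)
    (by
      obtain ⟨z, hz, hz'⟩ := Finset.exists_of_ssubset hs
      exact ⟨z, Finset.mem_sdiff.2 ⟨hz, hz'⟩⟩)
  rw [Finset.mem_sdiff] at hz
  refine fin z hz.1 hz.2 (fun B hB hzB hxB hyB => ?_) (fun B hB hzB hxB hyB => ?_)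
  · obtain ⟨w, hwn, hw2, hw1, hwz, hwb⟩ := type1 z hz.1 hz.2 B hB hzB hxB hyB
    exact absurd (hwb.symm.dist_lt hC hwz) (not_lt.2 (hmin w (Finset.mem_sdiff.2 ⟨hw2, hw1⟩)))
  · obtain ⟨w, hwn, hw2, hw1, hwz, hwb⟩ := type2 z hz.1 hz.2 B hB hzB hxB hyB
    have hwb' : T.graph.Btw z w x :=
      (hwb.split x).resolve_right (hno w hw2 hw1)
    exact absurd (hwb'.symm.dist_lt hC hwz) (not_lt.2 (hmin w (Finset.mem_sdiff.2 ⟨hw2, hw1⟩)))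

/-- Two compatible blocks do not cross: one of the four regions that they cut out is empty. -/
theorem BlockCompatible.not_crossing (h : T.BlockCompatible B₁ B₂) {w : V} (hx : x ∈ B₁)
    (hx' : x ∈ B₂) (hy : y ∈ B₁) (hy' : y ∉ B₂) (hz : z ∉ B₁) (hz' : z ∈ B₂) (hw : w ∉ B₁)
    (hw' : w ∉ B₂) : False := by
  rcases h with h | h | h | h
  · exact hy' (h hy)
  · exact hz (h hz')
  · exact h.notMem hx hx'
  · exact hw' (h.mem hw)

/-- In the tree dual to a nested family, a path with at least two edges has an interior vertex:
this is why the nodes of spines have non-empty labels. -/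
theorem IsNested.exists_onPath (h : T.IsNested 𝓑) (h₁ : B₁ ∈ 𝓑) (h₂ : B₂ ∈ 𝓑) (hne : B₁ ≠ B₂)
    (hs₁ : ¬ (x ∈ B₁ ↔ y ∈ B₁)) (hs₂ : ¬ (x ∈ B₂ ↔ y ∈ B₂)) :
    ∃ z, OnPath 𝓑 x z y ∧ (∃ B ∈ 𝓑, ¬ (x ∈ B ↔ z ∈ B)) ∧ ∃ B ∈ 𝓑, ¬ (z ∈ B ↔ y ∈ B) := by
  have up : ∀ {x y B₁ B₂}, B₁ ∈ 𝓑 → B₂ ∈ 𝓑 → B₁ ≠ B₂ → x ∈ B₁ → y ∉ B₁ → x ∈ B₂ → y ∉ B₂ →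
      ∃ z, OnPath 𝓑 x z y ∧ (∃ B ∈ 𝓑, ¬ (x ∈ B ↔ z ∈ B)) ∧ ∃ B ∈ 𝓑, ¬ (z ∈ B ↔ y ∈ B) := by
    intro x y B₁ B₂ h₁ h₂ hne hx1 hy1 hx2 hy2
    rcases h.2 _ h₁ _ h₂ with hc | hc | hc | hc
    · obtain ⟨z, hz2, hz1, hz⟩ := h.onPath_of_ssubset h₁ h₂ (hc.ssubset_of_ne hne) hx1 hy2
      exact ⟨z, hz, ⟨B₁, h₁, by tauto⟩, ⟨B₂, h₂, by tauto⟩⟩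
    · obtain ⟨z, hz2, hz1, hz⟩ := h.onPath_of_ssubset h₂ h₁ (hc.ssubset_of_ne hne.symm) hx2 hy1
      exact ⟨z, hz, ⟨B₂, h₂, by tauto⟩, ⟨B₁, h₁, by tauto⟩⟩
    · exact absurd hx2 (hc.notMem hx1)
    · exact absurd (hc.mem hy1) hy2
  have mixed : ∀ {x y B₁ B₂}, B₁ ∈ 𝓑 → B₂ ∈ 𝓑 → x ∈ B₁ → y ∉ B₁ → x ∉ B₂ → y ∈ B₂ →
      ∃ z, OnPath 𝓑 x z y ∧ (∃ B ∈ 𝓑, ¬ (x ∈ B ↔ z ∈ B)) ∧ ∃ B ∈ 𝓑, ¬ (z ∈ B ↔ y ∈ B) := by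
    intro x y B₁ B₂ h₁ h₂ hx1 hy1 hx2 hy2
    rcases h.2 _ h₁ _ h₂ with hc | hc | hc | hc
    · exact absurd (hc hx1) hx2
    · exact absurd (hc hy2) hy1
    · obtain ⟨z, -, -, hz1, hz2, hz⟩ := h.onPath_of_negSep h₁ hc hx1 hy2
      exact ⟨z, hz, ⟨B₁, h₁, by tauto⟩, ⟨B₂, h₂, by tauto⟩⟩
    · obtain ⟨z, -, -, hz1, hz2, hz⟩ := h.onPath_of_posSep h₂ hc.symm hx2 hy1
      exact ⟨z, hz, ⟨B₂, h₂, by tauto⟩, ⟨B₁, h₁, by tauto⟩⟩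
  have flip : (∃ z, OnPath 𝓑 y z x ∧ (∃ B ∈ 𝓑, ¬ (y ∈ B ↔ z ∈ B)) ∧ ∃ B ∈ 𝓑, ¬ (z ∈ B ↔ x ∈ B)) →
      ∃ z, OnPath 𝓑 x z y ∧ (∃ B ∈ 𝓑, ¬ (x ∈ B ↔ z ∈ B)) ∧ ∃ B ∈ 𝓑, ¬ (z ∈ B ↔ y ∈ B) := by
    rintro ⟨z, h1, ⟨B, hB, hb⟩, ⟨B', hB', hb'⟩⟩
    exact ⟨z, h1.symm, ⟨B', hB', by tauto⟩, ⟨B, hB, by tauto⟩⟩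
  by_cases hx1 : x ∈ B₁ <;> by_cases hx2 : x ∈ B₂
  · exact up h₁ h₂ hne hx1 (by tauto) hx2 (by tauto)
  · exact mixed h₁ h₂ hx1 (by tauto) hx2 (by tauto)
  · exact flip (mixed h₁ h₂ (by tauto) hx1 (by tauto) hx2)
  · exact flip (up h₁ h₂ hne (by tauto) hx1 (by tauto) hx2)

open Classical in
/-- The members of `𝓑` that separate `x` and `y`. -/
noncomputable def separators (𝓑 : Set (Finset V)) (x y : V) : Finset (Finset V) :=
  {B | B ∈ 𝓑 ∧ ¬ (x ∈ B ↔ y ∈ B)}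

theorem mem_separators : B ∈ separators 𝓑 x y ↔ B ∈ 𝓑 ∧ ¬ (x ∈ B ↔ y ∈ B) := by
  simp [separators]

theorem separators_comm (𝓑 : Set (Finset V)) (x y : V) : separators 𝓑 x y = separators 𝓑 y x := by
  ext B; simp only [mem_separators]; tauto

theorem OnPath.disjoint_separators (h : OnPath 𝓑 x z y) :
    Disjoint (separators 𝓑 x z) (separators 𝓑 z y) := by
  rw [Finset.disjoint_left]
  intro B hB hB'
  rw [mem_separators] at hB hB'
  have := h B hB.1
  tauto

theorem OnPath.separators_eq (h : OnPath 𝓑 x z y) :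
    separators 𝓑 x y = separators 𝓑 x z ∪ separators 𝓑 z y := by
  ext B
  simp only [Finset.mem_union, mem_separators]
  have := h B
  tauto

theorem OnPath.trans {w : V} (h : OnPath 𝓑 x z y) (h' : OnPath 𝓑 x w z) : OnPath 𝓑 x w y :=
  fun B hB hxy => h' B hB (h B hB hxy).symm

/-- The dual tree has an arc from the node of `u` to the node of `v` that corresponds to `B`. -/
def IsArc (𝓑 : Set (Finset V)) (B : Finset V) (u v : V) : Prop :=
  B ∈ 𝓑 ∧ u ∈ B ∧ v ∉ B ∧ ∀ B' ∈ 𝓑, B' ≠ B → (u ∈ B' ↔ v ∈ B')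

theorem IsArc.separators_eq (h : IsArc 𝓑 B u v) : separators 𝓑 u v = {B} := by
  ext B'
  rw [mem_separators, Finset.mem_singleton]
  constructor
  · rintro ⟨h1, h2⟩
    by_contra hne
    exact h2 (h.2.2.2 B' h1 hne)
  · rintro rfl
    exact ⟨h.1, fun e => h.2.2.1 (e.1 h.2.1)⟩

theorem isArc_or_of_separators_eq (h : separators 𝓑 x y = {B}) :
    IsArc 𝓑 B x y ∨ IsArc 𝓑 B y x := by
  have hB := mem_separators.1 (h ▸ Finset.mem_singleton_self B)
  have hu : ∀ B' ∈ 𝓑, B' ≠ B → (x ∈ B' ↔ y ∈ B') := fun B' hB' hne => by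
    by_contra hc
    exact hne (Finset.mem_singleton.1 (h ▸ mem_separators.2 ⟨hB', hc⟩))
  by_cases hx : x ∈ B
  · exact Or.inl ⟨hB.1, hx, by tauto, hu⟩
  · exact Or.inr ⟨hB.1, by tauto, hx, fun B' h1 h2 => (hu B' h1 h2).symm⟩

/-- The first arc on the path from `x` to `y` in the dual tree. -/
theorem IsNested.exists_step (h : T.IsNested 𝓑) : ∀ {x y : V}, (separators 𝓑 x y).Nonempty →
    ∃ z B, separators 𝓑 x z = {B} ∧ OnPath 𝓑 x z y := by
  suffices H : ∀ n : ℕ, ∀ {x y : V}, (separators 𝓑 x y).card = n → (separators 𝓑 x y).Nonempty →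
      ∃ z B, separators 𝓑 x z = {B} ∧ OnPath 𝓑 x z y from @fun _ _ hs => H _ rfl hs
  intro n
  induction n using Nat.strong_induction_on with
  | _ n ih =>
  intro x y hn hne
  obtain ⟨B₁, h₁⟩ := id hne
  by_cases hu : ∃ B₂ ∈ separators 𝓑 x y, B₁ ≠ B₂
  · obtain ⟨B₂, h₂, hne⟩ := hu
    rw [mem_separators] at h₁ h₂
    obtain ⟨z, hz, ⟨B, hB, hb⟩, ⟨B', hB', hb'⟩⟩ := h.exists_onPath h₁.1 h₂.1 hne h₁.2 h₂.2
    have hlt : (separators 𝓑 x z).card < n := by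
      rw [← hn, hz.separators_eq, Finset.card_union_of_disjoint hz.disjoint_separators]
      have : 0 < (separators 𝓑 z y).card := Finset.card_pos.2 ⟨B', mem_separators.2 ⟨hB', hb'⟩⟩
      omega
    obtain ⟨z', C, hC, hz'⟩ := ih _ hlt rfl ⟨B, mem_separators.2 ⟨hB, hb⟩⟩
    exact ⟨z', C, hC, hz.trans hz'⟩
  · push Not at hu
    exact ⟨y, B₁, Finset.eq_singleton_iff_unique_mem.2 ⟨h₁, fun B hB => (hu B hB).symm⟩,
      fun B hB hxy => hxy.symm⟩

/-- Induction along the paths of the dual tree. -/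
theorem IsNested.path_induction (h : T.IsNested 𝓑) {motive : V → V → Prop}
    (nil : ∀ x y, separators 𝓑 x y = ∅ → motive x y)
    (cons : ∀ x z y B, separators 𝓑 x z = {B} → OnPath 𝓑 x z y → motive z y → motive x y)
    (x y : V) : motive x y := by
  suffices H : ∀ n : ℕ, ∀ x, (separators 𝓑 x y).card = n → motive x y from H _ x rfl
  intro n
  induction n with
  | zero => exact fun x hx => nil x y (Finset.card_eq_zero.1 hx)
  | succ n ih =>
    intro x hx
    obtain ⟨z, B, hB, hz⟩ := h.exists_step (x := x) (y := y) (Finset.card_pos.1 (by omega))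
    refine cons x z y B hB hz (ih z ?_)
    rw [hz.separators_eq, Finset.card_union_of_disjoint hz.disjoint_separators, hB,
      Finset.card_singleton] at hx
    omega

theorem IsNested.exists_isArc (h : T.IsNested 𝓑) (hB : B ∈ 𝓑) : ∃ u v, IsArc 𝓑 B u v := by
  obtain ⟨-, ⟨u, hu⟩, ⟨v, hv⟩⟩ := h.1 B hB
  rw [Finset.mem_compl] at hv
  have := h.path_induction (motive := fun x y => x ∈ B → y ∉ B → ∃ u v, IsArc 𝓑 B u v)
    (fun x y he hx hy => by
      have : B ∈ separators 𝓑 x y := mem_separators.2 ⟨hB, by tauto⟩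
      simp [he] at this)
    (fun x z y C hC hz ih hx hy => by
      by_cases hzB : z ∈ B
      · exact ih hzB hy
      · have : B ∈ separators 𝓑 x z := mem_separators.2 ⟨hB, by tauto⟩
        rw [hC, Finset.mem_singleton] at this
        subst this
        rcases isArc_or_of_separators_eq hC with h1 | h1
        · exact ⟨_, _, h1⟩
        · exact ⟨_, _, h1⟩)
  exact this u v hu hv

/-- The two ends of an arc are determined by its block, up to elements which the family does not
separate. -/
theorem IsArc.mem_iff (h : T.IsNested 𝓑) {u' v' : V} (ha : IsArc 𝓑 B u v)
    (ha' : IsArc 𝓑 B u' v') {C : Finset V} (hC : C ∈ 𝓑) :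
    (u ∈ C ↔ u' ∈ C) ∧ (v ∈ C ↔ v' ∈ C) := by
  by_cases hCB : C = B
  · subst hCB
    exact ⟨iff_of_true ha.2.1 ha'.2.1, iff_of_false ha.2.2.1 ha'.2.2.1⟩
  have e1 := ha.2.2.2 C hC hCB
  have e2 := ha'.2.2.2 C hC hCB
  have hc := h.2 B ha.1 C hC
  rw [← e1, ← e2, and_self]
  by_cases h1 : u ∈ C <;> by_cases h2 : u' ∈ C
  · tauto
  · exact (hc.not_crossing ha.2.1 h1 ha'.2.1 h2 ha.2.2.1 (e1.1 h1) ha'.2.2.1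
      (fun h => h2 (e2.2 h))).elim
  · exact (hc.not_crossing ha'.2.1 h2 ha.2.1 h1 ha'.2.2.1 (e2.1 h2) ha.2.2.1
      (fun h => h1 (e1.2 h))).elim
  · tauto

/-- The family `𝓑` separates the points of `V`: the nodes of the dual tree are singletons. -/
def IsSeparating (𝓑 : Set (Finset V)) : Prop := ∀ x y, (∀ B ∈ 𝓑, x ∈ B ↔ y ∈ B) → x = y

theorem IsArc.unique (h : T.IsNested 𝓑) (hs : IsSeparating 𝓑) {u' v' : V} (ha : IsArc 𝓑 B u v)
    (ha' : IsArc 𝓑 B u' v') : u = u' ∧ v = v' :=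
  ⟨hs _ _ fun _ hC => (ha.mem_iff h ha' hC).1, hs _ _ fun _ hC => (ha.mem_iff h ha' hC).2⟩

/-- If `C` is compatible, on the correct side, with a block `M` that avoids `a`, then `C` is
compatible with each block `B` whose side away from `a` lies in `M`. -/
theorem blockCompatible_of_near {B C M : Finset V} (hMC : M ⊆ C ∨ T.NegSep M C)
    (hMB : T.BlockCompatible M B) (ha : a ∉ M) (hB : Bᶜ.Nonempty)
    (h : B ⊆ M ∨ (a ∈ B ∧ Bᶜ ⊆ M)) : T.BlockCompatible C B := by
  rcases h with h | ⟨haB, h⟩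
  · rcases hMC with h1 | ⟨w, hwn, hw1, hw2, hw⟩
    · exact Or.inr (Or.inl (h.trans h1))
    · exact Or.inr (Or.inr (Or.inl ⟨w, hwn, hw2, fun hB => hw1 (h hB),
        fun x hx y hy => (hw y (h hy) x hx).symm⟩))
  · have hP : T.PosSep M B := by
      obtain ⟨x, hx⟩ := hB
      rcases hMB with h1 | h1 | ⟨w, -, hw1, hw2, -⟩ | h1
      · exact absurd (h1 (h hx)) (Finset.mem_compl.1 hx)
      · exact absurd (h1 haB) ha
      · exact absurd (h (Finset.mem_compl.2 hw2)) hw1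
      · exact h1
    rcases hMC with h1 | h1
    · obtain ⟨w, hwn, hw1, hw2, hw⟩ := hP
      exact Or.inr (Or.inr (Or.inr ⟨w, hwn, h1 hw1, hw2, fun x hx y hy =>
        hw x (fun hx' => hx (h1 hx')) y hy⟩))
    · left
      intro x hx
      exact hP.mem fun hxM => h1.notMem hxM hx

/-- A node of the dual tree with at least two elements can be split. -/
theorem IsNested.exists_insert (h : T.IsNested 𝓑) {a' : V} (hne : a ≠ a')
    (hsep : ∀ B ∈ 𝓑, a ∈ B ↔ a' ∈ B) : ∃ C, a ∈ C ∧ a' ∉ C ∧ T.IsNested (insert C 𝓑) := by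
  classical
  -- The side of `B` that does not contain `a`.
  let far : Finset V → Finset V := fun B => if a ∈ B then Bᶜ else B
  have far_out : ∀ {B}, a ∈ B → far B = Bᶜ := fun h => by simp [far, h]
  have far_in : ∀ {B}, a ∉ B → far B = B := fun h => by simp [far, h]
  let Near : Finset V → Prop := fun M => M ∈ 𝓑 ∧ ∀ B ∈ 𝓑, far M ⊆ far B → far B = far M
  have hnear : ∀ B ∈ 𝓑, ∃ M, Near M ∧ far B ⊆ far M := by
    intro B hB
    obtain ⟨M, hM, hmax⟩ := Finset.exists_max_image
      (Finset.univ.filter fun M => M ∈ 𝓑 ∧ far B ⊆ far M) (fun M => (far M).card)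
      ⟨B, by simpa using hB⟩
    simp only [Finset.mem_filter, Finset.mem_univ, true_and] at hM hmax
    exact ⟨M, ⟨hM.1, fun B' hB' hs => (Finset.eq_of_subset_of_card_le hs
      (hmax B' ⟨hB', hM.2.trans hs⟩)).symm⟩, hM.2⟩
  -- The new block comes from the moment where `a` and the nodes below are swept.
  let P : Finset V := {x | x = a ∨ ∃ M, Near M ∧ a ∉ M ∧ x ∈ M}
  have haP : a ∈ P := by simp [P]
  have ha'P : a' ∉ P := by
    simp only [P, Finset.mem_filter, Finset.mem_univ, true_and, not_or, not_exists]
    refine ⟨hne.symm, fun M hM => ?_⟩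
    have := hsep M hM.1.1
    tauto
  obtain ⟨p, q, hadj, -, -, haC, ha'C⟩ := exists_cutBlock_separating (T := T) P haP ha'P
  set C := T.cutBlock p q P with hC
  have hin : ∀ M, Near M → a ∉ M → M ⊆ C ∨ T.NegSep M C := by
    intro M hM haM
    have ha'M : a' ∉ M := fun h => haM ((hsep M hM.1).2 h)
    obtain ⟨p', q', hadj', heq⟩ := (h.1 M hM.1).exists_eq_cutBlock
    have hMP : M ⊆ P := fun x hx => by
      simp only [P, Finset.mem_filter, Finset.mem_univ, true_and]
      exact Or.inr ⟨M, hM, haM, hx⟩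
    have := blockCompatible_cutBlock (T := T) hadj' hadj hMP
    rw [← heq, ← hC] at this
    rcases this with h1 | h1 | h1 | h1
    · exact Or.inl h1
    · exact absurd (h1 haC) haM
    · exact Or.inr h1
    · exact absurd (h1.mem ha'M) ha'C
  have hout : ∀ M, Near M → a ∈ M → C ⊆ M ∨ T.PosSep M C := by
    intro M hM haM
    have ha'M : a' ∈ M := (hsep M hM.1).1 haM
    obtain ⟨p', q', hadj', heq⟩ := (h.1 M hM.1).exists_eq_cutBlock
    have hPM : P ⊆ M := fun x hx => by
      simp only [P, Finset.mem_filter, Finset.mem_univ, true_and] at hx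
      rcases hx with rfl | ⟨I, hI, haI, hx⟩
      · exact haM
      · have e1 := hM.2 I hI.1
        have e2 := hI.2 M hM.1
        rw [far_out haM, far_in haI] at e1 e2
        rcases h.2 I hI.1 M hM.1 with h1 | h1 | h1 | h1
        · exact h1 hx
        · exact absurd (h1 haM) haI
        · have h2 : I ⊆ Mᶜ := fun y hy => Finset.mem_compl.2 (h1.notMem hy)
          obtain ⟨w, -, hw1, hw2, -⟩ := h1
          rw [← e2 h2, Finset.mem_compl] at hw1
          exact absurd hw2 hw1
        · have h2 : Mᶜ ⊆ I := fun y hy => h1.symm.mem (Finset.mem_compl.1 hy)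
          obtain ⟨w, -, hw1, hw2, -⟩ := h1
          rw [e1 h2, Finset.mem_compl] at hw1
          exact absurd hw2 hw1
    have := blockCompatible_cutBlock (T := T) hadj hadj' hPM
    rw [← heq, ← hC] at this
    rcases this with h1 | h1 | h1 | h1
    · exact Or.inl h1
    · exact absurd (h1 ha'M) ha'C
    · exact absurd haM (h1.notMem haC)
    · exact Or.inr h1.symm
  have hcomp : ∀ B ∈ 𝓑, T.BlockCompatible C B := by
    intro B hB
    obtain ⟨M, hM, hBM⟩ := hnear B hB
    obtain ⟨-, hBn, hBc⟩ := h.1 B hB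
    by_cases haM : a ∈ M
    · rw [far_out haM] at hBM
      rw [← blockCompatible_dual]
      refine blockCompatible_of_near (M := Mᶜ) (a := a) ?_ (blockCompatible_dual.2
        (h.2 M hM.1 B hB)) (by simpa using haM) (by simpa using hBn) ?_
      · rw [Finset.compl_subset_compl, negSep_dual]
        exact hout M hM haM
      · by_cases haB : a ∈ B
        · rw [far_out haB] at hBM
          exact Or.inl hBM
        · rw [far_in haB] at hBM
          exact Or.inr ⟨Finset.mem_compl.2 haB, by rwa [compl_compl]⟩
    · rw [far_in haM] at hBM
      refine blockCompatible_of_near (hin M hM haM) (h.2 M hM.1 B hB) haM hBc ?_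
      by_cases haB : a ∈ B
      · rw [far_out haB] at hBM
        exact Or.inr ⟨haB, hBM⟩
      · rw [far_in haB] at hBM
        exact Or.inl hBM
  refine ⟨C, haC, ha'C, ?_, ?_⟩
  · rintro B (rfl | hB)
    · exact ⟨cutBlock_mem_buildingSet hadj, ⟨a, haC⟩, ⟨a', Finset.mem_compl.2 ha'C⟩⟩
    · exact h.1 B hB
  · rintro B₁ (rfl | h₁) B₂ (rfl | h₂)
    · exact Or.inl subset_rfl
    · exact hcomp _ h₂
    · exact (hcomp _ h₁).symm
    · exact h.2 _ h₁ _ h₂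

/-- By `IsNested.exists_insert`, a maximal nested family separates any two vertices. -/
theorem IsNested.exists_isSeparating (h : T.IsNested 𝓑) :
    ∃ 𝓑', 𝓑 ⊆ 𝓑' ∧ T.IsNested 𝓑' ∧ IsSeparating 𝓑' := by
  obtain ⟨𝓑', hle, hmax⟩ := Set.Finite.exists_le_maximal
    (Set.toFinite {𝓑' : Set (Finset V) | T.IsNested 𝓑'}) h
  refine ⟨𝓑', hle, hmax.1, fun x y hxy => ?_⟩
  by_contra hne
  obtain ⟨C, hx, hy, hC⟩ := hmax.1.exists_insert hne hxy
  have := hmax.2 hC (Set.subset_insert C 𝓑') (Set.mem_insert C 𝓑')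
  exact hy ((hxy C this).1 hx)

/-- The fan is complete: every vector `g` is weakly increasing along the arcs of the dual tree of
some maximal nested family. The blocks are those of the strands met when the vertices are swept by
increasing values of `g`. -/
theorem exists_isNested_monotone (T : SignedTree V) (g : V → ℝ) :
    ∃ 𝓑, T.IsNested 𝓑 ∧ IsSeparating 𝓑 ∧ ∀ B u v, IsArc 𝓑 B u v → g u ≤ g v := by
  classical
  let low : ℝ → Finset V := fun t => {x | g x ≤ t}
  have hlow : ∀ {s t}, s ≤ t → low s ⊆ low t := fun hst x hx => by
    simp only [low, Finset.mem_filter, Finset.mem_univ, true_and] at hx ⊢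
    exact hx.trans hst
  let 𝓖 : Set (Finset V) := {B | T.IsProperBlock B ∧
    ∃ t p q, T.graph.Adj p q ∧ B = T.cutBlock p q (low t)}
  have h𝓖 : T.IsNested 𝓖 := by
    refine ⟨fun B hB => hB.1, ?_⟩
    rintro B₁ ⟨-, t₁, p₁, q₁, h₁, rfl⟩ B₂ ⟨-, t₂, p₂, q₂, h₂, rfl⟩
    rcases le_total t₁ t₂ with ht | ht
    · exact blockCompatible_cutBlock h₁ h₂ (hlow ht)
    · exact (blockCompatible_cutBlock h₂ h₁ (hlow ht)).symm
  obtain ⟨𝓑, hsub, hn, hs⟩ := h𝓖.exists_isSeparating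
  refine ⟨𝓑, hn, hs, fun B u v ha => ?_⟩
  by_contra! hlt
  have hv : v ∈ low (g v) := by simp [low]
  have hu : u ∉ low (g v) := by simpa [low] using hlt
  obtain ⟨p, q, hadj, -, -, hv', hu'⟩ := exists_cutBlock_separating (T := T) _ hv hu
  have hmem : T.cutBlock p q (low (g v)) ∈ 𝓑 := hsub
    ⟨⟨cutBlock_mem_buildingSet hadj, ⟨v, hv'⟩, ⟨u, Finset.mem_compl.2 hu'⟩⟩, _, p, q, hadj, rfl⟩
  by_cases he : T.cutBlock p q (low (g v)) = B
  · exact hu' (he ▸ ha.2.1)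
  · exact hu' ((ha.2.2.2 _ hmem he).2 hv')

end SignedTree

/-! ### The vertex of a maximal nested family -/

namespace SignedTree

variable {V : Type*} [Fintype V] [DecidableEq V] {T : SignedTree V} {𝓑 : Set (Finset V)}
  {B C : Finset V} {u v x y z a : V}

/-- The indicator function of `C`. -/
def indic (C : Finset V) (x : V) : ℝ := if x ∈ C then 1 else 0

theorem indic_of_mem (h : x ∈ C) : indic C x = 1 := if_pos h

theorem indic_of_notMem (h : x ∉ C) : indic C x = 0 := if_neg h

theorem indic_eq_iff : indic C x = indic C y ↔ (x ∈ C ↔ y ∈ C) := by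
  unfold indic
  split_ifs <;> simp_all

theorem sum_mul_indic (C : Finset V) (f : V → ℝ) : ∑ x, f x * indic C x = ∑ x ∈ C, f x := by
  simp [indic]

theorem separators_eq_empty (hs : IsSeparating 𝓑) (h : separators 𝓑 x y = ∅) : x = y :=
  hs x y fun B hB => by
    by_contra hc
    have : B ∈ separators 𝓑 x y := mem_separators.2 ⟨hB, hc⟩
    simp [h] at this

/-- On the path from `x` to `y` in the dual tree, the arcs that leave the block `C` exceed in number
those that enter it by at most one, and only if `C` separates `x` from `y`. -/
theorem IsNested.path_sum_nonneg (h : T.IsNested 𝓑) (hs : IsSeparating 𝓑)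
    (hC : C ∈ T.buildingSet) {δ : Finset V → ℝ}
    (hδ : ∀ B u v, IsArc 𝓑 B u v → δ B = indic C v - indic C u) (x y : V) :
    0 ≤ |indic C x - indic C y| + ∑ B ∈ separators 𝓑 x y, δ B := by
  rw [mem_buildingSet_iff] at hC
  suffices H : ∀ n : ℕ, ∀ x y, (separators 𝓑 x y).card = n →
      0 ≤ |indic C x - indic C y| + ∑ B ∈ separators 𝓑 x y, δ B from H _ x y rfl
  intro n
  induction n using Nat.strong_induction_on with
  | _ n ih =>
  intro x y hn
  have ihl : ∀ {z}, OnPath 𝓑 x z y → (separators 𝓑 z y).Nonempty →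
      0 ≤ |indic C x - indic C z| + ∑ B ∈ separators 𝓑 x z, δ B := fun {z} hz hne =>
    ih _ (by
      rw [← hn, hz.separators_eq, Finset.card_union_of_disjoint hz.disjoint_separators]
      have := Finset.card_pos.2 hne
      omega) x z rfl
  have ihr : ∀ {z}, OnPath 𝓑 x z y → (separators 𝓑 x z).Nonempty →
      0 ≤ |indic C z - indic C y| + ∑ B ∈ separators 𝓑 z y, δ B := fun {z} hz hne =>
    ih _ (by
      rw [← hn, hz.separators_eq, Finset.card_union_of_disjoint hz.disjoint_separators]
      have := Finset.card_pos.2 hne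
      omega) z y rfl
  by_cases hmid : ∃ z, OnPath 𝓑 x z y ∧ (separators 𝓑 x z).Nonempty ∧
      (separators 𝓑 z y).Nonempty ∧ (indic C z = indic C x ∨ indic C z = indic C y)
  · obtain ⟨z, hz, h1, h2, h3⟩ := hmid
    have e1 := ihl hz h2
    have e2 := ihr hz h1
    rw [hz.separators_eq, Finset.sum_union hz.disjoint_separators]
    rcases h3 with h3 | h3
    · rw [h3, sub_self, abs_zero] at e1
      rw [h3] at e2
      linarith
    · rw [h3, sub_self, abs_zero] at e2
      rw [h3] at e1
      linarith
  -- From now on, the interior vertices of the path are not on the same side of `C` as the ends.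
  push Not at hmid
  by_cases hxy : separators 𝓑 x y = ∅
  · rw [hxy, Finset.sum_empty]
    positivity
  obtain ⟨z₁, B₁, hB₁, hz₁⟩ := h.exists_step (Finset.nonempty_iff_ne_empty.2 hxy)
  have harc₁ := isArc_or_of_separators_eq hB₁
  by_cases hz₁y : separators 𝓑 z₁ y = ∅
  · obtain rfl := separators_eq_empty hs hz₁y
    rw [hB₁, Finset.sum_singleton]
    have h1 := neg_abs_le (indic C x - indic C z₁)
    have h2 := le_abs_self (indic C x - indic C z₁)
    rcases harc₁ with ha | ha <;> rw [hδ _ _ _ ha] <;> linarith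
  have hz₁' := hmid z₁ hz₁ (by simp [hB₁]) (Finset.nonempty_iff_ne_empty.2 hz₁y)
  obtain ⟨z₂, B₂, hB₂, hz₂⟩ := h.exists_step (x := y) (y := x)
    (by rw [separators_comm]; exact Finset.nonempty_iff_ne_empty.2 hxy)
  have harc₂ := isArc_or_of_separators_eq hB₂
  have hm₁ := mem_separators.1 (show B₁ ∈ separators 𝓑 x z₁ by simp [hB₁])
  have hm₂ := mem_separators.1 (show B₂ ∈ separators 𝓑 y z₂ by simp [hB₂])
  have hs₁ : B₁ ∈ separators 𝓑 x y := by simp [hz₁.separators_eq, hB₁]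
  have hs₂ : B₂ ∈ separators 𝓑 y x := by simp [hz₂.separators_eq, hB₂]
  have hs₁' := (mem_separators.1 hs₁).2
  have hs₂' := (mem_separators.1 hs₂).2
  have hxney : x ≠ y := by rintro rfl; exact hs₁' Iff.rfl
  have hx₂ : separators 𝓑 z₂ x ≠ ∅ := by
    intro he
    obtain rfl := separators_eq_empty hs he
    have h1 : separators 𝓑 z₂ y = {B₂} := by rw [separators_comm, hB₂]
    have h2 := hz₁.separators_eq
    rw [h1, hB₁] at h2
    obtain ⟨D, hD⟩ := Finset.nonempty_iff_ne_empty.2 hz₁y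
    have e1 : D = B₂ := by
      have : D ∈ ({B₂} : Finset (Finset V)) := h2 ▸ Finset.mem_union_right _ hD
      simpa using this
    have e2 : B₁ = B₂ := by
      have : B₁ ∈ ({B₂} : Finset (Finset V)) := h2 ▸ Finset.mem_union_left _ (by simp)
      simpa using this
    have := Finset.disjoint_left.1 hz₁.disjoint_separators (show B₁ ∈ _ by simp [hB₁])
    rw [e2, ← e1] at this
    exact this hD
  have hz₂' := hmid z₂ hz₂.symm (by rw [separators_comm]; exact Finset.nonempty_iff_ne_empty.2 hx₂)
    (by rw [separators_comm, hB₂]; simp)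
  have hne : B₁ ≠ B₂ := by
    rintro rfl
    rcases harc₁ with h1 | h1 <;> rcases harc₂ with h2 | h2 <;> obtain ⟨e1, e2⟩ := h1.unique h hs h2
    · exact hxney e1
    · exact hx₂ (by rw [e1]; ext; simp [mem_separators])
    · exact hx₂ (by rw [e2]; ext; simp [mem_separators])
    · exact hxney e2
  have hz₁₂ : OnPath 𝓑 z₁ z₂ y := fun B hB hz => by
    by_cases hxyB : x ∈ B ↔ y ∈ B
    · rw [hz]
      exact hz₂ B hB hxyB.symm
    · have : B ∈ separators 𝓑 x z₁ := mem_separators.2 ⟨hB, fun e => hxyB (e.trans hz)⟩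
      rw [hB₁, Finset.mem_singleton] at this
      subst this
      by_contra hc
      have : B ∈ separators 𝓑 y z₂ :=
        mem_separators.2 ⟨hB, fun e => hc (e.symm.trans hz.symm)⟩
      rw [hB₂, Finset.mem_singleton] at this
      exact hne this
  have hind : ∀ w, indic C w = 0 ∨ indic C w = 1 := fun w => by
    unfold indic; split_ifs <;> simp
  have hmidsum : 0 ≤ ∑ B ∈ separators 𝓑 z₁ z₂, δ B := by
    have h1 : (separators 𝓑 z₁ z₂).card < n := by
      rw [← hn, hz₁.separators_eq, Finset.card_union_of_disjoint hz₁.disjoint_separators,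
        hz₁₂.separators_eq, Finset.card_union_of_disjoint hz₁₂.disjoint_separators, hB₁]
      simp only [Finset.card_singleton]
      omega
    have h2 := ih _ h1 z₁ z₂ rfl
    have h3 : indic C z₁ = indic C z₂ := by
      have h4 := hz₁'.1
      have h5 := hz₂'.1
      rw [ne_eq, indic_eq_iff] at h4 h5
      rw [indic_eq_iff]
      clear * - h4 h5
      tauto
    simpa [h3] using h2
  have hexy : indic C x = indic C y := by
    obtain ⟨h1, h2⟩ := hz₁'
    rw [ne_eq, indic_eq_iff] at h1 h2
    rw [indic_eq_iff]
    clear * - h1 h2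
    tauto
  have hsum : ∑ B ∈ separators 𝓑 x y, δ B
      = δ B₁ + (∑ B ∈ separators 𝓑 z₁ z₂, δ B + δ B₂) := by
    rw [hz₁.separators_eq, Finset.sum_union hz₁.disjoint_separators, hB₁, Finset.sum_singleton,
      hz₁₂.separators_eq, Finset.sum_union hz₁₂.disjoint_separators, separators_comm 𝓑 z₂ y, hB₂,
      Finset.sum_singleton]
  rw [hexy, sub_self, abs_zero, hsum]
  suffices 0 ≤ δ B₁ + δ B₂ by linarith
  -- An interior vertex of the path cannot be on the same side of `C` as the ends.
  have hinner : ∀ z, OnPath 𝓑 x z y → (x ∈ B₁ ↔ ¬ z ∈ B₁) → (y ∈ B₂ ↔ ¬ z ∈ B₂) →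
      indic C z ≠ indic C x := fun z hz e1 e2 =>
    (hmid z hz ⟨B₁, mem_separators.2 ⟨hm₁.1, by clear * - e1; tauto⟩⟩
      ⟨B₂, mem_separators.2 ⟨hm₂.1, by clear * - e2; tauto⟩⟩).1
  have hz₁B₂ : x ∈ B₂ ↔ z₁ ∈ B₂ := by
    by_contra hc
    have : B₂ ∈ separators 𝓑 x z₁ := mem_separators.2 ⟨hm₂.1, hc⟩
    rw [hB₁, Finset.mem_singleton] at this
    exact hne this.symm
  rcases hind x with hx | hx
  · have hxC : x ∉ C := fun h => by rw [indic_of_mem h] at hx; exact one_ne_zero hx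
    have hyC : y ∉ C := fun h => by rw [hexy, indic_of_mem h] at hx; exact one_ne_zero hx
    have f1 : indic C z₁ = 1 := (hind z₁).resolve_left fun e => hz₁'.1 (e.trans hx.symm)
    have f2 : indic C z₂ = 1 := (hind z₂).resolve_left fun e => hz₂'.1 (e.trans hx.symm)
    rcases harc₁ with h1 | h1 <;> rcases harc₂ with h2 | h2 <;>
      rw [hδ _ _ _ h1, hδ _ _ _ h2, f1, f2, ← hexy, hx]
    · norm_num
    · norm_num
    · norm_num
    · exfalso
      have hx₁ := h1.2.2.1
      have hy₂ := h2.2.2.1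
      have hy₁ : y ∈ B₁ := by clear * - hx₁ hs₁'; tauto
      have hx₂' : x ∈ B₂ := by clear * - hy₂ hs₂'; tauto
      rcases h.2 _ hm₁.1 _ hm₂.1 with hc | hc | hc | hc
      · exact hy₂ (hc hy₁)
      · exact hx₁ (hc hx₂')
      · exact hc.notMem h1.2.1 (hz₁B₂.1 hx₂')
      · obtain ⟨z, hzn, hzb, hz1, hz2, hz⟩ := h.onPath_of_posSep hm₁.1 hc hx₁ hy₂
        refine hinner z hz (by clear * - hx₁ hz1; tauto) (by clear * - hy₂ hz2; tauto) ?_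
        rw [hx, indic_of_notMem (hC.2 x hxC y hyC z hzn hzb)]
  · have hxC : x ∈ C := by by_contra h; rw [indic_of_notMem h] at hx; exact zero_ne_one hx
    have hyC : y ∈ C := by by_contra h; rw [hexy, indic_of_notMem h] at hx; exact zero_ne_one hx
    have f1 : indic C z₁ = 0 := (hind z₁).resolve_right fun e => hz₁'.1 (e.trans hx.symm)
    have f2 : indic C z₂ = 0 := (hind z₂).resolve_right fun e => hz₂'.1 (e.trans hx.symm)
    rcases harc₁ with h1 | h1 <;> rcases harc₂ with h2 | h2 <;>
      rw [hδ _ _ _ h1, hδ _ _ _ h2, f1, f2, ← hexy, hx]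
    · exfalso
      have hx₁ := h1.2.1
      have hy₂ := h2.2.1
      have hy₁ : y ∉ B₁ := by clear * - hx₁ hs₁'; tauto
      have hx₂' : x ∉ B₂ := by clear * - hy₂ hs₂'; tauto
      rcases h.2 _ hm₁.1 _ hm₂.1 with hc | hc | hc | hc
      · exact hx₂' (hc hx₁)
      · exact hy₁ (hc hy₂)
      · obtain ⟨z, hzn, hzb, hz1, hz2, hz⟩ := h.onPath_of_negSep hm₁.1 hc hx₁ hy₂
        refine hinner z hz (by clear * - hx₁ hz1; tauto) (by clear * - hy₂ hz2; tauto) ?_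
        rw [hx, indic_of_mem (hC.1 x hxC y hyC z hzn hzb)]
      · exact hx₂' (hz₁B₂.2 (hc.mem h1.2.2.1))
    · norm_num
    · norm_num
    · norm_num

/-- A proper block that is a lower set of the dual tree is the source set of an arc. -/
theorem IsNested.mem_of_lower (h : T.IsNested 𝓑) (hs : IsSeparating 𝓑) (hC : T.IsProperBlock C)
    (hl : ∀ B u v, IsArc 𝓑 B u v → v ∈ C → u ∈ C) : C ∈ 𝓑 := by
  obtain ⟨-, ⟨x₀, hx₀⟩, ⟨y₀, hy₀⟩⟩ := id hC
  rw [Finset.mem_compl] at hy₀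
  have : Nonempty V := ⟨x₀⟩
  choose! src tgt harc using fun B (hB : B ∈ 𝓑) => h.exists_isArc hB
  set δ : Finset V → ℝ := fun B => indic C (tgt B) - indic C (src B)
  have hδ : ∀ B u v, IsArc 𝓑 B u v → δ B = indic C v - indic C u := fun B u v ha => by
    obtain ⟨rfl, rfl⟩ := ha.unique h hs (harc B ha.1)
    rfl
  have hle : ∀ B ∈ 𝓑, δ B ≤ 0 := fun B hB => by
    have := hl B _ _ (harc B hB)
    simp only [δ, indic]
    split_ifs <;> simp_all
  have hexists : ∃ B ∈ 𝓑, src B ∈ C ∧ tgt B ∉ C := by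
    by_contra! hno
    refine h.path_induction (motive := fun x y => x ∈ C → y ∉ C → False) ?_ ?_ x₀ y₀ hx₀ hy₀
    · intro x y he hx hy
      exact hy (separators_eq_empty hs he ▸ hx)
    · intro x z y B hB hz ih hx hy
      refine ih ?_ hy
      rcases isArc_or_of_separators_eq hB with ha | ha
      · obtain ⟨e1, e2⟩ := ha.unique h hs (harc B ha.1)
        rw [e2]
        exact hno B ha.1 (e1 ▸ hx)
      · exact hl B _ _ ha hx
  obtain ⟨B₀, hB₀, hsrc, htgt⟩ := hexists
  have hδ₀ : δ B₀ = -1 := by simp [δ, indic_of_mem hsrc, indic_of_notMem htgt]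
  have hnot : ∀ x y, indic C x = indic C y → (x ∈ B₀ ↔ y ∈ B₀) := by
    intro x y hxy
    by_contra hc
    have h1 := h.path_sum_nonneg hs hC.1 hδ x y
    rw [hxy, sub_self, abs_zero, zero_add] at h1
    have h2 := Finset.sum_nonpos fun B (hB : B ∈ (separators 𝓑 x y).erase B₀) =>
      hle B (mem_separators.1 (Finset.mem_of_mem_erase hB)).1
    rw [← Finset.add_sum_erase _ _ (mem_separators.2 ⟨hB₀, hc⟩), hδ₀] at h1
    linarith
  have : C = B₀ := by
    ext x
    have h1 := (harc B₀ hB₀).2.1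
    have h2 := (harc B₀ hB₀).2.2.1
    by_cases hx : x ∈ C
    · have := hnot x (src B₀) (by rw [indic_of_mem hx, indic_of_mem hsrc])
      tauto
    · have := hnot x (tgt B₀) (by rw [indic_of_notMem hx, indic_of_notMem htgt])
      tauto
  exact this ▸ hB₀

open Classical in
/-- The point that will turn out to be `a(S)`, for the maximal spine `S` with the dual tree of `𝓑`:
each arc from `u` to `v` with source set `B` contributes `|B| (ν - |B|) / 2` times `e_v - e_u`. -/
noncomputable def vertexPoint (𝓑 : Set (Finset V)) (v : V) : ℝ :=
  ((Fintype.card V : ℝ) + 1) / 2 +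
    (∑ B with ∃ u, IsArc 𝓑 B u v, (B.card : ℝ) * (Fintype.card V - B.card) -
      ∑ B with ∃ w, IsArc 𝓑 B v w, (B.card : ℝ) * (Fintype.card V - B.card)) / 2

theorem card_separated (B : Finset V) :
    ∑ x : V, ∑ y : V, |indic B x - indic B y| = 2 * (B.card * (Fintype.card V - B.card)) := by
  have h1 : ∀ x y : V, |indic B x - indic B y|
      = indic B x * (1 - indic B y) + (1 - indic B x) * indic B y := by
    intro x y
    unfold indic
    split_ifs <;> norm_num
  have h2 : ∑ x : V, indic B x = B.card := by
    have := sum_mul_indic B (fun _ => 1)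
    simpa using this
  simp_rw [h1, Finset.sum_add_distrib, ← Finset.mul_sum, ← Finset.sum_mul, Finset.sum_sub_distrib,
    h2]
  simp
  ring

open Classical in
theorem sum_vertexPoint (h : T.IsNested 𝓑) (hs : IsSeparating 𝓑) (C : Finset V)
    {δ : Finset V → ℝ} (hδ : ∀ B u v, IsArc 𝓑 B u v → δ B = indic C v - indic C u) :
    ∑ v ∈ C, vertexPoint 𝓑 v = ((Fintype.card V : ℝ) + 1) / 2 * C.card +
      (∑ B with B ∈ 𝓑, δ B * (B.card * (Fintype.card V - B.card))) / 2 := by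
  have : Nonempty V := T.connected.nonempty
  choose! src tgt harc using fun B (hB : B ∈ 𝓑) => h.exists_isArc hB
  have e1 : ∀ v, (Finset.univ.filter fun B => ∃ u, IsArc 𝓑 B u v)
      = (Finset.univ.filter fun B => B ∈ 𝓑).filter fun B => tgt B = v := by
    intro v
    ext B
    simp only [Finset.mem_filter, Finset.mem_univ, true_and]
    constructor
    · rintro ⟨u, hu⟩
      exact ⟨hu.1, ((harc B hu.1).unique h hs hu).2⟩
    · rintro ⟨hB, rfl⟩
      exact ⟨_, harc B hB⟩
  have e2 : ∀ v, (Finset.univ.filter fun B => ∃ w, IsArc 𝓑 B v w)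
      = (Finset.univ.filter fun B => B ∈ 𝓑).filter fun B => src B = v := by
    intro v
    ext B
    simp only [Finset.mem_filter, Finset.mem_univ, true_and]
    constructor
    · rintro ⟨u, hu⟩
      exact ⟨hu.1, ((harc B hu.1).unique h hs hu).1⟩
    · rintro ⟨hB, rfl⟩
      exact ⟨_, harc B hB⟩
  simp only [vertexPoint, e1, e2]
  rw [Finset.sum_add_distrib, Finset.sum_const, nsmul_eq_mul, mul_comm, ← Finset.sum_div,
    Finset.sum_sub_distrib]
  congr 2
  simp_rw [Finset.sum_filter (p := fun B => tgt B = _), Finset.sum_filter (p := fun B => src B = _)]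
  rw [Finset.sum_comm, Finset.sum_comm (s := C), ← Finset.sum_sub_distrib]
  refine Finset.sum_congr rfl fun B hB => ?_
  simp only [Finset.mem_filter, Finset.mem_univ, true_and] at hB
  rw [hδ B _ _ (harc B hB), Finset.sum_ite_eq, Finset.sum_ite_eq]
  unfold indic
  split_ifs <;> ring

/-- The variation of the indicator of `C` along an arc depends on the block of the arc only. -/
theorem exists_delta (h : T.IsNested 𝓑) (hs : IsSeparating 𝓑) (C : Finset V) :
    ∃ δ : Finset V → ℝ, ∀ B u v, IsArc 𝓑 B u v → δ B = indic C v - indic C u := by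
  have : Nonempty V := T.connected.nonempty
  choose! src tgt harc using fun B (hB : B ∈ 𝓑) => h.exists_isArc hB
  refine ⟨fun B => indic C (tgt B) - indic C (src B), fun B u v ha => ?_⟩
  obtain ⟨rfl, rfl⟩ := ha.unique h hs (harc B ha.1)
  rfl

theorem choose_two_eq (n : ℕ) : (((n + 1).choose 2 : ℕ) : ℝ) = n * (n + 1) / 2 := by
  rw [Nat.cast_choose_two]; push_cast; ring

/-- The difference of the two sides of the inequality of `C` at `vertexPoint 𝓑`, as a sum over pairs
of vertices: `|B| (ν - |B|)` is the number of unordered pairs separated by `B`, and `|C| (ν - |C|)`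
is the number of those separated by `C`. -/
theorem sum_vertexPoint' (h : T.IsNested 𝓑) (hs : IsSeparating 𝓑) (C : Finset V)
    {δ : Finset V → ℝ} (hδ : ∀ B u v, IsArc 𝓑 B u v → δ B = indic C v - indic C u) :
    ∑ v ∈ C, vertexPoint 𝓑 v = (C.card + 1).choose 2 +
      (∑ x : V, ∑ y : V, (|indic C x - indic C y| + ∑ B ∈ separators 𝓑 x y, δ B)) / 4 := by
  classical
  rw [sum_vertexPoint h hs C hδ, choose_two_eq]
  have e : ∑ x : V, ∑ y : V, ∑ B ∈ separators 𝓑 x y, δ B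
      = ∑ B with B ∈ 𝓑, δ B * (2 * (B.card * (Fintype.card V - B.card))) := by
    have : ∀ x y, ∑ B ∈ separators 𝓑 x y, δ B
        = ∑ B with B ∈ 𝓑, δ B * |indic B x - indic B y| := by
      intro x y
      have e0 : separators 𝓑 x y
          = (Finset.univ.filter fun B => B ∈ 𝓑).filter fun B => ¬ (x ∈ B ↔ y ∈ B) := by
        ext B; simp [mem_separators]
      rw [e0, Finset.sum_filter]
      refine Finset.sum_congr rfl fun B _ => ?_
      unfold indic
      by_cases h1 : x ∈ B <;> by_cases h2 : y ∈ B <;> simp [h1, h2]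
    simp_rw [this]
    rw [Finset.sum_congr rfl fun x _ => Finset.sum_comm, Finset.sum_comm]
    simp_rw [← Finset.mul_sum, card_separated]
  simp_rw [Finset.sum_add_distrib]
  rw [e, card_separated]
  have e3 : ∑ B with B ∈ 𝓑, δ B * (2 * ((B.card : ℝ) * (Fintype.card V - B.card)))
      = 2 * ∑ B with B ∈ 𝓑, δ B * (B.card * (Fintype.card V - B.card)) := by
    rw [Finset.mul_sum]
    exact Finset.sum_congr rfl fun B _ => by ring
  rw [e3]
  ring

theorem le_sum_vertexPoint (h : T.IsNested 𝓑) (hs : IsSeparating 𝓑) (hC : C ∈ T.buildingSet) :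
    ((C.card + 1).choose 2 : ℝ) ≤ ∑ v ∈ C, vertexPoint 𝓑 v := by
  obtain ⟨δ, hδ⟩ := exists_delta h hs C
  rw [sum_vertexPoint' h hs C hδ]
  have := Finset.sum_nonneg fun x (_ : x ∈ Finset.univ) => Finset.sum_nonneg
    fun y (_ : y ∈ Finset.univ) => h.path_sum_nonneg hs hC hδ x y
  linarith

/-- The inequality of a block is far from being tight if an arc enters the block. -/
theorem lt_sum_vertexPoint (h : T.IsNested 𝓑) (hs : IsSeparating 𝓑) (hC : C ∈ T.buildingSet)
    (ha : IsArc 𝓑 B u v) (hu : u ∉ C) (hv : v ∈ C) :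
    ((C.card + 1).choose 2 : ℝ) + 1 ≤ ∑ v ∈ C, vertexPoint 𝓑 v := by
  obtain ⟨δ, hδ⟩ := exists_delta h hs C
  rw [sum_vertexPoint' h hs C hδ]
  set F : V → V → ℝ := fun x y => |indic C x - indic C y| + ∑ B ∈ separators 𝓑 x y, δ B
  have h0 : ∀ x y, 0 ≤ F x y := h.path_sum_nonneg hs hC hδ
  have huv : F u v = 2 := by
    simp only [F, ha.separators_eq, Finset.sum_singleton, hδ _ _ _ ha, indic_of_mem hv,
      indic_of_notMem hu]
    norm_num
  have hvu : F v u = 2 := by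
    simp only [F, separators_comm 𝓑 v u, ha.separators_eq, Finset.sum_singleton, hδ _ _ _ ha,
      indic_of_mem hv, indic_of_notMem hu]
    norm_num
  have e1 : F u v ≤ ∑ y, F u y := Finset.single_le_sum (fun y _ => h0 u y) (Finset.mem_univ v)
  have e2 : F v u ≤ ∑ y, F v y := Finset.single_le_sum (fun y _ => h0 v y) (Finset.mem_univ u)
  have hne : u ≠ v := fun e => hu (e ▸ hv)
  have e3 : ∑ x ∈ {u, v}, ∑ y, F x y ≤ ∑ x, ∑ y, F x y :=
    Finset.sum_le_sum_of_subset_of_nonneg (Finset.subset_univ _)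
      fun x _ _ => Finset.sum_nonneg fun y _ => h0 x y
  rw [Finset.sum_pair hne] at e3
  change _ ≤ _ + (∑ x, ∑ y, F x y) / 4
  linarith

/-- For `B ∈ 𝓑` the sum over the members of `𝓑` has the only term of `B` itself, as no other arc
joins an element of `B` to an element outside. -/
theorem sum_vertexPoint_of_mem (h : T.IsNested 𝓑) (hs : IsSeparating 𝓑) (hB : B ∈ 𝓑) :
    ∑ v ∈ B, vertexPoint 𝓑 v = (B.card + 1).choose 2 := by
  classical
  obtain ⟨δ, hδ⟩ := exists_delta h hs B
  rw [sum_vertexPoint h hs B hδ, choose_two_eq, Finset.sum_eq_single B]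
  · obtain ⟨u, v, ha⟩ := h.exists_isArc hB
    rw [hδ _ _ _ ha, indic_of_mem ha.2.1, indic_of_notMem ha.2.2.1]
    ring
  · intro B' hB' hne
    obtain ⟨u, v, ha⟩ := h.exists_isArc (Finset.mem_filter.1 hB').2
    have := ha.2.2.2 B hB hne.symm
    rw [hδ _ _ _ ha]
    unfold indic
    simp [this]
  · intro hn
    simp [hB] at hn

theorem sum_univ_vertexPoint (h : T.IsNested 𝓑) (hs : IsSeparating 𝓑) :
    ∑ v, vertexPoint 𝓑 v = (Fintype.card V + 1).choose 2 := by
  rw [sum_vertexPoint h hs Finset.univ (δ := 0) (fun B u v _ => by simp [indic]), choose_two_eq]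
  simp
  ring

end SignedTree

/-! ### Facets, vertices and normal fan -/

namespace SignedTree

variable {V : Type*} [Fintype V] [DecidableEq V] {T : SignedTree V} {𝓑 𝓑' : Set (Finset V)}
  {B C : Finset V} {u v : V} {g h : V → ℝ} {y : V → ℝ}

theorem mem_assoFacets : y ∈ T.assoFacets ↔ ∑ v, y v = ((Fintype.card V + 1).choose 2 : ℝ) ∧
    ∀ B ∈ T.buildingSet, ((B.card + 1).choose 2 : ℝ) ≤ ∑ v ∈ B, y v := by
  simp [assoFacets, hyperplane, halfSpace]

theorem vertexPoint_mem (h : T.IsNested 𝓑) (hs : IsSeparating 𝓑) :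
    vertexPoint 𝓑 ∈ T.assoFacets :=
  mem_assoFacets.2 ⟨sum_univ_vertexPoint h hs, fun _ hB => le_sum_vertexPoint h hs hB⟩

theorem sum_single_sub (C : Finset V) (u v : V) :
    ∑ w ∈ C, (Pi.single u (1 : ℝ) - Pi.single v 1 : V → ℝ) w = indic C u - indic C v := by
  simp [Finset.sum_sub_distrib, indic]

theorem dotProduct_single_sub (g : V → ℝ) (u v : V) :
    g ⬝ᵥ (Pi.single u (1 : ℝ) - Pi.single v 1) = g u - g v := by
  simp [dotProduct_sub]

/-- From a vertex, one can move against each arc without leaving the polytope. -/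
theorem vertexPoint_add_mem (h : T.IsNested 𝓑) (hs : IsSeparating 𝓑) (ha : IsArc 𝓑 B u v) :
    vertexPoint 𝓑 + (Pi.single u 1 - Pi.single v 1) ∈ T.assoFacets := by
  rw [mem_assoFacets]
  simp only [Pi.add_apply, Finset.sum_add_distrib, sum_single_sub]
  refine ⟨?_, fun C hC => ?_⟩
  · rw [sum_univ_vertexPoint h hs]
    simp [indic]
  · have h1 := le_sum_vertexPoint h hs hC
    by_cases hu : u ∈ C <;> by_cases hv : v ∈ C
    · simpa [indic, hu, hv] using h1
    · simp only [indic, hu, hv, if_true, if_false]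
      linarith
    · have h2 := lt_sum_vertexPoint h hs hC ha hu hv
      simp only [indic, hu, hv, if_true, if_false]
      linarith
    · simpa [indic, hu, hv] using h1

open Classical in
/-- A vector is determined up to a constant by its differences along the arcs of the dual tree. -/
theorem IsNested.exists_decomposition (h : T.IsNested 𝓑) (hs : IsSeparating 𝓑) (g : V → ℝ) :
    ∃ (c : ℝ) (l : Finset V → ℝ), (∀ B u v, IsArc 𝓑 B u v → l B = g v - g u) ∧
      ∀ x, g x = c - ∑ B with B ∈ 𝓑, l B * indic B x := by
  have hV : Nonempty V := T.connected.nonempty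
  obtain ⟨o⟩ := id hV
  choose! src tgt harc using fun B (hB : B ∈ 𝓑) => h.exists_isArc hB
  set l : Finset V → ℝ := fun B => g (tgt B) - g (src B)
  have hl : ∀ B u v, IsArc 𝓑 B u v → l B = g v - g u := fun B u v ha => by
    obtain ⟨rfl, rfl⟩ := ha.unique h hs (harc B ha.1)
    rfl
  set f : V → ℝ := fun x => g x + ∑ B with B ∈ 𝓑, l B * indic B x
  have harcf : ∀ B u v, IsArc 𝓑 B u v → f u = f v := by
    intro B u v ha
    have hB : B ∈ Finset.univ.filter fun B => B ∈ 𝓑 := by simpa using ha.1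
    simp only [f]
    rw [← Finset.add_sum_erase _ _ hB, ← Finset.add_sum_erase _ _ hB, hl _ _ _ ha,
      indic_of_mem ha.2.1, indic_of_notMem ha.2.2.1]
    have : ∀ B' ∈ (Finset.univ.filter fun B => B ∈ 𝓑).erase B,
        l B' * indic B' u = l B' * indic B' v := fun B' hB' => by
      simp only [Finset.mem_erase, Finset.mem_filter, Finset.mem_univ, true_and] at hB'
      rw [indic_eq_iff.2 (ha.2.2.2 B' hB'.2 hB'.1)]
    rw [Finset.sum_congr rfl this]
    ring
  have hconst : ∀ x y, f x = f y := h.path_induction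
    (fun x y he => by rw [separators_eq_empty hs he])
    (fun x z y B hB _ ih => by
      rcases isArc_or_of_separators_eq hB with ha | ha
      · exact (harcf _ _ _ ha).trans ih
      · exact (harcf _ _ _ ha).symm.trans ih)
  refine ⟨f o, l, hl, fun x => ?_⟩
  rw [hconst o x]
  simp [f]

open Classical in
theorem dotProduct_eq_of_decomposition {c : ℝ} {l : Finset V → ℝ}
    (hg : ∀ x, g x = c - ∑ B with B ∈ 𝓑, l B * indic B x) (y : V → ℝ) :
    g ⬝ᵥ y = c * ∑ v, y v - ∑ B with B ∈ 𝓑, l B * ∑ v ∈ B, y v := by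
  simp only [dotProduct, hg, sub_mul, Finset.sum_sub_distrib, Finset.mul_sum, Finset.sum_mul]
  congr 1
  rw [Finset.sum_comm]
  refine Finset.sum_congr rfl fun B _ => ?_
  rw [← Finset.mul_sum, ← sum_mul_indic B y, Finset.mul_sum]
  exact Finset.sum_congr rfl fun x _ => by ring

open Classical in
/-- Since the members of `𝓑` are tight at `vertexPoint 𝓑`, the change of `g` is a combination of the
excesses of the members of `𝓑` at `y`. -/
theorem IsNested.dotProduct_sub (h : T.IsNested 𝓑) (hs : IsSeparating 𝓑) {c : ℝ}
    {l : Finset V → ℝ} (hg : ∀ x, g x = c - ∑ B with B ∈ 𝓑, l B * indic B x)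
    (hy : y ∈ T.assoFacets) : g ⬝ᵥ vertexPoint 𝓑 - g ⬝ᵥ y
      = ∑ B with B ∈ 𝓑, l B * (∑ v ∈ B, y v - (B.card + 1).choose 2) := by
  rw [dotProduct_eq_of_decomposition hg, dotProduct_eq_of_decomposition hg,
    sum_univ_vertexPoint h hs, (mem_assoFacets.1 hy).1]
  have : ∑ B with B ∈ 𝓑, l B * ∑ v ∈ B, vertexPoint 𝓑 v
      = ∑ B with B ∈ 𝓑, l B * ((B.card + 1).choose 2 : ℝ) :=
    Finset.sum_congr rfl fun B hB => by
      rw [sum_vertexPoint_of_mem h hs (Finset.mem_filter.1 hB).2]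
  simp_rw [this, mul_sub, Finset.sum_sub_distrib]
  ring

/-- The vector `g` weakly increases along the arcs of the dual tree of `𝓑`. -/
def IsMonotoneOn (𝓑 : Set (Finset V)) (g : V → ℝ) : Prop := ∀ B u v, IsArc 𝓑 B u v → g u ≤ g v

theorem IsNested.dotProduct_le (h : T.IsNested 𝓑) (hs : IsSeparating 𝓑) (hg : IsMonotoneOn 𝓑 g)
    (hy : y ∈ T.assoFacets) : g ⬝ᵥ y ≤ g ⬝ᵥ vertexPoint 𝓑 := by
  classical
  obtain ⟨c, l, hl, hc⟩ := h.exists_decomposition hs g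
  have := h.dotProduct_sub hs hc hy
  have h0 : 0 ≤ ∑ B with B ∈ 𝓑, l B * (∑ v ∈ B, y v - (B.card + 1).choose 2) :=
    Finset.sum_nonneg fun B hB => by
      have hB := (Finset.mem_filter.1 hB).2
      obtain ⟨u, v, ha⟩ := h.exists_isArc hB
      rw [hl _ _ _ ha]
      exact mul_nonneg (sub_nonneg.2 (hg _ _ _ ha))
        (sub_nonneg.2 ((mem_assoFacets.1 hy).2 B (h.1 B hB).1))
  linarith

/-- If `g` strictly increases along an arc, then the inequality of this arc is tight at every point
of the polytope where `g` is maximal. -/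
theorem IsNested.tight_of_maximal (h : T.IsNested 𝓑) (hs : IsSeparating 𝓑)
    (hg : IsMonotoneOn 𝓑 g) (hy : y ∈ T.assoFacets) (hm : g ⬝ᵥ vertexPoint 𝓑 ≤ g ⬝ᵥ y)
    (ha : IsArc 𝓑 B u v) (hlt : g u < g v) : ∑ v ∈ B, y v = (B.card + 1).choose 2 := by
  classical
  obtain ⟨c, l, hl, hc⟩ := h.exists_decomposition hs g
  have := h.dotProduct_sub hs hc hy
  have h0 : ∀ B ∈ Finset.univ.filter fun B => B ∈ 𝓑,
      0 ≤ l B * (∑ v ∈ B, y v - (B.card + 1).choose 2) := fun B hB => by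
    have hB := (Finset.mem_filter.1 hB).2
    obtain ⟨u, v, ha⟩ := h.exists_isArc hB
    rw [hl _ _ _ ha]
    exact mul_nonneg (sub_nonneg.2 (hg _ _ _ ha))
      (sub_nonneg.2 ((mem_assoFacets.1 hy).2 B (h.1 B hB).1))
  have h1 : ∑ B with B ∈ 𝓑, l B * (∑ v ∈ B, y v - (B.card + 1).choose 2) = 0 :=
    le_antisymm (by linarith) (Finset.sum_nonneg h0)
  have h2 := (Finset.sum_eq_zero_iff_of_nonneg h0).1 h1 B (by simpa using ha.1)
  rw [hl _ _ _ ha] at h2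
  rcases mul_eq_zero.1 h2 with h3 | h3 <;> linarith

theorem dual_apply_eq (l : (V → ℝ) →L[ℝ] ℝ) (x : V → ℝ) :
    l x = (fun v => l (Pi.single v 1)) ⬝ᵥ x := by
  conv_lhs => rw [pi_eq_sum_univ' x]
  simp [dotProduct, mul_comm]

/-- The facet description and the vertex description agree. -/
theorem convexHull_vertexPoint (T : SignedTree V) :
    convexHull ℝ {x | ∃ 𝓑, T.IsNested 𝓑 ∧ IsSeparating 𝓑 ∧ x = vertexPoint 𝓑} = T.assoFacets := by
  have hfin : {x | ∃ 𝓑, T.IsNested 𝓑 ∧ IsSeparating 𝓑 ∧ x = vertexPoint 𝓑}.Finite := by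
    refine (Set.toFinite (Set.range (vertexPoint (V := V)))).subset ?_
    rintro x ⟨𝓑, -, -, rfl⟩
    exact ⟨𝓑, rfl⟩
  apply subset_antisymm
  · apply convexHull_min
    · rintro x ⟨𝓑, h, hs, rfl⟩
      exact vertexPoint_mem h hs
    · intro x hx y hy a b ha hb hab
      rw [mem_assoFacets] at *
      simp only [Pi.add_apply, Pi.smul_apply, smul_eq_mul, Finset.sum_add_distrib,
        ← Finset.mul_sum]
      refine ⟨by rw [hx.1, hy.1, ← add_mul, hab, one_mul], fun B hB => ?_⟩
      calc ((B.card + 1).choose 2 : ℝ)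
          = a * ((B.card + 1).choose 2 : ℕ) + b * ((B.card + 1).choose 2 : ℕ) := by
            rw [← add_mul, hab, one_mul]
        _ ≤ _ := by gcongr; exacts [hx.2 B hB, hy.2 B hB]
  · intro y hy
    by_contra hny
    obtain ⟨l, c, hlt, hc⟩ := geometric_hahn_banach_closed_point (convex_convexHull ℝ _)
      (hfin.isClosed_convexHull ℝ) hny
    obtain ⟨𝓑, h, hs, hm⟩ := exists_isNested_monotone T fun v => l (Pi.single v 1)
    have h1 := hlt _ (subset_convexHull ℝ _ ⟨𝓑, h, hs, rfl⟩)
    have h2 := h.dotProduct_le hs hm hy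
    rw [← dual_apply_eq, ← dual_apply_eq] at h2
    linarith

/-- The cone, inside `H`, of the vectors that are constant on the nodes and that weakly increase
along the arcs of the dual tree of `𝓑`. -/
def familyCone (𝓑 : Set (Finset V)) : Set (V → ℝ) :=
  {h | h ∈ hyperplane V ∧ IsMonotoneOn 𝓑 h ∧ ∀ u v, separators 𝓑 u v = ∅ → h u = h v}

theorem IsArc.of_subset (ha : IsArc 𝓑 B u v) (hsub : 𝓑' ⊆ 𝓑) (hB : B ∈ 𝓑') : IsArc 𝓑' B u v :=
  ⟨hB, ha.2.1, ha.2.2.1, fun C hC => ha.2.2.2 C (hsub hC)⟩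

/-- The cone of a subfamily is the face of the cone of a maximal family that is given by equality
along the arcs outside the subfamily. -/
theorem IsNested.familyCone_eq (hn : T.IsNested 𝓑) (hs : IsSeparating 𝓑) (hsub : 𝓑' ⊆ 𝓑) :
    familyCone 𝓑' = {h | h ∈ hyperplane V ∧ IsMonotoneOn 𝓑 h ∧
      ∀ B u v, IsArc 𝓑 B u v → B ∉ 𝓑' → h u = h v} := by
  ext h
  simp only [familyCone, Set.mem_ofPred_eq]
  refine and_congr_right fun _ => ⟨fun ⟨h1, h2⟩ => ?_, fun ⟨h1, h2⟩ => ?_⟩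
  · have h3 : ∀ B u v, IsArc 𝓑 B u v → B ∉ 𝓑' → h u = h v := fun B u v ha hB => by
      refine h2 u v (Finset.eq_empty_of_forall_notMem fun C hC => ?_)
      rw [mem_separators] at hC
      exact hC.2 (ha.2.2.2 C (hsub hC.1) fun e => hB (e ▸ hC.1))
    refine ⟨fun B u v ha => ?_, h3⟩
    by_cases hB : B ∈ 𝓑'
    · exact h1 B u v (ha.of_subset hsub hB)
    · exact (h3 B u v ha hB).le
  · have h3 : ∀ x y, separators 𝓑' x y = ∅ → h x = h y := hn.path_induction
      (motive := fun x y => separators 𝓑' x y = ∅ → h x = h y)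
      (fun x y he _ => by rw [separators_eq_empty hs he])
      (fun x z y B hB hz ih he => by
        have hB1 : B ∈ separators 𝓑 x y := by simp [hz.separators_eq, hB]
        have hB' : B ∉ 𝓑' := fun hB' => by
          have : B ∈ separators 𝓑' x y := mem_separators.2 ⟨hB', (mem_separators.1 hB1).2⟩
          simp [he] at this
        have hzy : separators 𝓑' z y = ∅ := Finset.eq_empty_of_forall_notMem fun C hC => by
          rw [mem_separators] at hC
          have h4 : C ∈ separators 𝓑 z y := mem_separators.2 ⟨hsub hC.1, hC.2⟩
          have h5 : C ∈ separators 𝓑 x y := by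
            rw [hz.separators_eq]; exact Finset.mem_union_right _ h4
          have : C ∈ separators 𝓑' x y := mem_separators.2 ⟨hC.1, (mem_separators.1 h5).2⟩
          simp [he] at this
        rcases isArc_or_of_separators_eq hB with ha | ha
        · exact (h2 _ _ _ ha hB').trans (ih hzy)
        · exact (h2 _ _ _ ha hB').symm.trans (ih hzy))
    refine ⟨fun B u v ha => ?_, h3⟩
    obtain ⟨u', v', ha'⟩ := hn.exists_isArc (hsub ha.1)
    have e := fun C hC => ha.mem_iff (hn.subset hsub) (ha'.of_subset hsub ha.1) (C := C) hC
    rw [h3 u u' (by ext C; simp only [mem_separators]; have := e C; simp; tauto),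
      h3 v v' (by ext C; simp only [mem_separators]; have := e C; simp; tauto)]
    exact h1 B _ _ ha'

/-- The normal cone of the face where `g` is maximal. -/
theorem IsNested.normalCone_eq (hn : T.IsNested 𝓑) (hs : IsSeparating 𝓑) (hg : IsMonotoneOn 𝓑 g) :
    normalCone T.assoFacets {x | x ∈ T.assoFacets ∧ ∀ y ∈ T.assoFacets, g ⬝ᵥ y ≤ g ⬝ᵥ x}
      = familyCone {B | ∃ u v, IsArc 𝓑 B u v ∧ g u < g v} := by
  have hsub : {B | ∃ u v, IsArc 𝓑 B u v ∧ g u < g v} ⊆ 𝓑 := fun B ⟨u, v, ha, _⟩ => ha.1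
  have hnotin : ∀ B u v, IsArc 𝓑 B u v →
      (B ∉ {B | ∃ u v, IsArc 𝓑 B u v ∧ g u < g v} ↔ g u = g v) := fun B u v ha => by
    simp only [Set.mem_ofPred_eq, not_exists, not_and, not_lt]
    refine ⟨fun h => le_antisymm (hg _ _ _ ha) (h u v ha), fun h u' v' ha' => ?_⟩
    obtain ⟨rfl, rfl⟩ := ha.unique hn hs ha'
    exact h.ge
  rw [hn.familyCone_eq hs hsub]
  have hvF : ∀ y ∈ T.assoFacets, g ⬝ᵥ y ≤ g ⬝ᵥ vertexPoint 𝓑 :=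
    fun y hy => hn.dotProduct_le hs hg hy
  have hv := vertexPoint_mem hn hs
  ext h
  simp only [normalCone, Set.mem_ofPred_eq]
  refine and_congr_right fun _ => ⟨fun hF => ?_, fun ⟨h1, h2⟩ => ?_⟩
  · have h3 : IsMonotoneOn 𝓑 h := fun B u v ha => by
      have := hF _ ⟨hv, hvF⟩ _ (vertexPoint_add_mem hn hs ha)
      rw [dotProduct_add, dotProduct_single_sub] at this
      linarith
    refine ⟨h3, fun B u v ha hB => le_antisymm (h3 _ _ _ ha) ?_⟩
    replace hB := (hnotin _ _ _ ha).1 hB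
    have := hF _ ⟨vertexPoint_add_mem hn hs ha, fun y hy => by
      rw [dotProduct_add, dotProduct_single_sub, hB, sub_self, add_zero]
      exact hvF y hy⟩ _ hv
    rw [dotProduct_add, dotProduct_single_sub] at this
    linarith
  · intro x hx y hy
    have h3 := hn.dotProduct_le hs h1 hy
    classical
    obtain ⟨c, l, hl, hc⟩ := hn.exists_decomposition hs h
    have h4 := hn.dotProduct_sub hs hc hx.1
    rw [Finset.sum_eq_zero] at h4
    · linarith
    · intro B hB
      obtain ⟨u, v, ha⟩ := hn.exists_isArc (Finset.mem_filter.1 hB).2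
      by_cases he : g u = g v
      · rw [hl _ _ _ ha, h2 _ _ _ ha ((hnotin _ _ _ ha).2 he), sub_self, zero_mul]
      · rw [hn.tight_of_maximal hs hg hx.1 (hx.2 _ hv) ha ((hg _ _ _ ha).lt_of_ne he), sub_self,
          mul_zero]

open Classical in
/-- For a subfamily of a maximal nested family, the sum of the indicator functions with opposite
signs strictly increases precisely along the arcs of the subfamily. -/
theorem IsNested.neg_sum_indic (hsub : 𝓑' ⊆ 𝓑) (ha : IsArc 𝓑 B u v) :
    (-∑ C with C ∈ 𝓑', indic C v) - (-∑ C with C ∈ 𝓑', indic C u) = if B ∈ 𝓑' then 1 else 0 := by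
  rw [neg_sub_neg, ← Finset.sum_sub_distrib,
    Finset.sum_congr rfl (g := fun C => if C = B then 1 else 0)]
  · simp [Finset.sum_ite_eq']
  · intro C hC
    by_cases hCB : C = B
    · subst hCB
      simp [indic_of_mem ha.2.1, indic_of_notMem ha.2.2.1]
    · rw [indic_eq_iff.2 (ha.2.2.2 C (hsub (Finset.mem_filter.1 hC).2) hCB)]
      simp [hCB]

/-- The normal fan consists of the cones of all nested families. -/
theorem normalFan_assoFacets (T : SignedTree V) :
    normalFan T.assoFacets = {C | ∃ 𝓑, T.IsNested 𝓑 ∧ C = familyCone 𝓑} := by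
  classical
  ext C
  constructor
  · rintro ⟨F, hF, hne, rfl⟩
    obtain ⟨l, rfl⟩ := hF hne
    set g : V → ℝ := fun v => l (Pi.single v 1) with hg
    obtain ⟨𝓑, hn, hs, hm⟩ := exists_isNested_monotone T g
    have hsub : {B | ∃ u v, IsArc 𝓑 B u v ∧ g u < g v} ⊆ 𝓑 := fun B ⟨u, v, ha, _⟩ => ha.1
    refine ⟨_, hn.subset hsub, ?_⟩
    rw [← hn.normalCone_eq hs hm]
    simp_rw [hg, ← dual_apply_eq]
  · rintro ⟨𝓑', hn', rfl⟩
    obtain ⟨𝓑, hsub, hn, hs⟩ := hn'.exists_isSeparating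
    set g : V → ℝ := fun x => -∑ C with C ∈ 𝓑', indic C x with hgdef
    have hd : ∀ {B u v}, IsArc 𝓑 B u v → g v - g u = if B ∈ 𝓑' then 1 else 0 :=
      fun ha => IsNested.neg_sum_indic hsub ha
    have hg : IsMonotoneOn 𝓑 g := fun B u v ha => by
      have := hd ha
      split_ifs at this <;> linarith
    have he : {B | ∃ u v, IsArc 𝓑 B u v ∧ g u < g v} = 𝓑' := by
      ext B
      constructor
      · rintro ⟨u, v, ha, hlt⟩
        by_contra hB
        have := hd ha
        rw [if_neg hB] at this
        linarith
      · intro hB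
        obtain ⟨u, v, ha⟩ := hn.exists_isArc (hsub hB)
        refine ⟨u, v, ha, ?_⟩
        have := hd ha
        rw [if_pos hB] at this
        linarith
    refine ⟨{x | x ∈ T.assoFacets ∧ ∀ y ∈ T.assoFacets, g ⬝ᵥ y ≤ g ⬝ᵥ x}, ?_,
      ⟨vertexPoint 𝓑, vertexPoint_mem hn hs, fun y hy => hn.dotProduct_le hs hg hy⟩,
      by rw [hn.normalCone_eq hs hg, he]⟩
    intro _
    refine ⟨LinearMap.toContinuousLinearMap (dotProductBilin ℝ ℝ g), ?_⟩
    simp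

end SignedTree

/-! ### The boundary complex of the polar -/

namespace SignedTree

variable {V : Type*} [Fintype V] [DecidableEq V] {T : SignedTree V} {𝓑 : Set (Finset V)}
  {B B₁ B₂ C : Finset V} {u v : V} {g x y o z : V → ℝ}

variable (T) in
/-- The proper signed building blocks whose inequality is tight at `x`. -/
def tightBlocks (x : V → ℝ) : Set (Finset V) :=
  {B | T.IsProperBlock B ∧ ∑ v ∈ B, x v = (B.card + 1).choose 2}

/-- A tight block is a lower set of the dual tree, because an arc entering it would make its
inequality strict. -/
theorem mem_of_tight (h : T.IsNested 𝓑) (hs : IsSeparating 𝓑)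
    (hB : B ∈ T.tightBlocks (vertexPoint 𝓑)) : B ∈ 𝓑 := by
  refine h.mem_of_lower hs hB.1 fun C u v ha hv => ?_
  by_contra hu
  have h1 := lt_sum_vertexPoint h hs hB.1.1 ha hu hv
  have h2 := hB.2
  linarith

/-- Two blocks which are tight at the same point are tight at a common vertex, so they are
compatible. -/
theorem isNested_tightBlocks (hx : x ∈ T.assoFacets) : T.IsNested (T.tightBlocks x) := by
  refine ⟨fun B hB => hB.1, fun B₁ h₁ B₂ h₂ => ?_⟩
  -- A vertex where the sum over `B₁` plus the sum over `B₂` is minimal is tight for both blocks.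
  obtain ⟨𝓑, h, hs, hm⟩ := exists_isNested_monotone T fun v => -(indic B₁ v + indic B₂ v)
  have key : ∀ y : V → ℝ, (fun v => -(indic B₁ v + indic B₂ v)) ⬝ᵥ y
      = -(∑ v ∈ B₁, y v + ∑ v ∈ B₂, y v) := fun y => by
    rw [← sum_mul_indic, ← sum_mul_indic B₂, ← Finset.sum_add_distrib, ← Finset.sum_neg_distrib]
    exact Finset.sum_congr rfl fun v _ => by ring
  have h3 := h.dotProduct_le hs hm hx
  rw [key, key, h₁.2, h₂.2] at h3
  have h4 := le_sum_vertexPoint h hs h₁.1.1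
  have h5 := le_sum_vertexPoint h hs h₂.1.1
  exact h.2 _ (mem_of_tight h hs ⟨h₁.1, by linarith⟩) _ (mem_of_tight h hs ⟨h₂.1, by linarith⟩)

/-- Every nested family is the set of tight blocks of some point. -/
theorem IsNested.exists_tightBlocks_eq {𝓑' : Set (Finset V)} (h' : T.IsNested 𝓑') :
    ∃ x ∈ T.assoFacets, T.tightBlocks x = 𝓑' := by
  classical
  obtain ⟨𝓑, hsub, h, hs⟩ := h'.exists_isSeparating
  have : Nonempty V := T.connected.nonempty
  choose! src tgt harc using fun B (hB : B ∈ 𝓑) => h.exists_isArc hB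
  -- Move from the vertex of `𝓑` slightly against all arcs that are not in `𝓑'`.
  set R : Finset (Finset V) := {B | B ∈ 𝓑 ∧ B ∉ 𝓑'} with hR
  set ε : ℝ := 1 / (R.card + 1) with hε
  have hεpos : 0 < ε := by positivity
  set x : V → ℝ := vertexPoint 𝓑 +
    ε • ∑ B ∈ R, (Pi.single (src B) (1 : ℝ) - Pi.single (tgt B) 1 : V → ℝ) with hx
  have hsum : ∀ C : Finset V, ∑ v ∈ C, x v = ∑ v ∈ C, vertexPoint 𝓑 v +
      ε * ∑ B ∈ R, (indic C (src B) - indic C (tgt B)) := by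
    intro C
    simp only [hx, Pi.add_apply, Pi.smul_apply, smul_eq_mul, Finset.sum_add_distrib,
      ← Finset.mul_sum, Finset.sum_apply]
    rw [Finset.sum_comm]
    simp_rw [sum_single_sub]
  have hmem : ∀ C ∈ 𝓑, ∑ v ∈ C, x v = (C.card + 1).choose 2 + ε * if C ∈ 𝓑' then 0 else 1 := by
    intro C hC
    rw [hsum, sum_vertexPoint_of_mem h hs hC]
    congr 2
    have : ∀ B ∈ R, indic C (src B) - indic C (tgt B) = if B = C then 1 else 0 := by
      intro B hB
      simp only [hR, Finset.mem_filter, Finset.mem_univ, true_and] at hB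
      have ha := harc B hB.1
      by_cases hBC : B = C
      · subst hBC
        rw [indic_of_mem ha.2.1, indic_of_notMem ha.2.2.1]
        simp
      · rw [indic_eq_iff.2 (ha.2.2.2 C hC (Ne.symm hBC))]
        simp [hBC]
    rw [Finset.sum_congr rfl this, Finset.sum_ite_eq' R C (fun _ => (1 : ℝ))]
    by_cases hC' : C ∈ 𝓑' <;> simp [hR, hC, hC']
  have hnotmem : ∀ C, T.IsProperBlock C → C ∉ 𝓑 → ((C.card + 1).choose 2 : ℝ) < ∑ v ∈ C, x v := by
    intro C hC hCB
    have h1 : ∃ B u v, IsArc 𝓑 B u v ∧ v ∈ C ∧ u ∉ C := by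
      by_contra! hno
      exact hCB (h.mem_of_lower hs hC hno)
    obtain ⟨B, u, v, ha, hv, hu⟩ := h1
    have h2 := lt_sum_vertexPoint h hs hC.1 ha hu hv
    have h3 : -(R.card : ℝ) ≤ ∑ B ∈ R, (indic C (src B) - indic C (tgt B)) := by
      have := Finset.card_nsmul_le_sum R (fun B => indic C (src B) - indic C (tgt B)) (-1)
        (fun B _ => by unfold indic; split_ifs <;> norm_num)
      simpa using this
    have h4 : ε * R.card < 1 := by
      rw [hε, div_mul_eq_mul_div, one_mul, div_lt_one (by positivity)]
      linarith
    have h5 := mul_le_mul_of_nonneg_left h3 hεpos.le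
    rw [hsum]
    linarith
  refine ⟨x, mem_assoFacets.2 ⟨?_, fun C hC => ?_⟩, ?_⟩
  · rw [hsum, sum_univ_vertexPoint h hs]
    simp [indic]
  · by_cases hCB : C ∈ 𝓑
    · rw [hmem C hCB]
      have : 0 ≤ ε * if C ∈ 𝓑' then 0 else 1 := by split_ifs <;> simp [hεpos.le]
      linarith
    · by_cases hp : T.IsProperBlock C
      · exact (hnotmem C hp hCB).le
      · have h0 := le_sum_vertexPoint h hs hC
        rw [hsum]
        have : ∀ B, indic C (src B) - indic C (tgt B) = 0 := fun B => by
          simp only [IsProperBlock, hC, true_and, not_and_or, Finset.not_nonempty_iff_eq_empty,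
            Finset.compl_eq_empty_iff] at hp
          rcases hp with rfl | rfl <;> simp [indic]
        simpa [this] using h0
  · ext C
    constructor
    · rintro ⟨hC, ht⟩
      by_contra hC'
      by_cases hCB : C ∈ 𝓑
      · rw [hmem C hCB, if_neg hC'] at ht
        linarith
      · exact absurd ht (hnotmem C hC hCB).ne'
    · intro hC
      refine ⟨h'.1 C hC, ?_⟩
      rw [hmem C (hsub hC), if_pos hC]
      simp

/-- The polytope spans the hyperplane: the edge directions along the arcs at a vertex generate all
vectors with coordinate sum zero. -/
theorem direction_assoFacets (T : SignedTree V) :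
    ∀ d, d ∈ (affineSpan ℝ T.assoFacets).direction ↔ ∑ v, d v = 0 := by
  intro d
  obtain ⟨r⟩ : Nonempty V := T.connected.nonempty
  rw [direction_affineSpan]
  constructor
  · intro hd
    have : vectorSpan ℝ T.assoFacets ≤
        LinearMap.ker (∑ v, LinearMap.proj (R := ℝ) (φ := fun _ : V => ℝ) v) := by
      rw [vectorSpan_def, Submodule.span_le]
      rintro _ ⟨y, hy, z, hz, rfl⟩
      simp [(mem_assoFacets.1 hy).1, (mem_assoFacets.1 hz).1]
    simpa using this hd
  · intro hd
    obtain ⟨𝓑, h, hs, -⟩ := exists_isNested_monotone T 0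
    have harc : ∀ B u v, IsArc 𝓑 B u v →
        (Pi.single u (1 : ℝ) - Pi.single v 1 : V → ℝ) ∈ vectorSpan ℝ T.assoFacets := by
      intro B u v ha
      have := vsub_mem_vectorSpan ℝ (vertexPoint_add_mem h hs ha) (vertexPoint_mem h hs)
      simpa using this
    have hall : ∀ x y,
        (Pi.single x (1 : ℝ) - Pi.single y 1 : V → ℝ) ∈ vectorSpan ℝ T.assoFacets :=
      h.path_induction
        (fun x y he => by rw [separators_eq_empty hs he, sub_self]; exact Submodule.zero_mem _)
        (fun x z y B hB _ ih => by
          have h1 : (Pi.single x (1 : ℝ) - Pi.single z 1 : V → ℝ) ∈ vectorSpan ℝ T.assoFacets := by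
            rcases isArc_or_of_separators_eq hB with ha | ha
            · exact harc _ _ _ ha
            · rw [← neg_sub]
              exact Submodule.neg_mem _ (harc _ _ _ ha)
          have := Submodule.add_mem _ h1 ih
          rwa [sub_add_sub_cancel] at this)
    have he : d = ∑ v, d v • (Pi.single v (1 : ℝ) - Pi.single r 1 : V → ℝ) := by
      simp_rw [smul_sub, Finset.sum_sub_distrib, ← Finset.sum_smul, hd, zero_smul, sub_zero]
      ext w
      simp [Finset.sum_apply, Pi.single_apply]
    rw [he]
    exact Submodule.sum_mem _ fun v _ => Submodule.smul_mem _ _ (hall v r)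

/-- The inequality of a proper block is strict at a relative interior point, since the block sum is
not constant on the affine span. -/
theorem lt_sum_of_mem_intrinsicInterior (ho : o ∈ intrinsicInterior ℝ T.assoFacets)
    (hB : T.IsProperBlock B) : ((B.card + 1).choose 2 : ℝ) < ∑ v ∈ B, o v := by
  obtain ⟨-, ⟨u, hu⟩, ⟨v, hv⟩⟩ := id hB
  rw [Finset.mem_compl] at hv
  obtain ⟨o', ho', rfl⟩ := mem_intrinsicInterior.1 ho
  set d : V → ℝ := Pi.single u (1 : ℝ) - Pi.single v 1 with hd
  have hdir : d ∈ (affineSpan ℝ T.assoFacets).direction := by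
    rw [direction_assoFacets, hd, sum_single_sub]
    simp [indic]
  let γ : ℝ → affineSpan ℝ T.assoFacets := fun t => ⟨(t • d) +ᵥ (o' : V → ℝ),
    AffineSubspace.vadd_mem_of_mem_direction (Submodule.smul_mem _ t hdir) o'.2⟩
  have hγ : Continuous γ := by
    apply Continuous.subtype_mk
    simp only [vadd_eq_add]
    fun_prop
  have hγ0 : γ 0 = o' := by ext; simp [γ]
  have hopen := (isOpen_interior
    (s := ((↑) : affineSpan ℝ T.assoFacets → V → ℝ) ⁻¹' T.assoFacets)).preimage hγ
  obtain ⟨ε, hε, hball⟩ := Metric.isOpen_iff.1 hopen 0 (by simpa [hγ0] using ho')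
  have hmem : -(ε / 2) ∈ Metric.ball (0 : ℝ) ε := by
    rw [Metric.mem_ball, dist_zero_right, norm_neg, Real.norm_eq_abs, abs_of_pos (by positivity)]
    linarith
  have h1 := interior_subset (hball hmem)
  have h2 := (mem_assoFacets.1 h1).2 B hB.1
  have h3 : ∑ w ∈ B, ((γ (-(ε / 2)) : affineSpan ℝ T.assoFacets) : V → ℝ) w
      = -(ε / 2) + ∑ w ∈ B, (o' : V → ℝ) w := by
    simp only [γ, vadd_eq_add, Pi.add_apply, Pi.smul_apply, smul_eq_mul, Finset.sum_add_distrib,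
      ← Finset.mul_sum, hd, sum_single_sub, indic_of_mem hu, indic_of_notMem hv]
    ring
  rw [h3] at h2
  linarith

/-- The vertex of the polar that corresponds to the facet of the block `B`. -/
noncomputable def polarVertex (o : V → ℝ) (B : Finset V) (v : V) : ℝ :=
  (B.card / Fintype.card V - indic B v) / (∑ v ∈ B, o v - (B.card + 1).choose 2)

theorem polarVertex_dotProduct (o : V → ℝ) (B : Finset V) (hz : ∑ v, z v = 0) :
    polarVertex o B ⬝ᵥ z = -(∑ v ∈ B, z v) / (∑ v ∈ B, o v - (B.card + 1).choose 2) := by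
  simp only [polarVertex, dotProduct, div_mul_eq_mul_div, ← Finset.sum_div, sub_mul,
    Finset.sum_sub_distrib, ← Finset.mul_sum, hz, mul_zero]
  simp_rw [mul_comm (indic B _), sum_mul_indic]
  simp

theorem polarVertex_dotProduct_sub (ho : o ∈ intrinsicInterior ℝ T.assoFacets)
    (hB : T.IsProperBlock B) (hx : ∑ v, (x - o) v = 0) :
    polarVertex o B ⬝ᵥ (x - o) = 1 - (∑ v ∈ B, x v - (B.card + 1).choose 2) /
      (∑ v ∈ B, o v - (B.card + 1).choose 2) := by
  have h := lt_sum_of_mem_intrinsicInterior ho hB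
  rw [polarVertex_dotProduct o B hx]
  have h' : ∑ v ∈ B, o v - ((B.card + 1).choose 2 : ℝ) ≠ 0 := by linarith
  field_simp
  simp [Finset.sum_sub_distrib]

theorem sum_sub_eq_zero (hx : x ∈ T.assoFacets) (ho : o ∈ T.assoFacets) :
    ∑ v, (x - o) v = 0 := by
  simp [Finset.sum_sub_distrib, (mem_assoFacets.1 hx).1, (mem_assoFacets.1 ho).1]

theorem polarVertex_mem (ho : o ∈ intrinsicInterior ℝ T.assoFacets) (hB : T.IsProperBlock B) :
    polarVertex o B ∈ polarAt o T.assoFacets := by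
  have hV : Nonempty V := T.connected.nonempty
  refine ⟨?_, fun x hx => ?_⟩
  · rw [direction_assoFacets]
    simp only [polarVertex, ← Finset.sum_div, Finset.sum_sub_distrib]
    have h1 := sum_mul_indic B (fun _ => 1)
    simp only [one_mul, Finset.sum_const, nsmul_eq_mul, mul_one] at h1
    rw [h1]
    simp
  · rw [polarVertex_dotProduct_sub ho hB (sum_sub_eq_zero hx (intrinsicInterior_subset ho))]
    have h1 := lt_sum_of_mem_intrinsicInterior ho hB
    have h2 := (mem_assoFacets.1 hx).2 B hB.1
    have : 0 ≤ (∑ v ∈ B, x v - ((B.card + 1).choose 2 : ℝ)) /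
      (∑ v ∈ B, o v - (B.card + 1).choose 2) := div_nonneg (by linarith) (by linarith)
    linarith

theorem zero_mem_polarAt (o : V → ℝ) (P : Set (V → ℝ)) : (0 : V → ℝ) ∈ polarAt o P :=
  ⟨Submodule.zero_mem _, fun x _ => by simp⟩

variable (T) in
/-- The face of the polar that is dual to the smallest face containing `x`. -/
def polarFace (o x : V → ℝ) : Set (V → ℝ) :=
  {g | g ∈ polarAt o T.assoFacets ∧ g ⬝ᵥ (x - o) = 1}

theorem polarFace_mem (hx : x ∈ T.assoFacets) :
    T.polarFace o x ∈ boundaryComplex (polarAt o T.assoFacets) := by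
  constructor
  · rintro ⟨g₀, hg₀, hg₀'⟩
    refine ⟨LinearMap.toContinuousLinearMap (dotProductBilin ℝ ℝ (x - o)), ?_⟩
    ext g
    simp only [polarFace, Set.mem_ofPred_eq, LinearMap.coe_toContinuousLinearMap',
      dotProductBilin_apply_apply, dotProduct_comm (x - o)]
    refine and_congr_right fun hg => ⟨fun h g' hg' => ?_, fun h => ?_⟩
    · rw [h]
      exact hg'.2 x hx
    · have h1 := h g₀ hg₀
      have h2 := hg.2 x hx
      linarith
  · intro he
    have : (0 : V → ℝ) ∈ T.polarFace o x := he ▸ zero_mem_polarAt o _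
    have := this.2
    simp at this

/-- Every non-empty proper face of the polar is dual to a point of the polytope. -/
theorem exists_eq_polarFace (ho : o ∈ intrinsicInterior ℝ T.assoFacets) {F : Set (V → ℝ)}
    (hF : F ∈ boundaryComplex (polarAt o T.assoFacets)) (hne : F.Nonempty) :
    ∃ x ∈ T.assoFacets, F = T.polarFace o x := by
  have hV : Nonempty V := T.connected.nonempty
  have hoP : o ∈ T.assoFacets := intrinsicInterior_subset ho
  obtain ⟨hexp, hproper⟩ := hF
  obtain ⟨l, hl⟩ := hexp hne
  obtain ⟨g₀, hg₀⟩ := hne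
  set w : V → ℝ := fun v => l (Pi.single v 1) with hw
  set m : ℝ := (∑ v, w v) / Fintype.card V with hm
  -- The functional in the linear span of the polytope.
  set w₀ : V → ℝ := fun v => w v - m with hw₀
  have hsum₀ : ∑ v, w₀ v = 0 := by
    simp only [hw₀, Finset.sum_sub_distrib, Finset.sum_const, hm, nsmul_eq_mul, Finset.card_univ]
    have h2 : (Fintype.card V : ℝ) ≠ 0 := by simp
    field_simp
    simp
  have hlw : ∀ g ∈ polarAt o T.assoFacets, l g = g ⬝ᵥ w₀ := fun g hg => by
    have hg0 := (direction_assoFacets T g).1 hg.1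
    rw [dual_apply_eq, dotProduct_comm]
    simp only [hw₀, dotProduct, mul_sub, Finset.sum_sub_distrib, ← Finset.sum_mul, hg0, zero_mul,
      sub_zero, hw]
  have hg₀' : g₀ ∈ polarAt o T.assoFacets ∧ ∀ y ∈ polarAt o T.assoFacets, l y ≤ l g₀ := by
    rw [hl] at hg₀; exact hg₀
  set M : ℝ := l g₀ with hM
  have hM0 : 0 ≤ M := by
    have := hg₀'.2 0 (zero_mem_polarAt o _)
    simpa using this
  have hMpos : 0 < M := by
    refine hM0.lt_of_ne fun hMz => hproper ?_
    -- A small multiple of `w₀` belongs to the polar.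
    obtain ⟨𝓑, h, hs, hmon⟩ := exists_isNested_monotone T w₀
    set K : ℝ := w₀ ⬝ᵥ (vertexPoint 𝓑 - o) with hK
    have hKle : ∀ x ∈ T.assoFacets, w₀ ⬝ᵥ (x - o) ≤ K := fun x hx => by
      have := h.dotProduct_le hs hmon hx
      rw [hK, dotProduct_sub, dotProduct_sub]
      linarith
    have hK0 : 0 ≤ K := by simpa using hKle o hoP
    have hmem : (1 / (K + 1)) • w₀ ∈ polarAt o T.assoFacets := by
      refine ⟨Submodule.smul_mem _ _ ((direction_assoFacets T _).2 hsum₀), fun x hx => ?_⟩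
      rw [smul_dotProduct, smul_eq_mul, div_mul_eq_mul_div, one_mul,
        div_le_one (by positivity)]
      linarith [hKle x hx]
    have h1 := hg₀'.2 _ hmem
    rw [hlw _ hmem, ← hMz, smul_dotProduct, smul_eq_mul] at h1
    have h2 : w₀ ⬝ᵥ w₀ ≤ 0 := by
      by_contra! hc
      have : 0 < 1 / (K + 1) * w₀ ⬝ᵥ w₀ := by positivity
      linarith
    have h3 : w₀ = 0 := by
      have h4 : 0 ≤ w₀ ⬝ᵥ w₀ := Finset.sum_nonneg fun v _ => mul_self_nonneg _
      exact dotProduct_self_eq_zero.1 (le_antisymm h2 h4)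
    rw [hl]
    ext g
    simp only [Set.mem_ofPred_eq, and_iff_left_iff_imp]
    intro hg y hy
    rw [hlw g hg, hlw y hy, h3]
    simp
  set x : V → ℝ := o + (1 / M) • w₀ with hx
  have hxo : x - o = (1 / M) • w₀ := by simp [hx]
  have hxsum : ∑ v, (x - o) v = 0 := by
    rw [hxo]
    simp [← Finset.mul_sum, hsum₀]
  have hdot : ∀ g ∈ polarAt o T.assoFacets, g ⬝ᵥ (x - o) = l g / M := fun g hg => by
    rw [hxo, dotProduct_smul, hlw g hg, smul_eq_mul]
    ring
  have hxP : x ∈ T.assoFacets := by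
    have htot : ∑ v, x v = ((Fintype.card V + 1).choose 2 : ℝ) := by
      have := (mem_assoFacets.1 hoP).1
      simp only [Pi.sub_apply, Finset.sum_sub_distrib] at hxsum
      linarith
    refine mem_assoFacets.2 ⟨htot, fun B hB => ?_⟩
    by_cases hp : T.IsProperBlock B
    · have h1 := lt_sum_of_mem_intrinsicInterior ho hp
      have h2 := polarVertex_mem ho hp
      have h3 : polarVertex o B ⬝ᵥ (x - o) ≤ 1 := by
        rw [hdot _ h2, div_le_one hMpos]
        exact hg₀'.2 _ h2
      rw [polarVertex_dotProduct_sub ho hp hxsum] at h3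
      by_contra! hc
      have : (∑ v ∈ B, x v - ((B.card + 1).choose 2 : ℝ)) /
        (∑ v ∈ B, o v - (B.card + 1).choose 2) < 0 :=
        div_neg_of_neg_of_pos (by linarith) (by linarith)
      linarith
    · simp only [IsProperBlock, hB, true_and, not_and_or, Finset.not_nonempty_iff_eq_empty,
        Finset.compl_eq_empty_iff] at hp
      rcases hp with rfl | rfl
      · simp
      · rw [Finset.card_univ, htot]
  refine ⟨x, hxP, ?_⟩
  rw [hl]
  ext g
  simp only [polarFace, Set.mem_ofPred_eq]
  refine and_congr_right fun hg => ⟨fun h => ?_, fun h y hy => ?_⟩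
  · rw [hdot g hg, div_eq_one_iff_eq hMpos.ne']
    exact le_antisymm (hg₀'.2 g hg) (h g₀ hg₀'.1)
  · rw [hdot g hg, div_eq_one_iff_eq hMpos.ne'] at h
    rw [h]
    exact hg₀'.2 y hy

theorem polarVertex_mem_polarFace (ho : o ∈ intrinsicInterior ℝ T.assoFacets)
    (hB : T.IsProperBlock B) (hx : x ∈ T.assoFacets) :
    polarVertex o B ∈ T.polarFace o x ↔ B ∈ T.tightBlocks x := by
  have h1 := lt_sum_of_mem_intrinsicInterior ho hB
  have h2 : ∑ v ∈ B, o v - ((B.card + 1).choose 2 : ℝ) ≠ 0 := by linarith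
  simp only [polarFace, Set.mem_ofPred_eq, polarVertex_mem ho hB, true_and, tightBlocks, hB,
    polarVertex_dotProduct_sub ho hB (sum_sub_eq_zero hx (intrinsicInterior_subset ho))]
  rw [sub_eq_self, div_eq_zero_iff, or_iff_left h2, sub_eq_zero]

/-- A face of the polar is determined by the vertices it contains. -/
theorem polarFace_eq_of_tight (hx : x ∈ T.assoFacets)
    (hg : g ∈ T.polarFace o x) (hy : ∑ v, y v = ((Fintype.card V + 1).choose 2 : ℝ))
    (hxy : ∀ B ∈ T.tightBlocks x, ∑ v ∈ B, y v = ∑ v ∈ B, x v) : g ⬝ᵥ (y - o) = 1 := by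
  classical
  obtain ⟨𝓑, h, hs, hm⟩ := exists_isNested_monotone T g
  obtain ⟨c, l, hl, hc⟩ := h.exists_decomposition hs g
  have hmax : g ⬝ᵥ vertexPoint 𝓑 ≤ g ⬝ᵥ x := by
    have h1 := hg.1.2 _ (vertexPoint_mem h hs)
    have h2 := hg.2
    rw [_root_.dotProduct_sub] at h1 h2
    linarith
  rw [← hg.2, _root_.dotProduct_sub, _root_.dotProduct_sub]
  congr 1
  rw [dotProduct_eq_of_decomposition hc, dotProduct_eq_of_decomposition hc, hy,
    (mem_assoFacets.1 hx).1]
  congr 1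
  refine Finset.sum_congr rfl fun B hB => ?_
  obtain ⟨u, v, ha⟩ := h.exists_isArc (Finset.mem_filter.1 hB).2
  rcases (hm _ _ _ ha).eq_or_lt with he | hlt
  · rw [hl _ _ _ ha, he, sub_self, zero_mul, zero_mul]
  · rw [hxy B ⟨h.1 B ha.1, h.tight_of_maximal hs hm hx hmax ha hlt⟩]

/-- The boundary complex of the polar is the complex of nested families of blocks. -/
theorem exists_boundaryComplex_iso (ho : o ∈ intrinsicInterior ℝ T.assoFacets) :
    Nonempty (boundaryComplex (polarAt o T.assoFacets) ≃o {𝓑 : Set (Finset V) | T.IsNested 𝓑}) := by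
  have hoP : o ∈ T.assoFacets := intrinsicInterior_subset ho
  let Φ : Set (V → ℝ) → Set (Finset V) := fun F => {B | T.IsProperBlock B ∧ polarVertex o B ∈ F}
  have hΦ : ∀ x ∈ T.assoFacets, Φ (T.polarFace o x) = T.tightBlocks x := fun x hx => by
    ext B
    simp only [Φ, Set.mem_ofPred_eq]
    constructor
    · rintro ⟨h1, h2⟩
      exact (polarVertex_mem_polarFace ho h1 hx).1 h2
    · intro h1
      exact ⟨h1.1, (polarVertex_mem_polarFace ho h1.1 hx).2 h1⟩
  have hnested : ∀ F ∈ boundaryComplex (polarAt o T.assoFacets), T.IsNested (Φ F) := by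
    intro F hF
    rcases F.eq_empty_or_nonempty with rfl | hne
    · exact ⟨fun B hB => hB.1, fun B hB => hB.2.elim⟩
    · obtain ⟨x, hx, rfl⟩ := exists_eq_polarFace ho hF hne
      rw [hΦ x hx]
      exact isNested_tightBlocks hx
  let f : boundaryComplex (polarAt o T.assoFacets) → {𝓑 : Set (Finset V) | T.IsNested 𝓑} :=
    fun F => ⟨Φ F.1, hnested F.1 F.2⟩
  have hf : ∀ F₁ F₂, f F₁ ≤ f F₂ ↔ F₁ ≤ F₂ := by
    rintro ⟨F₁, hF₁⟩ ⟨F₂, hF₂⟩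
    refine ⟨fun h => ?_, fun h B hB => ⟨hB.1, h hB.2⟩⟩
    change Φ F₁ ⊆ Φ F₂ at h
    change F₁ ⊆ F₂
    rcases F₁.eq_empty_or_nonempty with rfl | hne
    · exact Set.empty_subset _
    obtain ⟨x, hx, rfl⟩ := exists_eq_polarFace ho hF₁ hne
    rw [hΦ x hx] at h
    intro g hg
    rcases F₂.eq_empty_or_nonempty with rfl | hne'
    · exfalso
      have := polarFace_eq_of_tight (y := o) hx hg (mem_assoFacets.1 hoP).1
        fun B hB => (h hB).2.elim
      simp at this
    · obtain ⟨y, hy, rfl⟩ := exists_eq_polarFace ho hF₂ hne'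
      rw [hΦ y hy] at h
      exact ⟨hg.1, polarFace_eq_of_tight hx hg (mem_assoFacets.1 hy).1
        fun B hB => by rw [(h hB).2, hB.2]⟩
  have hsurj : Function.Surjective f := by
    rintro ⟨𝓑, h⟩
    obtain ⟨x, hx, hx'⟩ := IsNested.exists_tightBlocks_eq h
    exact ⟨⟨T.polarFace o x, polarFace_mem hx⟩, Subtype.ext ((hΦ x hx).trans hx')⟩
  exact ⟨RelIso.ofSurjective (OrderEmbedding.ofMapLEIff f hf) hsurj⟩

end SignedTree

/-! ### Signed tubes and signed building blocks -/

namespace SignedTree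

section Cells

variable {V : Type*} {T : SignedTree V} {U U' : Set V} {Z : Set T.Cell} {u v w x y b : V}

theorem incidence_adj {a c : T.Cell} : T.incidence.Adj a c ↔
    (∃ v e, a = Sum.inl v ∧ c = Sum.inr e ∧ v ∈ e.1) ∨
      ∃ v e, c = Sum.inl v ∧ a = Sum.inr e ∧ v ∈ e.1 := by
  rw [incidence, SimpleGraph.fromRel_adj]
  refine and_iff_right_of_imp ?_
  rintro (⟨v, e, rfl, rfl, -⟩ | ⟨v, e, rfl, rfl, -⟩) <;> simp

/-- The components of `T ∖ U` are the connected sets of cells whose vertices avoid `U`, which are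
open, and whose boundary is contained in `U`. -/
theorem isComponent_iff : T.IsComponent U Z ↔ (T.incidence.induce Z).Connected ∧
    (∀ v, Sum.inl v ∈ Z → v ∉ U) ∧
    (∀ (v : V) (e : T.graph.edgeSet), Sum.inl v ∈ Z → v ∈ e.1 → Sum.inr e ∈ Z) ∧
    T.boundary Z ⊆ U := by
  constructor
  · rintro ⟨C, rfl⟩
    have hmem : ∀ {c : T.Cell}, c ∈ Subtype.val '' C.supp ↔
        ∃ hc, (T.incidence.induce (Sum.inl '' U)ᶜ).connectedComponentMk ⟨c, hc⟩ = C := by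
      intro c
      simp
    have hstep : ∀ {a c : T.Cell}, a ∈ Subtype.val '' C.supp → T.incidence.Adj a c →
        c ∉ Sum.inl '' U → c ∈ Subtype.val '' C.supp := by
      intro a c ha hac hc
      obtain ⟨ha', haC⟩ := hmem.1 ha
      refine hmem.2 ⟨hc, ?_⟩
      rw [← haC, SimpleGraph.ConnectedComponent.eq]
      exact (SimpleGraph.Adj.reachable (by simpa using hac.symm))
    refine ⟨?_, fun v hv hvU => ?_, fun v e hv hve => ?_, fun v ⟨hv, e, he, hve⟩ => ?_⟩
    · have hwalk : ∀ (a c : ((Sum.inl '' U)ᶜ : Set T.Cell))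
          (_ : (T.incidence.induce (Sum.inl '' U)ᶜ).Walk a c) (ha : a.1 ∈ Subtype.val '' C.supp),
          ∃ hc : c.1 ∈ Subtype.val '' C.supp,
            (T.incidence.induce (Subtype.val '' C.supp)).Reachable ⟨a.1, ha⟩ ⟨c.1, hc⟩ := by
        intro a c p
        induction p with
        | nil => exact fun ha => ⟨ha, SimpleGraph.Reachable.refl _⟩
        | @cons a b _ h p ih =>
          intro ha
          have h' : T.incidence.Adj a.1 b.1 := by simpa using h
          obtain ⟨hc, hr⟩ := ih (hstep ha h' b.2)
          refine ⟨hc, SimpleGraph.Reachable.trans (SimpleGraph.Adj.reachable ?_) hr⟩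
          simpa using h'
      obtain ⟨c₀, hc₀⟩ := C.nonempty_supp
      have : Nonempty (Subtype.val '' C.supp : Set T.Cell) := ⟨⟨c₀.1, ⟨c₀, hc₀, rfl⟩⟩⟩
      refine SimpleGraph.Connected.mk ?_
      rintro ⟨_, ⟨a, ha, rfl⟩⟩ ⟨_, ⟨c, hc, rfl⟩⟩
      obtain ⟨p⟩ := C.reachable_of_mem_supp ha hc
      exact (hwalk a c p ⟨a, ha, rfl⟩).2
    · obtain ⟨h, -⟩ := hmem.1 hv
      exact h ⟨v, hvU, rfl⟩
    · exact hstep hv (incidence_adj.2 (Or.inl ⟨v, e, rfl, rfl, hve⟩)) (by simp)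
    · by_contra hvU
      exact hv (hstep he (incidence_adj.2 (Or.inr ⟨v, e, rfl, rfl, hve⟩)) (by simpa using hvU))
  · rintro ⟨hconn, hU, hopen, hbd⟩
    have hsub : ∀ {c}, c ∈ Z → c ∈ (Sum.inl '' U)ᶜ := by
      rintro c hc ⟨v, hv, rfl⟩
      exact hU v hc hv
    obtain ⟨c₀⟩ := hconn.nonempty
    refine ⟨(T.incidence.induce (Sum.inl '' U)ᶜ).connectedComponentMk ⟨c₀.1, hsub c₀.2⟩, ?_⟩
    ext c
    constructor
    · intro hc
      refine ⟨⟨c, hsub hc⟩, ?_, rfl⟩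
      rw [SimpleGraph.ConnectedComponent.mem_supp_iff, SimpleGraph.ConnectedComponent.eq]
      have := hconn.preconnected ⟨c, hc⟩ c₀
      exact this.map (SimpleGraph.induceHomOfLE T.incidence (fun _ h => hsub h)).toHom
    · rintro ⟨c, hc, rfl⟩
      rw [SimpleGraph.ConnectedComponent.mem_supp_iff, SimpleGraph.ConnectedComponent.eq] at hc
      obtain ⟨p⟩ := hc.symm
      have hwalk : ∀ (a c : ((Sum.inl '' U)ᶜ : Set T.Cell))
          (_ : (T.incidence.induce (Sum.inl '' U)ᶜ).Walk a c), a.1 ∈ Z → c.1 ∈ Z := by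
        intro a c p
        induction p with
        | nil => exact id
        | @cons a b c h p ih =>
          intro ha
          refine ih ?_
          have h' : T.incidence.Adj a.1 b.1 := by simpa using h
          rcases incidence_adj.1 h' with ⟨v, e, hv, he, hve⟩ | ⟨v, e, hv, he, hve⟩
          · rw [he]
            exact hopen v e (hv ▸ ha) hve
          · by_contra hb
            rw [hv] at hb
            exact b.2 ⟨v, hbd ⟨hb, e, he ▸ ha, hve⟩, hv.symm⟩
      exact hwalk _ _ p c₀.2

theorem IsOpenSubtree.isComponent (hZ : T.IsOpenSubtree Z) (hU : ∀ v, Sum.inl v ∈ Z → v ∉ U)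
    (hb : T.boundary Z ⊆ U) : T.IsComponent U Z := by
  obtain ⟨U', hU'⟩ := hZ
  rw [isComponent_iff] at hU' ⊢
  exact ⟨hU'.1, hU, hU'.2.2.1, hb⟩

variable (T) in
/-- The component of `T ∖ U` that contains the vertex `x`. -/
def cellsFrom (U : Set V) (x : V) : Set T.Cell :=
  {c | Sum.elim (fun v => ∀ w ∈ U, ¬ T.graph.Btw x w v)
    (fun e : T.graph.edgeSet => ∃ v ∈ e.1, ∀ w ∈ U, ¬ T.graph.Btw x w v) c}

theorem inl_mem_cellsFrom : Sum.inl v ∈ T.cellsFrom U x ↔ ∀ w ∈ U, ¬ T.graph.Btw x w v := Iff.rfl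

theorem inr_mem_cellsFrom {e : T.graph.edgeSet} :
    Sum.inr e ∈ T.cellsFrom U x ↔ ∃ v ∈ e.1, ∀ w ∈ U, ¬ T.graph.Btw x w v := Iff.rfl

theorem adj_of_mem {e : T.graph.edgeSet} (hu : u ∈ e.1) (hv : v ∈ e.1) (hne : u ≠ v) :
    T.graph.Adj u v := by
  have := (Sym2.mem_and_mem_iff hne).1 ⟨hu, hv⟩
  rw [← SimpleGraph.mem_edgeSet, ← this]
  exact e.2

theorem boundary_cellsFrom_subset : T.boundary (T.cellsFrom U x) ⊆ U := by
  rintro v ⟨hv, e, ⟨u, hu, hxu⟩, hve⟩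
  rw [inl_mem_cellsFrom] at hv
  push Not at hv
  obtain ⟨w, hwU, hw⟩ := hv
  have hne : u ≠ v := by rintro rfl; exact hxu w hwU hw
  have h1 := (hw.split u).resolve_left (hxu w hwU)
  rcases h1.eq_or_of_adj (adj_of_mem hu hve hne) with rfl | rfl
  · exact absurd SimpleGraph.btw_right (hxu w hwU)
  · exact hwU

theorem isComponent_cellsFrom (hx : x ∉ U) : T.IsComponent U (T.cellsFrom U x) := by
  rw [isComponent_iff]
  refine ⟨?_, fun v hv hvU => hv v hvU SimpleGraph.btw_right, fun v e hv hve => ⟨v, hve, hv⟩,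
    boundary_cellsFrom_subset⟩
  have hself : Sum.inl x ∈ T.cellsFrom U x := fun w hw hb => hx (hb.eq_of_self ▸ hw)
  have hedge : ∀ {u : V} (hu : Sum.inl u ∈ T.cellsFrom U x) (e : T.graph.edgeSet) (hue : u ∈ e.1),
      (T.incidence.induce (T.cellsFrom U x)).Adj ⟨Sum.inl u, hu⟩ ⟨Sum.inr e, ⟨u, hue, hu⟩⟩ := by
    intro u hu e hue
    simpa using incidence_adj.2 (Or.inl ⟨u, e, rfl, rfl, hue⟩)
  have hwalk : ∀ (v u : V) (p : T.graph.Walk v u)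
      (_ : ∀ w ∈ p.support, Sum.inl w ∈ T.cellsFrom U x)
      (hv : Sum.inl v ∈ T.cellsFrom U x) (hu : Sum.inl u ∈ T.cellsFrom U x),
      (T.incidence.induce (T.cellsFrom U x)).Reachable ⟨Sum.inl v, hv⟩ ⟨Sum.inl u, hu⟩ := by
    intro v u p
    induction p with
    | nil => exact fun _ _ _ => SimpleGraph.Reachable.refl _
    | @cons a b c h p ih =>
      intro hp ha hc
      have hb := hp b (by simp)
      have h1 := hedge ha ⟨s(a, b), h⟩ (by simp)
      have h2 := hedge hb ⟨s(a, b), h⟩ (by simp)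
      exact h1.reachable.trans
        (h2.symm.reachable.trans (ih (fun w hw => hp w (by simp [hw])) hb hc))
  have hvert : ∀ v (hv : Sum.inl v ∈ T.cellsFrom U x),
      (T.incidence.induce (T.cellsFrom U x)).Reachable ⟨Sum.inl x, hself⟩ ⟨Sum.inl v, hv⟩ := by
    intro v hv
    obtain ⟨p, hp⟩ := T.connected.exists_isPath x v
    refine hwalk x v p (fun w hw => ?_) hself hv
    have hb := (T.isTree.mem_support_iff_btw hp).1 hw
    exact fun w' hw' hb' => hv w' hw' (hb.trans hb')
  have hall : ∀ c : T.cellsFrom U x,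
      (T.incidence.induce (T.cellsFrom U x)).Reachable ⟨Sum.inl x, hself⟩ c := by
    rintro ⟨v | e, hc⟩
    · exact hvert v hc
    · obtain ⟨v, hv, hxv⟩ := id hc
      exact (hvert v hxv).trans (hedge hxv e hv).reachable
  have : Nonempty (T.cellsFrom U x) := ⟨⟨_, hself⟩⟩
  exact SimpleGraph.Connected.mk fun a c => (hall a).symm.trans (hall c)

theorem IsComponent.eq_of_mem {Z' : Set T.Cell} {c : T.Cell} (h : T.IsComponent U Z)
    (h' : T.IsComponent U Z') (hc : c ∈ Z) (hc' : c ∈ Z') : Z = Z' := by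
  obtain ⟨C, rfl⟩ := h
  obtain ⟨C', rfl⟩ := h'
  obtain ⟨d, hd, rfl⟩ := hc
  obtain ⟨d', hd', he⟩ := hc'
  obtain rfl := Subtype.ext he
  rw [SimpleGraph.ConnectedComponent.mem_supp_iff] at hd hd'
  rw [← hd, ← hd']

theorem IsOpenSubtree.eq_cellsFrom (hZ : T.IsOpenSubtree Z) (hU : ∀ v, Sum.inl v ∈ Z → v ∉ U)
    (hb : T.boundary Z ⊆ U) (hx : Sum.inl x ∈ Z) : Z = T.cellsFrom U x :=
  (hZ.isComponent hU hb).eq_of_mem (isComponent_cellsFrom (hU x hx)) hx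
    fun _ hw hb => hU x hx (hb.eq_of_self ▸ hw)

theorem IsOpenSubtree.eq_cellsFrom_boundary (hZ : T.IsOpenSubtree Z) (hx : Sum.inl x ∈ Z) :
    Z = T.cellsFrom (T.boundary Z) x :=
  hZ.eq_cellsFrom (fun _ hv hvb => hvb.1 hv) subset_rfl hx

theorem IsOpenSubtree.exists_boundary (hZ : T.IsOpenSubtree Z) (hx : Sum.inl x ∈ Z)
    (hy : Sum.inl y ∉ Z) : ∃ w ∈ T.boundary Z, T.graph.Btw x w y := by
  rw [hZ.eq_cellsFrom_boundary hx, inl_mem_cellsFrom] at hy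
  push Not at hy
  exact hy

theorem IsOpenSubtree.mem_of_btw (hZ : T.IsOpenSubtree Z) (hx : Sum.inl x ∈ Z)
    (hy : Sum.inl y ∈ Z) (hb : T.graph.Btw x w y) : Sum.inl w ∈ Z := by
  rw [hZ.eq_cellsFrom_boundary hx, inl_mem_cellsFrom] at hy ⊢
  exact fun w' hw' hb' => hy w' hw' (hb.trans hb')

theorem IsOpenSubtree.eq_univ (hZ : T.IsOpenSubtree Z) (hb : T.boundary Z = ∅) :
    Z = Set.univ := by
  have h0 : ∃ x, Sum.inl x ∈ Z := by
    obtain ⟨U, hU⟩ := hZ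
    obtain ⟨⟨v | e, hc⟩⟩ := (isComponent_iff.1 hU).1.nonempty
    · exact ⟨v, hc⟩
    · obtain ⟨⟨a, b⟩, he⟩ := e
      refine ⟨a, ?_⟩
      by_contra ha
      have : a ∈ T.boundary Z := ⟨ha, _, hc, by simp⟩
      simp [hb] at this
  obtain ⟨x, hx⟩ := h0
  have h := hZ.eq_cellsFrom_boundary hx
  rw [hb] at h
  rw [h]
  ext (v | e)
  · simp [inl_mem_cellsFrom]
  · obtain ⟨⟨a, b⟩, he⟩ := e
    simp only [inr_mem_cellsFrom, Set.mem_univ, iff_true]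
    exact ⟨a, by simp, by simp⟩

end Cells

section Tubes

variable {V : Type*} [Fintype V] [DecidableEq V] {T : SignedTree V} {B B₁ B₂ : Finset V}
  {u v w x y b : V} {W : Set T.Cell × Set T.Cell}

variable (T) in
/-- The component of `T ∖ (V⁻ ∖ B)` that contains the block `B`. -/
def negPart (B : Finset V) : Set T.Cell := {c | ∃ b ∈ B, c ∈ T.cellsFrom (T.neg \ B) b}

variable (T) in
/-- The signed tube of a block `B`: the component of `T ∖ (V⁻ ∖ B)` that contains `B`, and the
component of `T ∖ (V⁺ ∩ B)` that contains the complement of `B`. -/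
def tube (B : Finset V) : Set T.Cell × Set T.Cell := (T.negPart B, T.dual.negPart Bᶜ)

theorem IsProperBlock.negPart_eq (h : T.IsProperBlock B) (hb : b ∈ B) :
    T.negPart B = T.cellsFrom (T.neg \ B) b := by
  have key : ∀ b ∈ B, ∀ b' ∈ B, ∀ v, (∀ w ∈ T.neg \ (B : Set V), ¬ T.graph.Btw b w v) →
      ∀ w ∈ T.neg \ (B : Set V), ¬ T.graph.Btw b' w v := by
    intro b hb b' hb' v hv w hw hbtw
    rcases hbtw.split b with h1 | h1
    · exact hw.2 (h.neg_mem hb' hb hw.1 h1)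
    · exact hv w hw h1
  ext c
  refine ⟨?_, fun hc => ⟨b, hb, hc⟩⟩
  rintro ⟨b', hb', hc⟩
  rcases c with v | e
  · exact key b' hb' b hb v hc
  · obtain ⟨v, hv, hc⟩ := hc
    exact ⟨v, hv, key b' hb' b hb v hc⟩

theorem IsProperBlock.isOpenSubtree_negPart (h : T.IsProperBlock B) :
    T.IsOpenSubtree (T.negPart B) := by
  obtain ⟨b, hb⟩ := h.2.1
  rw [h.negPart_eq hb]
  exact ⟨_, isComponent_cellsFrom fun hb' => hb'.2 hb⟩

theorem inl_mem_negPart (hv : v ∈ B) : Sum.inl v ∈ T.negPart B :=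
  ⟨v, hv, fun _ hw hb => hw.2 (hb.eq_of_self ▸ hv)⟩

theorem inl_mem_negPart_iff (hv : v ∈ T.neg) :
    Sum.inl v ∈ T.negPart B ↔ v ∈ B := by
  refine ⟨?_, inl_mem_negPart⟩
  rintro ⟨b, hb, hc⟩
  by_contra hvB
  exact hc v ⟨hv, hvB⟩ SimpleGraph.btw_right

theorem IsProperBlock.boundary_negPart (h : T.IsProperBlock B) :
    T.boundary (T.negPart B) ⊆ T.neg \ B := by
  obtain ⟨b, hb⟩ := h.2.1
  rw [h.negPart_eq hb]
  exact boundary_cellsFrom_subset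

theorem IsProperBlock.compl (h : T.IsProperBlock B) : T.dual.IsProperBlock Bᶜ :=
  T.isProperBlock_dual.2 h

theorem isSignedTube_dual : T.dual.IsSignedTube W.swap ↔ T.IsSignedTube W := by
  have : T.dual.pos = T.neg := compl_compl T.neg
  unfold IsSignedTube
  rw [this]
  change T.IsOpenSubtree W.2 ∧ T.IsOpenSubtree W.1 ∧
    (∀ v ∈ T.boundary W.2, v ∈ T.pos ∧ Sum.inl v ∈ W.1) ∧
    (∀ v ∈ T.boundary W.1, v ∈ T.neg ∧ Sum.inl v ∈ W.2) ↔ _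
  tauto

theorem isIrrelevantTube_dual : T.dual.IsIrrelevantTube W.swap ↔ T.IsIrrelevantTube W := by
  have : T.dual.pos = T.neg := compl_compl T.neg
  unfold IsIrrelevantTube
  rw [this]
  exact or_comm

theorem isRelevantTube_dual : T.dual.IsRelevantTube W.swap ↔ T.IsRelevantTube W :=
  and_congr isSignedTube_dual (not_congr isIrrelevantTube_dual)

theorem tube_dual (T : SignedTree V) (B : Finset V) : T.dual.tube Bᶜ = (T.tube B).swap := by
  refine Prod.ext rfl ?_
  change {c | ∃ b ∈ Bᶜᶜ, c ∈ T.cellsFrom (T.negᶜᶜ \ (Bᶜᶜ : Finset V)) b} = T.negPart B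
  rw [compl_compl, compl_compl]
  rfl

theorem IsProperBlock.isRelevantTube (h : T.IsProperBlock B) : T.IsRelevantTube (T.tube B) := by
  have hirr : ∀ {T : SignedTree V} {B : Finset V}, T.IsProperBlock B →
      ¬ (T.IsComponent T.neg (T.tube B).1 ∧ (T.tube B).2 = Set.univ) := by
    rintro T B h ⟨h1, h2⟩
    obtain ⟨b, hb⟩ := h.2.1
    by_cases hn : b ∈ T.neg
    · exact (isComponent_iff.1 h1).2.1 b (inl_mem_negPart hb) hn
    · have : Sum.inl b ∈ (T.tube B).2 := h2 ▸ Set.mem_univ _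
      have := (inl_mem_negPart_iff (T := T.dual) (v := b) hn).1 this
      exact Finset.mem_compl.1 this hb
  refine ⟨⟨h.isOpenSubtree_negPart, h.compl.isOpenSubtree_negPart, fun v hv => ?_, fun v hv => ?_⟩,
    ?_⟩
  · have := h.boundary_negPart hv
    exact ⟨this.1, inl_mem_negPart (Finset.mem_compl.2 this.2)⟩
  · have := h.compl.boundary_negPart hv
    exact ⟨this.1, inl_mem_negPart (by simpa using this.2)⟩
  · rintro (h1 | h1)
    · exact hirr h h1
    · have h2 := hirr h.compl
      rw [tube_dual] at h2
      have : T.dual.neg = T.pos := rfl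
      exact h2 ⟨this ▸ h1.1, h1.2⟩

theorem mem_iff_tube : v ∈ B ↔
    (v ∈ T.neg ∧ Sum.inl v ∈ (T.tube B).1) ∨ (v ∉ T.neg ∧ Sum.inl v ∉ (T.tube B).2) := by
  by_cases hv : v ∈ T.neg
  · have := inl_mem_negPart_iff (B := B) hv
    simp [hv, tube, this]
  · have : Sum.inl v ∈ (T.tube B).2 ↔ v ∈ Bᶜ := inl_mem_negPart_iff (T := T.dual) (v := v) hv
    rw [this]
    simp [hv]

open Classical in
/-- The block of a signed tube. -/
noncomputable def blockOfTube (T : SignedTree V) (W : Set T.Cell × Set T.Cell) : Finset V :=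
  {v | (v ∈ T.neg ∧ Sum.inl v ∈ W.1) ∨ (v ∉ T.neg ∧ Sum.inl v ∉ W.2)}

theorem mem_blockOfTube : v ∈ T.blockOfTube W ↔
    (v ∈ T.neg ∧ Sum.inl v ∈ W.1) ∨ (v ∉ T.neg ∧ Sum.inl v ∉ W.2) := by
  simp [blockOfTube]

theorem blockOfTube_dual : T.dual.blockOfTube W.swap = (T.blockOfTube W)ᶜ := by
  ext v
  rw [Finset.mem_compl, mem_blockOfTube]
  refine (mem_blockOfTube (T := T.dual)).trans ?_
  change (v ∈ T.negᶜ ∧ Sum.inl v ∈ W.2) ∨ (v ∉ T.negᶜ ∧ Sum.inl v ∉ W.1) ↔ _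
  by_cases hv : v ∈ T.neg <;> simp [hv]

theorem IsRelevantTube.nonempty (hW : T.IsRelevantTube W) : (T.blockOfTube W).Nonempty := by
  rw [Finset.nonempty_iff_ne_empty]
  intro he
  obtain ⟨⟨h1, h2, h3, h4⟩, hirr⟩ := hW
  have hempty : ∀ v, ¬ ((v ∈ T.neg ∧ Sum.inl v ∈ W.1) ∨ (v ∉ T.neg ∧ Sum.inl v ∉ W.2)) := by
    intro v hv
    have := mem_blockOfTube.2 hv
    simp [he] at this
  refine hirr (Or.inl ⟨h1.isComponent (fun v hv hn => hempty v (Or.inl ⟨hn, hv⟩))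
    fun v hv => (h3 v hv).1, h2.eq_univ (Set.eq_empty_of_forall_notMem fun v hv => ?_)⟩)
  exact hempty v (Or.inr ⟨(h4 v hv).1, hv.1⟩)

theorem IsRelevantTube.blockOfTube_subset (hW : T.IsRelevantTube W)
    (hv : v ∈ T.blockOfTube W) : Sum.inl v ∈ W.1 := by
  obtain ⟨⟨h1, h2, h3, h4⟩, hirr⟩ := hW
  rcases mem_blockOfTube.1 hv with h | ⟨hvn, hv2⟩
  · exact h.2
  by_contra hv1
  have hne : (T.boundary W.2).Nonempty := by
    rw [Set.nonempty_iff_ne_empty]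
    intro he
    rw [h2.eq_univ he] at hv2
    exact hv2 (Set.mem_univ _)
  obtain ⟨p, hp⟩ := hne
  obtain ⟨n, hn, hpn⟩ := h1.exists_boundary (h4 p hp).2 hv1
  obtain ⟨p', hp', hnp⟩ := h2.exists_boundary (h3 n hn).2 hv2
  have := hpn.symm.drop T.connected hnp.symm
  exact hn.1 (h1.mem_of_btw (h4 p' hp').2 (h4 p hp).2 this)

theorem IsRelevantTube.isProperBlock (hW : T.IsRelevantTube W) :
    T.IsProperBlock (T.blockOfTube W) := by
  have key : ∀ {T : SignedTree V} {W : Set T.Cell × Set T.Cell}, T.IsRelevantTube W →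
      ∀ x ∈ T.blockOfTube W, ∀ y ∈ T.blockOfTube W, ∀ w ∈ T.neg, T.graph.Btw x w y →
        w ∈ T.blockOfTube W := by
    intro T W hW x hx y hy w hw hb
    exact mem_blockOfTube.2 (Or.inl ⟨hw, hW.1.1.mem_of_btw (hW.blockOfTube_subset hx)
      (hW.blockOfTube_subset hy) hb⟩)
  have hW' := isRelevantTube_dual.2 hW
  refine ⟨T.mem_buildingSet_iff.2 ⟨key hW, fun x hx y hy w hw hb => ?_⟩, hW.nonempty, ?_⟩
  · have := key hW' x (by rw [blockOfTube_dual]; simpa using hx) y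
      (by rw [blockOfTube_dual]; simpa using hy) w hw hb
    rw [blockOfTube_dual] at this
    simpa using this
  · rw [← blockOfTube_dual]
    exact hW'.nonempty

theorem IsRelevantTube.tube_blockOfTube (hW : T.IsRelevantTube W) :
    T.tube (T.blockOfTube W) = W := by
  have key : ∀ {T : SignedTree V} {W : Set T.Cell × Set T.Cell}, T.IsRelevantTube W →
      T.negPart (T.blockOfTube W) = W.1 := by
    intro T W hW
    obtain ⟨b, hb⟩ := hW.nonempty
    rw [hW.isProperBlock.negPart_eq hb]
    refine (hW.1.1.eq_cellsFrom ?_ ?_ (hW.blockOfTube_subset hb)).symm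
    · rintro v hv ⟨hvn, hvB⟩
      exact hvB (mem_blockOfTube.2 (Or.inl ⟨hvn, hv⟩))
    · intro v hv
      refine ⟨(hW.1.2.2.1 v hv).1, fun hvB => ?_⟩
      exact hv.1 (hW.blockOfTube_subset hvB)
  refine Prod.ext (key hW) ?_
  have := key (isRelevantTube_dual.2 hW)
  rw [blockOfTube_dual] at this
  exact this

theorem negNested_tube_iff (h₁ : T.IsProperBlock B₁) (h₂ : T.IsProperBlock B₂) :
    T.NegNested (T.tube B₁) (T.tube B₂) ↔ B₁ ⊆ B₂ := by
  have key : ∀ {T : SignedTree V} {B₁ B₂ : Finset V}, T.IsProperBlock B₁ → T.IsProperBlock B₂ →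
      B₁ ⊆ B₂ → T.negPart B₁ ⊆ T.negPart B₂ := by
    intro T B₁ B₂ h₁ h₂ hs c
    rintro ⟨b, hb, hc⟩
    have hs' : T.neg \ (B₂ : Set V) ⊆ T.neg \ B₁ := fun w hw => ⟨hw.1, fun h => hw.2 (hs h)⟩
    refine ⟨b, hs hb, ?_⟩
    rcases c with v | e
    · exact fun w hw => hc w (hs' hw)
    · obtain ⟨v, hv, hc⟩ := hc
      exact ⟨v, hv, fun w hw => hc w (hs' hw)⟩
  constructor
  · rintro ⟨ha, hb⟩ v hv
    rw [mem_iff_tube]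
    rcases mem_iff_tube.1 hv with ⟨hn, hv⟩ | ⟨hn, hv⟩
    · exact Or.inl ⟨hn, ha hv⟩
    · exact Or.inr ⟨hn, fun h => hv (hb h)⟩
  · exact fun hs => ⟨key h₁ h₂ hs, key h₂.compl h₁.compl (Finset.compl_subset_compl.2 hs)⟩

theorem negDisjoint_tube_iff (h₁ : T.IsProperBlock B₁) (h₂ : T.IsProperBlock B₂) :
    T.NegDisjoint (T.tube B₁) (T.tube B₂) ↔ T.NegSep B₁ B₂ := by
  obtain ⟨x, hx⟩ := h₁.2.1
  obtain ⟨y, hy⟩ := h₂.2.1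
  constructor
  · rintro ⟨hd, -⟩
    have hd' : ∀ c, c ∈ T.negPart B₁ → c ∉ T.negPart B₂ := fun c hc hc' => by
      have : c ∈ (T.tube B₁).1 ∩ (T.tube B₂).1 := ⟨hc, hc'⟩
      rw [hd] at this
      exact this
    have hy1 : Sum.inl y ∉ T.negPart B₁ := fun h => hd' _ h (inl_mem_negPart hy)
    obtain ⟨n, hn, hb⟩ := h₁.isOpenSubtree_negPart.exists_boundary (inl_mem_negPart hx) hy1
    have hn1 := h₁.boundary_negPart hn
    have hn2 : n ∉ B₂ := by
      intro hnB
      obtain ⟨-, e, he, hne⟩ := hn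
      refine hd' _ he ⟨n, hnB, n, hne, fun w hw hbw => hw.2 ?_⟩
      rw [hbw.eq_of_self]
      exact hnB
    refine ⟨n, hn1.1, hn1.2, hn2, fun x' hx' y' hy' => ?_⟩
    have e1 := (hb.split x').resolve_left fun h => hn1.2 (h₁.neg_mem hx hx' hn1.1 h)
    exact (e1.split y').resolve_right fun h => hn2 (h₂.neg_mem hy' hy hn1.1 h)
  · intro hs
    obtain ⟨w, hwn, hw1, hw2, hw⟩ := id hs
    have hb := hw x hx y hy
    constructor
    · rw [Set.eq_empty_iff_forall_notMem]
      rintro c ⟨hc1, hc2⟩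
      change c ∈ T.negPart B₁ at hc1
      change c ∈ T.negPart B₂ at hc2
      rw [h₁.negPart_eq hx] at hc1
      rw [h₂.negPart_eq hy] at hc2
      have key : ∀ v, ¬ T.graph.Btw x w v → ¬ T.graph.Btw y w v → False := fun v h1 h2 =>
        (hb.split v).elim h1 fun h => h2 h.symm
      rcases c with v | e
      · exact key v (hc1 w ⟨hwn, hw1⟩) (hc2 w ⟨hwn, hw2⟩)
      · obtain ⟨v, hv, hc1⟩ := hc1
        obtain ⟨v', hv', hc2⟩ := hc2
        have f1 := hc1 w ⟨hwn, hw1⟩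
        have f2 := hc2 w ⟨hwn, hw2⟩
        by_cases hvv : v = v'
        · exact key v f1 (hvv ▸ f2)
        · have g1 := (hb.split v).resolve_left f1
          have g2 := (g1.split v').resolve_right fun h => f2 h.symm
          rcases g2.eq_or_of_adj (adj_of_mem hv hv' hvv) with rfl | rfl
          · exact f1 SimpleGraph.btw_right
          · exact f2 SimpleGraph.btw_right
    · rw [Set.eq_univ_iff_forall]
      have key : ∀ v, v ∉ B₁ ∨ v ∉ B₂ := fun v => by
        by_cases hv : v ∈ B₁
        · exact Or.inr (hs.notMem hv)
        · exact Or.inl hv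
      rintro (v | e)
      · rcases key v with h | h
        · exact Or.inl (inl_mem_negPart (Finset.mem_compl.2 h))
        · exact Or.inr (inl_mem_negPart (Finset.mem_compl.2 h))
      · obtain ⟨⟨v, v'⟩, he⟩ := e
        have hself : ∀ {B : Finset V}, v ∉ B →
            Sum.inr ⟨s(v, v'), he⟩ ∈ T.dual.negPart Bᶜ := fun {B} hv =>
          ⟨v, Finset.mem_compl.2 hv, v, by simp, fun w hw hbw => hw.2 (by
            rw [hbw.eq_of_self]; exact Finset.mem_compl.2 hv)⟩
        rcases key v with h | h
        · exact Or.inl (hself h)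
        · exact Or.inr (hself h)

theorem posDisjoint_tube_iff (h₁ : T.IsProperBlock B₁) (h₂ : T.IsProperBlock B₂) :
    T.PosDisjoint (T.tube B₁) (T.tube B₂) ↔ T.PosSep B₁ B₂ := by
  rw [← negSep_dual, ← negDisjoint_tube_iff h₁.compl h₂.compl, tube_dual, tube_dual]
  exact and_comm

theorem compatible_tube_iff (h₁ : T.IsProperBlock B₁) (h₂ : T.IsProperBlock B₂) :
    T.Compatible (T.tube B₁) (T.tube B₂) ↔ T.BlockCompatible B₁ B₂ := by
  rw [Compatible, negNested_tube_iff h₁ h₂, negNested_tube_iff h₂ h₁, negDisjoint_tube_iff h₁ h₂,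
    posDisjoint_tube_iff h₁ h₂, BlockCompatible]
  tauto

theorem tube_injective (T : SignedTree V) : Function.Injective T.tube := fun B₁ B₂ he => by
  ext v
  rw [mem_iff_tube (T := T), mem_iff_tube (T := T), he]

/-- The signed nested complex is the complex of nested families of blocks. -/
theorem exists_signedNestedComplex_iso (T : SignedTree V) :
    Nonempty ({𝓑 : Set (Finset V) | T.IsNested 𝓑} ≃o T.signedNestedComplex) := by
  have hmem : ∀ 𝓑, T.IsNested 𝓑 → T.tube '' 𝓑 ∈ T.signedNestedComplex := by
    intro 𝓑 h
    constructor
    · rintro _ ⟨B, hB, rfl⟩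
      exact (h.1 B hB).isRelevantTube
    · rintro _ ⟨B₁, h₁, rfl⟩ _ ⟨B₂, h₂, rfl⟩
      exact (compatible_tube_iff (h.1 _ h₁) (h.1 _ h₂)).2 (h.2 _ h₁ _ h₂)
  let f : {𝓑 : Set (Finset V) | T.IsNested 𝓑} → T.signedNestedComplex :=
    fun 𝓑 => ⟨T.tube '' 𝓑.1, hmem 𝓑.1 𝓑.2⟩
  have hf : ∀ 𝓑₁ 𝓑₂, f 𝓑₁ ≤ f 𝓑₂ ↔ 𝓑₁ ≤ 𝓑₂ := by
    rintro ⟨𝓑₁, h₁⟩ ⟨𝓑₂, h₂⟩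
    change T.tube '' 𝓑₁ ⊆ T.tube '' 𝓑₂ ↔ 𝓑₁ ⊆ 𝓑₂
    refine ⟨fun h B hB => ?_, fun h => Set.image_mono h⟩
    obtain ⟨B', hB', he⟩ := h ⟨B, hB, rfl⟩
    rwa [← T.tube_injective he]
  have hsurj : Function.Surjective f := by
    rintro ⟨N, hN, hN'⟩
    have himage : T.tube '' (T.blockOfTube '' N) = N := by
      rw [Set.image_image]
      ext W
      constructor
      · rintro ⟨W', hW', rfl⟩
        change T.tube (T.blockOfTube W') ∈ N
        rwa [(hN W' hW').tube_blockOfTube]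
      · intro hW
        exact ⟨W, hW, (hN W hW).tube_blockOfTube⟩
    refine ⟨⟨T.blockOfTube '' N, ?_, ?_⟩, Subtype.ext himage⟩
    · rintro _ ⟨W, hW, rfl⟩
      exact (hN W hW).isProperBlock
    · rintro _ ⟨W₁, h₁, rfl⟩ _ ⟨W₂, h₂, rfl⟩
      rw [← compatible_tube_iff (hN _ h₁).isProperBlock (hN _ h₂).isProperBlock,
        (hN _ h₁).tube_blockOfTube, (hN _ h₂).tube_blockOfTube]
      exact hN' _ h₁ _ h₂
  exact ⟨RelIso.ofSurjective (OrderEmbedding.ofMapLEIff f hf) hsurj⟩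

end Tubes

end SignedTree

/-! ### The sides of an edge of a tree -/

namespace SimpleGraph

variable {N : Type*} {G : SimpleGraph N} {a b p q r s m n : N}

theorem IsTree.btw_or_btw (hG : G.IsTree) (h : G.Adj p q) (m : N) : G.Btw p q m ∨ G.Btw q p m := by
  by_contra! hc
  obtain ⟨z, hz, -⟩ := hG.existsUnique_path p m
  have h1 : q ∉ z.support := fun hq => hc.1 ((hG.mem_support_iff_btw hz).1 hq)
  have hp : (Walk.cons h.symm z).IsPath := (Walk.cons_isPath_iff _ _).2 ⟨hz, h1⟩
  exact hc.2 ((hG.mem_support_iff_btw hp).1 (by simp))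

theorem IsTree.not_btw_iff (hG : G.IsTree) (h : G.Adj p q) : ¬ G.Btw p q m ↔ G.Btw q p m :=
  ⟨(hG.btw_or_btw h m).resolve_left,
    fun h1 h2 => h.ne (h1.symm.antisymm hG.connected h2.symm)⟩

theorem Btw.of_not_btw (hs : G.Btw p q s) (hr : G.Btw s r q) (hm : ¬ G.Btw p q m) : G.Btw s r m :=
  ((hs.split m).resolve_left hm).symm.trans hr

theorem IsTree.eq_of_btw_of_not_btw (hG : G.IsTree) (h : G.Adj p q) (h' : G.Adj a b)
    (ha : ¬ G.Btw p q a) (hb : G.Btw p q b) : p = a ∧ q = b := by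
  have hq : q = b := (((hb.split a).resolve_left ha).eq_or_of_adj h').resolve_left
    fun e => ha (e ▸ btw_right)
  subst hq
  have h1 := (hG.not_btw_iff h).1 ha
  exact ⟨(h1.eq_or_of_adj h'.symm).resolve_left h.ne, rfl⟩

theorem IsTree.reachable_deleteEdges_iff (hG : G.IsTree) (h : G.Adj p q) :
    (G.deleteEdges {s(p, q)}).Reachable p m ↔ ¬ G.Btw p q m := by
  classical
  constructor
  · rintro ⟨w⟩ hb
    have hbr := isAcyclic_iff_forall_adj_isBridge.1 hG.isAcyclic h
    have hq := hb (w.mapLe (deleteEdges_le _))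
    rw [Walk.support_mapLe_eq_support] at hq
    exact (isBridge_iff.1 hbr) ⟨w.takeUntil q hq⟩
  · intro hb
    simp only [Btw, not_forall] at hb
    obtain ⟨w, hw⟩ := hb
    refine ⟨w.toDeleteEdges _ fun e he heq => hw ?_⟩
    rw [Set.mem_singleton_iff] at heq
    subst heq
    exact w.snd_mem_support_of_mem_edges he

end SimpleGraph

/-! ### The nested family of a signed spine -/

namespace SignedTree

variable {V N : Type*} {T : SignedTree V} {G : SimpleGraph N} {A : N → N → Prop} {f : V → N}
  {a b c d m n s t : N} {u v w x y : V}

variable (T) in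
/-- The directed tree with underlying graph `G` and with arcs `A`, whose node `n` is labeled by the
fibre of `f` over `n`, satisfies the local conditions of signed spines: the source label sets of
two incoming arcs of a node are separated by a negative element of its label, and such an element
never separates two elements of one of these sets; and dually for outgoing arcs. -/
structure IsSpine (G : SimpleGraph N) (A : N → N → Prop) (f : V → N) : Prop where
  isTree : G.IsTree
  adj_iff : ∀ s t, G.Adj s t ↔ A s t ∨ A t s
  asymm : ∀ s t, A s t → ¬ A t s
  surjective : Function.Surjective f
  exists_neg : ∀ n s s' x y, A s n → A s' n → s ≠ s' → ¬ G.Btw s n (f x) → ¬ G.Btw s' n (f y) →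
    ∃ w, f w = n ∧ w ∈ T.neg ∧ T.graph.Btw x w y
  not_btw_neg : ∀ s x y w, A s (f w) → w ∈ T.neg → ¬ G.Btw s (f w) (f x) →
    ¬ G.Btw s (f w) (f y) → ¬ T.graph.Btw x w y
  exists_pos : ∀ n t t' x y, A n t → A n t' → t ≠ t' → ¬ G.Btw t n (f x) → ¬ G.Btw t' n (f y) →
    ∃ w, f w = n ∧ w ∉ T.neg ∧ T.graph.Btw x w y
  not_btw_pos : ∀ t x y w, A (f w) t → w ∉ T.neg → ¬ G.Btw t (f w) (f x) →
    ¬ G.Btw t (f w) (f y) → ¬ T.graph.Btw x w y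

namespace IsSpine

theorem dual (h : T.IsSpine G A f) : T.dual.IsSpine G (fun s t => A t s) f where
  isTree := h.isTree
  adj_iff s t := (h.adj_iff s t).trans or_comm
  asymm s t := h.asymm t s
  surjective := h.surjective
  exists_neg := h.exists_pos
  not_btw_neg := h.not_btw_pos
  exists_pos n t t' x y h1 h2 h3 h4 h5 := by
    obtain ⟨w, hw, hwn, hb⟩ := h.exists_neg n t t' x y h1 h2 h3 h4 h5
    exact ⟨w, hw, fun hc => hc hwn, hb⟩
  not_btw_pos t x y w h1 h2 := h.not_btw_neg t x y w h1 (not_not.1 h2)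

theorem adj (h : T.IsSpine G A f) (hst : A s t) : G.Adj s t := (h.adj_iff s t).2 (Or.inl hst)

/-- Between two arcs which point towards each other there is a node with two different incoming
arcs, one from either side. -/
theorem exists_peak (h : T.IsSpine G A f) (hab : A a b) (hcd : A c d) (hne : ¬ (a = c ∧ b = d))
    (h1 : ¬ G.Btw b a d) (h2 : ¬ G.Btw d c b) : ∃ m a' c', A a' m ∧ A c' m ∧ a' ≠ c' ∧
      (∀ n, ¬ G.Btw a b n → ¬ G.Btw a' m n) ∧ ∀ n, ¬ G.Btw c d n → ¬ G.Btw c' m n := by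
  have hG := h.isTree
  induction hk : G.dist d b using Nat.strong_induction_on generalizing a b with
  | _ k ih =>
  by_cases hbd : b = d
  · subst hbd
    exact ⟨b, a, c, hab, hcd, fun e => hne ⟨e, rfl⟩, fun _ => id, fun _ => id⟩
  obtain ⟨z, hz, hzd, hzb⟩ := hG.exists_adj_btw hbd
  rcases (h.adj_iff b z).1 hz with hA | hA
  · have hmono : ∀ n, ¬ G.Btw a b n → ¬ G.Btw b z n := fun n hn => by
      rw [hG.not_btw_iff hz]
      refine SimpleGraph.Btw.of_not_btw (p := a) (q := b) ?_ SimpleGraph.btw_right hn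
      rw [← hG.not_btw_iff (h.adj hab).symm]
      exact fun hc => h1 (hzd.trans hc)
    obtain ⟨m, a', c', e1, e2, e3, e4, e5⟩ := ih (G.dist d z)
      (hk ▸ hzd.symm.dist_lt hG.connected hz.ne') (a := b) (b := z) hA
      (by
        rintro ⟨rfl, rfl⟩
        exact h2 SimpleGraph.btw_right)
      hzb (fun hc => h2 (hzd.symm.trans hc)) rfl
    exact ⟨m, a', c', e1, e2, e3, fun n hn => e4 n (hmono n hn), e5⟩
  · refine ⟨b, a, z, hab, hA, ?_, fun _ => id, fun n hn => ?_⟩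
    · rintro rfl
      exact h1 hzd
    · rw [hG.not_btw_iff hz.symm]
      refine SimpleGraph.Btw.of_not_btw (p := c) (q := d) ?_ hzd hn
      rwa [← hG.not_btw_iff (h.adj hcd).symm]

/-- The source label sets of two arcs which point towards each other are separated by a negative
element outside of them. -/
theorem exists_neg_of_facing (h : T.IsSpine G A f) (hab : A a b) (hcd : A c d)
    (hne : ¬ (a = c ∧ b = d)) (h1 : ¬ G.Btw b a d) (h2 : ¬ G.Btw d c b) :
    ∃ w ∈ T.neg, G.Btw a b (f w) ∧ G.Btw c d (f w) ∧
      ∀ x y, ¬ G.Btw a b (f x) → ¬ G.Btw c d (f y) → T.graph.Btw x w y := by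
  obtain ⟨m, a', c', ha, hc, hne', ham, hcm⟩ := h.exists_peak hab hcd hne h1 h2
  obtain ⟨x, rfl⟩ := h.surjective a
  obtain ⟨y, rfl⟩ := h.surjective c
  have hx : ¬ G.Btw (f x) b (f x) := fun e => (h.adj hab).ne' e.eq_of_self
  have hy : ¬ G.Btw (f y) d (f y) := fun e => (h.adj hcd).ne' e.eq_of_self
  obtain ⟨w, rfl, hw, hb⟩ := h.exists_neg m a' c' x y ha hc hne' (ham _ hx) (hcm _ hy)
  refine ⟨w, hw, ?_, ?_, fun x' y' hx' hy' => ?_⟩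
  · by_contra hcon
    exact ham _ hcon SimpleGraph.btw_right
  · by_contra hcon
    exact hcm _ hcon SimpleGraph.btw_right
  · have e1 := (hb.split x').resolve_left
      (h.not_btw_neg a' x x' w ha hw (ham _ hx) (ham _ hx'))
    exact (e1.split y').resolve_right
      (h.not_btw_neg c' y' y w hc hw (hcm _ hy') (hcm _ hy))

/-- The source label set of an arc satisfies the condition on negative vertices of a signed building
block. -/
theorem neg_convex (h : T.IsSpine G A f) (hst : A s t) (hx : ¬ G.Btw s t (f x))
    (hy : ¬ G.Btw s t (f y)) (hw : w ∈ T.neg) (hb : T.graph.Btw x w y) : ¬ G.Btw s t (f w) := by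
  have hG := h.isTree
  intro hc
  by_cases hwt : f w = t
  · subst hwt
    exact h.not_btw_neg s x y w hst hw hx hy hb
  obtain ⟨z, hz, hzt, hzw⟩ := hG.exists_adj_btw hwt
  rcases (h.adj_iff _ z).1 hz with hA | hA
  · obtain ⟨u, hu, hu1, hu2, hub⟩ := h.exists_neg_of_facing hst hA
      (by
        rintro ⟨rfl, -⟩
        exact (h.adj hst).ne' hc.eq_of_self)
      (fun e => (hG.not_btw_iff (h.adj hst).symm).2 hc (hzt.symm.trans e)) hzw
    have hww : ¬ G.Btw (f w) z (f w) := fun e => hz.ne' e.eq_of_self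
    have huw : w = u := by
      rcases hb.split u with e | e
      · exact e.antisymm T.connected (hub x w hx hww)
      · exact e.symm.antisymm T.connected (hub y w hy hww)
    exact hww (huw ▸ hu2)
  · have hmono : ∀ n, ¬ G.Btw s t n → ¬ G.Btw z (f w) n := fun n hn => by
      rw [hG.not_btw_iff hz.symm]
      exact SimpleGraph.Btw.of_not_btw hc hzt hn
    exact h.not_btw_neg z x y w hA hw (hmono _ hx) (hmono _ hy) hb

end IsSpine

variable [Fintype V] [DecidableEq V] {B : Finset V} {𝓑 : Set (Finset V)}

/-- The source label sets of the arcs of a directed tree. -/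
def sourceFamily (G : SimpleGraph N) (A : N → N → Prop) (f : V → N) : Set (Finset V) :=
  {B | ∃ s t, A s t ∧ ∀ x, x ∈ B ↔ ¬ G.Btw s t (f x)}

namespace IsSpine

theorem exists_mem_sourceFamily (hst : A s t) :
    ∃ B ∈ sourceFamily G A f, ∀ x, x ∈ B ↔ ¬ G.Btw s t (f x) := by
  classical
  exact ⟨({x | ¬ G.Btw s t (f x)} : Finset V), ⟨s, t, hst, by simp⟩, by simp⟩

/-- Every edge of the spine gives a block that separates the same elements. -/
theorem exists_separating_iff (h : T.IsSpine G A f) (hst : G.Adj s t) :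
    ∃ B ∈ sourceFamily G A f, ∀ x y, (x ∈ B ↔ y ∈ B) ↔ (G.Btw s t (f x) ↔ G.Btw s t (f y)) := by
  rcases (h.adj_iff s t).1 hst with hA | hA
  · obtain ⟨B, hB, hm⟩ := exists_mem_sourceFamily (G := G) (f := f) hA
    exact ⟨B, hB, fun x y => by rw [hm, hm, not_iff_not]⟩
  · obtain ⟨B, hB, hm⟩ := exists_mem_sourceFamily (G := G) (f := f) hA
    exact ⟨B, hB, fun x y => by
      rw [hm, hm, h.isTree.not_btw_iff hst.symm, h.isTree.not_btw_iff hst.symm]⟩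

/-- The source label sets of the arcs of a signed spine form a nested family. -/
theorem isNested (h : T.IsSpine G A f) : T.IsNested (sourceFamily G A f) := by
  have hG := h.isTree
  refine ⟨?_, ?_⟩
  · rintro B ⟨s, t, hst, hm⟩
    refine ⟨T.mem_buildingSet_iff.2 ⟨fun x hx y hy w hw hb => ?_, fun x hx y hy w hw hb => ?_⟩,
      ?_, ?_⟩
    · rw [hm] at hx hy ⊢
      exact h.neg_convex hst hx hy hw hb
    · rw [hm, not_not, ← hG.not_btw_iff (h.adj hst).symm] at hx hy ⊢
      exact h.dual.neg_convex hst hx hy hw hb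
    · obtain ⟨x, rfl⟩ := h.surjective s
      exact ⟨x, (hm x).2 fun e => (h.adj hst).ne' e.eq_of_self⟩
    · obtain ⟨x, rfl⟩ := h.surjective t
      exact ⟨x, Finset.mem_compl.2 fun e => (hm x).1 e SimpleGraph.btw_right⟩
  · rintro B₁ ⟨a, b, hab, hm₁⟩ B₂ ⟨c, d, hcd, hm₂⟩
    have hsep : ∀ {T : SignedTree V} {A : N → N → Prop} {a b c d : N} {B₁ B₂ : Finset V},
        T.IsSpine G A f → A a b → (∀ x, x ∈ B₁ ↔ ¬ G.Btw a b (f x)) → A c d →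
        (∀ x, x ∈ B₂ ↔ ¬ G.Btw c d (f x)) → ¬ (a = c ∧ b = d) → ¬ G.Btw b a d → ¬ G.Btw d c b →
        T.NegSep B₁ B₂ := by
      intro T A a b c d B₁ B₂ h hab hm₁ hcd hm₂ heq h1 h2
      obtain ⟨w, hw, hw1, hw2, hb⟩ := h.exists_neg_of_facing hab hcd heq h1 h2
      exact ⟨w, hw, fun e => (hm₁ w).1 e hw1, fun e => (hm₂ w).1 e hw2, fun x hx y hy =>
        hb x y ((hm₁ x).1 hx) ((hm₂ y).1 hy)⟩
    by_cases heq : a = c ∧ b = d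
    · obtain ⟨rfl, rfl⟩ := heq
      exact Or.inl fun x hx => (hm₂ x).2 ((hm₁ x).1 hx)
    by_cases hP : G.Btw b a d <;> by_cases hQ : G.Btw d c b
    · have key : ∀ {a b c d : N}, A a b → A c d → G.Btw b a d → G.Btw d c b → G.Btw b a c := by
        intro a b c d hab hcd hP hQ
        rcases hG.btw_total hP hQ.symm with e | e
        · exact e
        · rcases e.eq_or_of_adj (h.adj hab).symm with rfl | rfl
          · rcases hP.eq_or_of_adj (h.adj hcd) with rfl | rfl
            · exact ((h.adj hab).ne rfl).elim
            · exact (h.asymm _ _ hab hcd).elim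
          · exact SimpleGraph.btw_right
      have h1 := (hG.not_btw_iff (h.adj hab)).2 (key hab hcd hP hQ)
      have h2 := (hG.not_btw_iff (h.adj hcd)).2 (key hcd hab hQ hP)
      refine Or.inr (Or.inr (Or.inr (negSep_dual.1 (hsep h.dual hab (fun x => ?_) hcd
        (fun x => ?_) (fun e => heq e.symm) h1 h2))))
      · rw [Finset.mem_compl, hm₁, hG.not_btw_iff (h.adj hab).symm, not_not]
      · rw [Finset.mem_compl, hm₂, hG.not_btw_iff (h.adj hcd).symm, not_not]
    · refine Or.inr (Or.inl fun x hx => ?_)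
      rw [hm₁, hG.not_btw_iff (h.adj hab)]
      rw [hm₂] at hx
      exact SimpleGraph.Btw.of_not_btw ((hG.not_btw_iff (h.adj hcd).symm).1 hQ) hP hx
    · refine Or.inl fun x hx => ?_
      rw [hm₂, hG.not_btw_iff (h.adj hcd)]
      rw [hm₁] at hx
      exact SimpleGraph.Btw.of_not_btw ((hG.not_btw_iff (h.adj hab).symm).1 hP) hQ hx
    · exact Or.inr (Or.inr (Or.inl (hsep h hab hm₁ hcd hm₂ heq hP hQ)))

theorem separators_eq_empty_iff (h : T.IsSpine G A f) :
    separators (sourceFamily G A f) u v = ∅ ↔ f u = f v := by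
  constructor
  · intro he
    by_contra hne
    obtain ⟨z, hz, h1, h2⟩ := h.isTree.exists_adj_btw hne
    obtain ⟨B, hB, hm⟩ := h.exists_separating_iff hz
    have : B ∈ separators (sourceFamily G A f) u v := mem_separators.2 ⟨hB, fun e =>
      hz.ne' (((hm u v).1 e).2 h1).eq_of_self⟩
    simp [he] at this
  · intro he
    rw [Finset.eq_empty_iff_forall_notMem]
    intro B hB
    obtain ⟨⟨s, t, -, hm⟩, hne⟩ := mem_separators.1 hB
    rw [hm, hm, he] at hne
    exact hne Iff.rfl

/-- The arcs of a signed spine are the arcs of the tree that is dual to its nested family. -/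
theorem isArc_iff (h : T.IsSpine G A f) : IsArc (sourceFamily G A f) B u v ↔
    A (f u) (f v) ∧ ∀ x, x ∈ B ↔ ¬ G.Btw (f u) (f v) (f x) := by
  have hG := h.isTree
  constructor
  · rintro ⟨⟨s, t, hst, hm⟩, hu, hv, huniq⟩
    have key : ∀ {s t : N} {u v : V}, G.Adj s t → ¬ G.Btw s t (f u) → G.Btw s t (f v) →
        (∀ x, (x ∈ B ↔ u ∈ B) ↔ ¬ G.Btw s t (f x)) →
        (∀ C ∈ sourceFamily G A f, C ≠ B → (u ∈ C ↔ v ∈ C)) → f u = s := by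
      intro s t u v hst hu hv hm huniq
      by_contra hne
      obtain ⟨z, hz, hzs, hzu⟩ := hG.exists_adj_btw hne
      obtain ⟨C, hC, hmC⟩ := h.exists_separating_iff hz
      have huu : ¬ G.Btw (f u) z (f u) := fun e => hz.ne' e.eq_of_self
      have hCB : C ≠ B := by
        rintro rfl
        obtain ⟨y, rfl⟩ := h.surjective s
        have e1 : (y ∈ C ↔ u ∈ C) :=
          (hm y).2 fun e => hst.ne' e.eq_of_self
        exact huu (((hmC u y).1 e1.symm).2 hzs)
      refine huu (((hmC u v).1 (huniq C hC hCB)).2 ?_)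
      have h3 : G.Btw (f u) s (f v) := by
        refine (SimpleGraph.Btw.of_not_btw (p := t) (q := s) ((hG.not_btw_iff hst).1 hu)
          SimpleGraph.btw_right ((hG.not_btw_iff hst.symm).2 hv))
      exact h3.trans hzs
    rw [hm] at hu hv
    rw [not_not] at hv
    obtain rfl := key (h.adj hst) hu hv (fun x => by rw [hm, hm]; tauto) huniq
    obtain rfl := key (h.adj hst).symm (u := v) (v := u)
      ((hG.not_btw_iff (h.adj hst).symm).2 hv) ((hG.not_btw_iff (h.adj hst)).1 hu)
      (fun x => by rw [hm, hm, hG.not_btw_iff (h.adj hst).symm]; tauto)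
      (fun C hC hne => (huniq C hC hne).symm)
    exact ⟨hst, hm⟩
  · rintro ⟨hA, hm⟩
    refine ⟨⟨_, _, hA, hm⟩, (hm u).2 fun e => (h.adj hA).ne' e.eq_of_self,
      fun e => (hm v).1 e SimpleGraph.btw_right, ?_⟩
    rintro C ⟨p, q, hpq, hmC⟩ hne
    by_contra hcon
    rw [hmC, hmC] at hcon
    by_cases hu : G.Btw p q (f u)
    · have hv : ¬ G.Btw p q (f v) := by tauto
      obtain ⟨rfl, rfl⟩ := hG.eq_of_btw_of_not_btw (h.adj hpq) (h.adj hA).symm hv hu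
      exact h.asymm _ _ hA hpq
    · have hv : G.Btw p q (f v) := by tauto
      obtain ⟨rfl, rfl⟩ := hG.eq_of_btw_of_not_btw (h.adj hpq) (h.adj hA) hu hv
      exact hne (Finset.ext fun x => (hmC x).trans (hm x).symm)

theorem arc_iff (h : T.IsSpine G A f) :
    A (f u) (f v) ↔ ∃ B, IsArc (sourceFamily G A f) B u v := by
  classical
  constructor
  · intro hA
    exact ⟨({x | ¬ G.Btw (f u) (f v) (f x)} : Finset V), h.isArc_iff.2 ⟨hA, by simp⟩⟩
  · rintro ⟨B, hB⟩
    exact (h.isArc_iff.1 hB).1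

theorem mem_familyCone_iff (h : T.IsSpine G A f) {g : V → ℝ} :
    g ∈ familyCone (sourceFamily G A f) ↔ g ∈ hyperplane V ∧
      ∀ u v, Relation.ReflTransGen A (f u) (f v) → g u ≤ g v := by
  refine and_congr_right fun _ => ⟨fun ⟨h1, h2⟩ u v hr => ?_, fun h1 => ⟨?_, fun u v he => ?_⟩⟩
  · generalize hn : f v = n at hr
    induction hr generalizing v with
    | refl => exact (h2 u v (h.separators_eq_empty_iff.2 hn.symm)).le
    | @tail m n _ hA ih =>
      obtain ⟨w, rfl⟩ := h.surjective m
      subst hn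
      obtain ⟨B, hB⟩ := h.arc_iff.1 hA
      exact (ih w rfl).trans (h1 B w v hB)
  · exact fun B u v ha => h1 u v (Relation.ReflTransGen.single (h.arc_iff.2 ⟨B, ha⟩))
  · have he := h.separators_eq_empty_iff.1 he
    refine le_antisymm (h1 u v ?_) (h1 v u ?_) <;> rw [he]

end IsSpine

end SignedTree

/-! ### The signed spine of a nested family -/

namespace SignedTree

section Realization

variable {V N : Type*} [Fintype V] [DecidableEq V] {T : SignedTree V} {𝓑 : Set (Finset V)}
  {G : SimpleGraph N} {A : N → N → Prop} {f : V → N} {B : Finset V} {u v x y : V}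

/-- The directed tree that is dual to the family `𝓑`: its nodes are the classes of elements of `V`
which are not separated by members of `𝓑`, and it has an arc for every member of `𝓑`. -/
structure IsDualTree (𝓑 : Set (Finset V)) (G : SimpleGraph N) (A : N → N → Prop) (f : V → N) :
    Prop where
  surjective : Function.Surjective f
  eq_iff : ∀ u v, f u = f v ↔ ∀ B ∈ 𝓑, (u ∈ B ↔ v ∈ B)
  arc_iff : ∀ u v, A (f u) (f v) ↔ ∃ B, IsArc 𝓑 B u v
  adj_iff : ∀ s t, G.Adj s t ↔ A s t ∨ A t s

namespace IsDualTree

/-- Without the arc of `B`, no walk of the dual tree leaves or enters `B`. -/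
theorem mem_iff_of_reachable (hD : IsDualTree 𝓑 G A f) (h : T.IsNested 𝓑) (ha : IsArc 𝓑 B u v)
    (hr : (G.deleteEdges {s(f u, f v)}).Reachable (f x) (f y)) : x ∈ B ↔ y ∈ B := by
  have H : ∀ {m n : N} (_ : (G.deleteEdges {s(f u, f v)}).Walk m n) (x y : V),
      f x = m → f y = n → (x ∈ B ↔ y ∈ B) := by
    intro m n p
    induction p with
    | nil =>
      rintro x y rfl he
      exact ((hD.eq_iff _ _).1 he.symm) B ha.1
    | @cons a b c hab p ih =>
      rintro x y rfl hy
      obtain ⟨z, rfl⟩ := hD.surjective b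
      rw [← ih z y rfl hy]
      rw [SimpleGraph.deleteEdges_adj, hD.adj_iff, hD.arc_iff, hD.arc_iff] at hab
      obtain ⟨hab, hne⟩ := hab
      have key : ∀ {C : Finset V} {p q : V}, IsArc 𝓑 C p q → s(f p, f q) ≠ s(f u, f v) →
          (p ∈ B ↔ q ∈ B) := by
        intro C p q hC hne
        refine hC.2.2.2 B ha.1 ?_
        rintro rfl
        have h1 := (hD.eq_iff _ _).2 fun C hC' => (hC.mem_iff h ha hC').1
        have h2 := (hD.eq_iff _ _).2 fun C hC' => (hC.mem_iff h ha hC').2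
        rw [h1, h2] at hne
        exact hne rfl
      rcases hab with ⟨C, hC⟩ | ⟨C, hC⟩
      · exact key hC hne
      · exact (key hC (by rwa [Sym2.eq_swap])).symm
  obtain ⟨p⟩ := hr
  exact H p x y rfl rfl

theorem asymm (hD : IsDualTree 𝓑 G A f) (s t : N) (h : A s t) : ¬ A t s := by
  obtain ⟨u, rfl⟩ := hD.surjective s
  obtain ⟨v, rfl⟩ := hD.surjective t
  rw [hD.arc_iff] at h ⊢
  obtain ⟨B, hB⟩ := h
  rintro ⟨C, hC⟩
  by_cases hCB : C = B
  · subst hCB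
    exact hC.2.2.1 hB.2.1
  · exact hC.2.2.1 ((hB.2.2.2 C hC.1 hCB).2 hC.2.1)

theorem isTree (hD : IsDualTree 𝓑 G A f) (h : T.IsNested 𝓑) : G.IsTree := by
  have hreach : ∀ x y, G.Reachable (f x) (f y) := by
    refine h.path_induction (fun x y he => ?_) fun x z y B hB hz ih => ?_
    · have : f x = f y := (hD.eq_iff x y).2 fun B hB => by
        by_contra hc
        have := mem_separators.2 ⟨hB, hc⟩
        simp [he] at this
      rw [this]
    · refine SimpleGraph.Reachable.trans (SimpleGraph.Adj.reachable ?_) ih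
      rw [hD.adj_iff, hD.arc_iff, hD.arc_iff]
      exact (isArc_or_of_separators_eq hB).imp (fun h => ⟨B, h⟩) fun h => ⟨B, h⟩
  obtain ⟨v₀⟩ := T.connected.nonempty
  have : Nonempty N := ⟨f v₀⟩
  refine ⟨SimpleGraph.Connected.mk fun m n => ?_, ?_⟩
  · obtain ⟨x, rfl⟩ := hD.surjective m
    obtain ⟨y, rfl⟩ := hD.surjective n
    exact hreach x y
  · rw [SimpleGraph.isAcyclic_iff_forall_adj_isBridge]
    intro m n hmn
    have key : ∀ m n, A m n → G.IsBridge s(m, n) := by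
      intro m n hA
      obtain ⟨x, rfl⟩ := hD.surjective m
      obtain ⟨y, rfl⟩ := hD.surjective n
      obtain ⟨B, hB⟩ := (hD.arc_iff _ _).1 hA
      rw [SimpleGraph.isBridge_iff]
      exact fun hr => hB.2.2.1 ((hD.mem_iff_of_reachable h hB hr).1 hB.2.1)
    rcases (hD.adj_iff m n).1 hmn with hA | hA
    · exact key m n hA
    · rw [Sym2.eq_swap]
      exact key n m hA

/-- The block of an arc is the source label set of the arc. -/
theorem mem_iff (hD : IsDualTree 𝓑 G A f) (h : T.IsNested 𝓑) (ha : IsArc 𝓑 B u v) :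
    x ∈ B ↔ ¬ G.Btw (f u) (f v) (f x) := by
  have hG := hD.isTree h
  have hadj : G.Adj (f u) (f v) := (hD.adj_iff _ _).2 (Or.inl ((hD.arc_iff _ _).2 ⟨B, ha⟩))
  constructor
  · intro hx hb
    rw [← hG.not_btw_iff hadj.symm, ← hG.reachable_deleteEdges_iff hadj.symm, Sym2.eq_swap] at hb
    exact ha.2.2.1 ((hD.mem_iff_of_reachable h ha hb).2 hx)
  · intro hb
    rw [← hG.reachable_deleteEdges_iff hadj] at hb
    exact (hD.mem_iff_of_reachable h ha hb).1 ha.2.1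

theorem dual (hD : IsDualTree 𝓑 G A f) :
    IsDualTree (compl ⁻¹' 𝓑) G (fun s t => A t s) f where
  surjective := hD.surjective
  eq_iff u v := by
    rw [hD.eq_iff]
    refine ⟨fun h B hB => ?_, fun h B hB => ?_⟩
    · have := h _ hB
      simp only [Finset.mem_compl] at this
      tauto
    · have := h Bᶜ (by simpa using hB)
      simp only [Finset.mem_compl] at this
      tauto
  arc_iff u v := by
    rw [hD.arc_iff]
    have key : ∀ {𝓑 : Set (Finset V)} {B : Finset V} {u v : V}, IsArc 𝓑 B v u →
        IsArc (compl ⁻¹' 𝓑) Bᶜ u v := by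
      intro 𝓑 B u v h
      refine ⟨by simpa using h.1, Finset.mem_compl.2 h.2.2.1, fun e => Finset.mem_compl.1 e h.2.1,
        fun C hC hne => ?_⟩
      have := h.2.2.2 Cᶜ hC fun e => hne (by rw [← e, compl_compl])
      simp only [Finset.mem_compl] at this
      tauto
    refine ⟨fun ⟨B, hB⟩ => ⟨_, key hB⟩, fun ⟨B, hB⟩ => ⟨Bᶜ, ?_⟩⟩
    have := key hB
    rwa [← Set.preimage_comp, show (compl ∘ compl : Finset V → Finset V) = id from
      funext compl_compl, Set.preimage_id] at this
  adj_iff s t := (hD.adj_iff s t).trans or_comm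

/-- The blocks of two arcs into a common node are incomparable and do not cover `V`, so they are
separated by a negative vertex; one such vertex belongs to the label of the node. -/
theorem exists_neg (hD : IsDualTree 𝓑 G A f) (h : T.IsNested 𝓑) (n s s' : N) (x y : V)
    (hs : A s n) (hs' : A s' n) (hne : s ≠ s') (hx : ¬ G.Btw s n (f x))
    (hy : ¬ G.Btw s' n (f y)) : ∃ w, f w = n ∧ w ∈ T.neg ∧ T.graph.Btw x w y := by
  obtain ⟨u, rfl⟩ := hD.surjective s
  obtain ⟨u', rfl⟩ := hD.surjective s'
  obtain ⟨v, rfl⟩ := hD.surjective n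
  obtain ⟨B, hB⟩ := (hD.arc_iff _ _).1 hs
  obtain ⟨B', hB'⟩ := (hD.arc_iff _ _).1 hs'
  rw [← hD.mem_iff h hB] at hx
  rw [← hD.mem_iff h hB'] at hy
  have hBB : B ≠ B' := by
    rintro rfl
    exact hne ((hD.eq_iff _ _).2 fun C hC => (hB.mem_iff h hB' hC).1)
  have hu : u ∉ B' := fun hu => hB'.2.2.1 ((hB.2.2.2 B' hB'.1 hBB.symm).1 hu)
  have hu' : u' ∉ B := fun hu => hB.2.2.1 ((hB'.2.2.2 B hB.1 hBB).1 hu)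
  have hsep : T.NegSep B B' := by
    rcases h.2 B hB.1 B' hB'.1 with hc | hc | hc | hc
    · exact (hu (hc hB.2.1)).elim
    · exact (hu' (hc hB'.2.1)).elim
    · exact hc
    · exact (hB'.2.2.1 (hc.mem hB.2.2.1)).elim
  obtain ⟨z, hz, hb, hz1, hz2, hp⟩ := h.onPath_of_negSep hB.1 hsep hx hy
  refine ⟨z, (hD.eq_iff _ _).2 fun C hC => ?_, hz, hb⟩
  by_cases hCB : C = B
  · subst hCB
    exact iff_of_false hz1 hB.2.2.1
  by_cases hCB' : C = B'
  · subst hCB'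
    exact iff_of_false hz2 hB'.2.2.1
  have e := hB.2.2.2 C hC hCB
  have e' := hB'.2.2.2 C hC hCB'
  have c := h.2 B hB.1 C hC
  have c' := h.2 B' hB'.1 C hC
  have hp := hp C hC
  by_cases hzC : z ∈ C <;> by_cases hvC : v ∈ C
  · exact iff_of_true hzC hvC
  · exfalso
    have hxC : x ∉ C := fun hxC =>
      c.not_crossing hx hxC hB.2.1 (fun h => hvC (e.1 h)) hz1 hzC hB.2.2.1 hvC
    have hyC : y ∉ C := fun hyC =>
      c'.not_crossing hy hyC hB'.2.1 (fun h => hvC (e'.1 h)) hz2 hzC hB'.2.2.1 hvC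
    exact hxC ((hp (iff_of_false hxC hyC)).1 hzC)
  · exfalso
    have hxC : x ∈ C := by_contra fun hxC =>
      c.not_crossing hB.2.1 (e.2 hvC) hx hxC hB.2.2.1 hvC hz1 hzC
    have hyC : y ∈ C := by_contra fun hyC =>
      c'.not_crossing hB'.2.1 (e'.2 hvC) hy hyC hB'.2.2.1 hvC hz2 hzC
    exact hzC ((hp (iff_of_true hxC hyC)).2 hxC)
  · exact iff_of_false hzC hvC

theorem not_btw_neg (hD : IsDualTree 𝓑 G A f) (h : T.IsNested 𝓑) (s : N) (x y w : V)
    (hs : A s (f w)) (hw : w ∈ T.neg) (hx : ¬ G.Btw s (f w) (f x)) (hy : ¬ G.Btw s (f w) (f y)) :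
    ¬ T.graph.Btw x w y := by
  obtain ⟨u, rfl⟩ := hD.surjective s
  obtain ⟨B, hB⟩ := (hD.arc_iff _ _).1 hs
  rw [← hD.mem_iff h hB] at hx hy
  exact fun hb => hB.2.2.1 ((h.1 B hB.1).neg_mem hx hy hw hb)

/-- The directed tree dual to a nested family is a signed spine. -/
theorem isSpine (hD : IsDualTree 𝓑 G A f) (h : T.IsNested 𝓑) : T.IsSpine G A f where
  isTree := hD.isTree h
  adj_iff := hD.adj_iff
  asymm := hD.asymm
  surjective := hD.surjective
  exists_neg := hD.exists_neg h
  not_btw_neg := hD.not_btw_neg h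
  exists_pos := hD.dual.exists_neg h.dual
  not_btw_pos := hD.dual.not_btw_neg h.dual

theorem sourceFamily_eq (hD : IsDualTree 𝓑 G A f) (h : T.IsNested 𝓑) :
    sourceFamily G A f = 𝓑 := by
  ext B
  constructor
  · rintro ⟨s, t, hst, hm⟩
    obtain ⟨u, rfl⟩ := hD.surjective s
    obtain ⟨v, rfl⟩ := hD.surjective t
    obtain ⟨C, hC⟩ := (hD.arc_iff _ _).1 hst
    rw [Finset.ext fun x => (hm x).trans (hD.mem_iff h hC).symm]
    exact hC.1
  · intro hB
    obtain ⟨u, v, ha⟩ := h.exists_isArc hB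
    exact ⟨f u, f v, (hD.arc_iff _ _).2 ⟨B, ha⟩, fun x => hD.mem_iff h ha⟩

end IsDualTree

end Realization

end SignedTree

/-! ### Signed spines and nested families -/

namespace LabeledDirectedTree

variable {V : Type*} [Fintype V] [DecidableEq V] {T : SignedTree V} {S : LabeledDirectedTree V}
  {m n s t : S.Node} {u v x y : V}

theorem nodeOf_eq_iff : S.nodeOf v = n ↔ v ∈ n.1 := by
  rw [Subtype.ext_iff]
  exact S.nodes.part_eq_iff_mem n.2

theorem mem_nodeOf : v ∈ (S.nodeOf v).1 := nodeOf_eq_iff.1 rfl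

theorem nodeOf_surjective : Function.Surjective S.nodeOf := fun n => by
  obtain ⟨v, hv⟩ := S.nodes.nonempty_of_mem_parts n.2
  exact ⟨v, nodeOf_eq_iff.2 hv⟩

theorem graph_adj : S.graph.Adj s t ↔ S.arc s.1 t.1 ∨ S.arc t.1 s.1 := by
  refine (SimpleGraph.fromRel_adj _ _ _).trans ?_
  refine and_iff_right_of_imp ?_
  rintro h rfl
  rcases h with h | h <;> exact S.arc_asymm _ _ h h

theorem mem_source (h : S.arc s.1 t.1) :
    v ∈ S.source s t ↔ ¬ S.graph.Btw s t (S.nodeOf v) :=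
  S.isTree.reachable_deleteEdges_iff (graph_adj.2 (Or.inl h))

theorem mem_sink (h : S.arc s.1 t.1) :
    v ∈ S.sink s t ↔ ¬ S.graph.Btw t s (S.nodeOf v) := by
  rw [← S.isTree.reachable_deleteEdges_iff (graph_adj.2 (Or.inr h)), Sym2.eq_swap]
  rfl

/-- One half of the local condition of signed spines, in terms of betweenness. -/
theorem exists_components_iff {ι : Type*} {U : Set V} {L : ι → Set V}
    (hL : ∀ i, (L i).Nonempty) (hU : ∀ i, ∀ x ∈ L i, x ∉ U) :
    (∃ g : ι → {Z : Set T.Cell // T.IsComponent U Z}, Function.Injective g ∧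
      ∀ i, ∀ v ∈ L i, Sum.inl v ∈ (g i).1) ↔
    (∀ i j x y, i ≠ j → x ∈ L i → y ∈ L j → ∃ w ∈ U, T.graph.Btw x w y) ∧
      ∀ i, ∀ x ∈ L i, ∀ y ∈ L i, ∀ w ∈ U, ¬ T.graph.Btw x w y := by
  have hself : ∀ i, ∀ x ∈ L i, Sum.inl x ∈ T.cellsFrom U x := fun i x hx w hw hb =>
    hU i x hx (hb.eq_of_self ▸ hw)
  constructor
  · rintro ⟨g, hg, hgL⟩
    have hcells : ∀ i, ∀ x ∈ L i, (g i).1 = T.cellsFrom U x := fun i x hx =>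
      (g i).2.eq_of_mem (SignedTree.isComponent_cellsFrom (hU i x hx)) (hgL i x hx) (hself i x hx)
    refine ⟨fun i j x y hij hx hy => ?_, fun i x hx y hy w hw => ?_⟩
    · by_contra! hc
      refine hij (hg (Subtype.ext ((g i).2.eq_of_mem (g j).2 (c := Sum.inl y) ?_ (hgL j y hy))))
      rw [hcells i x hx]
      exact hc
    · have := hgL i y hy
      rw [hcells i x hx] at this
      exact this w hw
  · rintro ⟨h1, h2⟩
    choose p hp using hL
    refine ⟨fun i => ⟨T.cellsFrom U (p i), SignedTree.isComponent_cellsFrom (hU i _ (hp i))⟩,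
      fun i j hij => ?_, fun i v hv w hw => h2 i _ (hp i) _ hv w hw⟩
    by_contra hne
    obtain ⟨w, hw, hb⟩ := h1 i j _ _ hne (hp i) (hp j)
    have he : T.cellsFrom U (p i) = T.cellsFrom U (p j) := congrArg Subtype.val hij
    have : Sum.inl (p j) ∈ T.cellsFrom U (p i) := he ▸ hself j _ (hp j)
    exact this w hw hb

/-- The local condition at a node: the label sets of two different arcs are separated in `T` by a
vertex of the appropriate sign in the label, and no such vertex separates a single label set. -/
theorem localCondition_iff : S.LocalCondition T n ↔
    ((∀ i j : {s : S.Node // S.arc s.1 n.1}, ∀ x y, i ≠ j → x ∈ S.source i.1 n →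
        y ∈ S.source j.1 n → ∃ w ∈ (n.1 : Set V) ∩ T.neg, T.graph.Btw x w y) ∧
      ∀ i : {s : S.Node // S.arc s.1 n.1}, ∀ x ∈ S.source i.1 n, ∀ y ∈ S.source i.1 n,
        ∀ w ∈ (n.1 : Set V) ∩ T.neg, ¬ T.graph.Btw x w y) ∧
    (∀ i j : {t : S.Node // S.arc n.1 t.1}, ∀ x y, i ≠ j → x ∈ S.sink n i.1 →
        y ∈ S.sink n j.1 → ∃ w ∈ (n.1 : Set V) ∩ T.pos, T.graph.Btw x w y) ∧
      ∀ i : {t : S.Node // S.arc n.1 t.1}, ∀ x ∈ S.sink n i.1, ∀ y ∈ S.sink n i.1,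
        ∀ w ∈ (n.1 : Set V) ∩ T.pos, ¬ T.graph.Btw x w y := by
  refine and_congr ?_ ?_
  · refine exists_components_iff (fun i => ?_) fun i x hx hxU => ?_
    · obtain ⟨x, hx⟩ := nodeOf_surjective i.1
      refine ⟨x, (mem_source i.2).2 fun e => ?_⟩
      rw [hx] at e
      exact (graph_adj.2 (Or.inl i.2)).ne' e.eq_of_self
    · rw [mem_source i.2, nodeOf_eq_iff.2 hxU.1] at hx
      exact hx SimpleGraph.btw_right
  · refine exists_components_iff (fun i => ?_) fun i x hx hxU => ?_
    · obtain ⟨x, hx⟩ := nodeOf_surjective i.1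
      refine ⟨x, (mem_sink i.2).2 fun e => ?_⟩
      rw [hx] at e
      exact (graph_adj.2 (Or.inl i.2)).ne e.eq_of_self
    · rw [mem_sink i.2, nodeOf_eq_iff.2 hxU.1] at hx
      exact hx SimpleGraph.btw_right

theorem forall_localCondition_iff : (∀ n, S.LocalCondition T n) ↔
    T.IsSpine S.graph (fun s t => S.arc s.1 t.1) S.nodeOf := by
  simp_rw [localCondition_iff]
  constructor
  · intro h
    refine ⟨S.isTree, fun s t => graph_adj, fun s t => S.arc_asymm _ _, nodeOf_surjective,
      fun n s s' x y hs hs' hne hx hy => ?_, fun s x y w hs hw hx hy => ?_,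
      fun n s s' x y hs hs' hne hx hy => ?_, fun s x y w hs hw hx hy => ?_⟩
    · obtain ⟨w, hw, hb⟩ := (h n).1.1 ⟨s, hs⟩ ⟨s', hs'⟩ x y (fun e => hne (congrArg Subtype.val e))
        ((mem_source hs).2 hx) ((mem_source hs').2 hy)
      exact ⟨w, nodeOf_eq_iff.2 hw.1, hw.2, hb⟩
    · exact (h _).1.2 ⟨s, hs⟩ x ((mem_source hs).2 hx) y ((mem_source hs).2 hy) w ⟨mem_nodeOf, hw⟩
    · obtain ⟨w, hw, hb⟩ := (h n).2.1 ⟨s, hs⟩ ⟨s', hs'⟩ x y (fun e => hne (congrArg Subtype.val e))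
        ((mem_sink hs).2 hx) ((mem_sink hs').2 hy)
      exact ⟨w, nodeOf_eq_iff.2 hw.1, hw.2, hb⟩
    · exact (h _).2.2 ⟨s, hs⟩ x ((mem_sink hs).2 hx) y ((mem_sink hs).2 hy) w ⟨mem_nodeOf, hw⟩
  · intro h n
    refine ⟨⟨fun i j x y hij hx hy => ?_, fun i x hx y hy w hw => ?_⟩,
      fun i j x y hij hx hy => ?_, fun i x hx y hy w hw => ?_⟩
    · rw [mem_source i.2] at hx
      rw [mem_source j.2] at hy
      obtain ⟨w, hw, hwn, hb⟩ := h.exists_neg n i.1 j.1 x y i.2 j.2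
        (fun e => hij (Subtype.ext e)) hx hy
      exact ⟨w, ⟨nodeOf_eq_iff.1 hw, hwn⟩, hb⟩
    · rw [mem_source i.2] at hx hy
      obtain rfl := nodeOf_eq_iff.2 hw.1
      exact h.not_btw_neg i.1 x y w i.2 hw.2 hx hy
    · rw [mem_sink i.2] at hx
      rw [mem_sink j.2] at hy
      obtain ⟨w, hw, hwn, hb⟩ := h.exists_pos n i.1 j.1 x y i.2 j.2
        (fun e => hij (Subtype.ext e)) hx hy
      exact ⟨w, ⟨nodeOf_eq_iff.1 hw, hwn⟩, hb⟩
    · rw [mem_sink i.2] at hx hy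
      obtain rfl := nodeOf_eq_iff.2 hw.1
      exact h.not_btw_pos i.1 x y w i.2 hw.2 hx hy

end LabeledDirectedTree

namespace SignedSpine

open LabeledDirectedTree SignedTree

variable {V : Type*} [Fintype V] [DecidableEq V] {T : SignedTree V} {S S' : SignedSpine T}
  {𝓑 : Set (Finset V)} {B : Finset V} {u v : V}

theorem isSpine (S : SignedSpine T) : T.IsSpine S.graph (fun s t => S.arc s.1 t.1) S.nodeOf :=
  forall_localCondition_iff.1 S.local_condition

/-- The nested family of a signed spine: the source label sets of its arcs. -/
def family (S : SignedSpine T) : Set (Finset V) :=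
  sourceFamily S.graph (fun s t => S.arc s.1 t.1) S.nodeOf

theorem isNested_family (S : SignedSpine T) : T.IsNested S.family := S.isSpine.isNested

theorem arc_iff : S.arc (S.nodeOf u).1 (S.nodeOf v).1 ↔ ∃ B, IsArc S.family B u v :=
  S.isSpine.arc_iff

theorem nodeOf_eq_nodeOf_iff : S.nodeOf u = S.nodeOf v ↔ ∀ B ∈ S.family, (u ∈ B ↔ v ∈ B) := by
  rw [← S.isSpine.separators_eq_empty_iff, Finset.eq_empty_iff_forall_notMem]
  simp only [mem_separators, not_and, not_not]
  rfl

theorem cone_eq (S : SignedSpine T) : S.cone = familyCone S.family :=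
  Set.ext fun _ => S.isSpine.mem_familyCone_iff.symm

end SignedSpine

namespace SignedTree

open LabeledDirectedTree SignedSpine

variable {V : Type*} [Fintype V] [DecidableEq V] {T : SignedTree V} {S S' : SignedSpine T}
  {𝓑 : Set (Finset V)} {B : Finset V} {u v : V}

theorem IsNested.exists_signedSpine (h : T.IsNested 𝓑) : ∃ S : SignedSpine T, S.family = 𝓑 := by
  classical
  let r : Setoid V := ⟨fun u v => ∀ B ∈ 𝓑, (u ∈ B ↔ v ∈ B), ⟨fun u B _ => Iff.rfl,
    fun h B hB => (h B hB).symm, fun h h' B hB => (h B hB).trans (h' B hB)⟩⟩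
  let P : Finpartition (Finset.univ : Finset V) := Finpartition.ofSetoid r
  let arc : Finset V → Finset V → Prop :=
    fun s t => ∃ u v B, IsArc 𝓑 B u v ∧ s = P.part u ∧ t = P.part v
  have hP : ∀ u v, P.part u = P.part v ↔ ∀ B ∈ 𝓑, (u ∈ B ↔ v ∈ B) := fun u v => by
    rw [← P.mem_part_iff_part_eq_part (Finset.mem_univ u) (Finset.mem_univ v)]
    refine Finpartition.mem_part_ofSetoid_iff_rel.trans ?_
    exact ⟨fun h B hB => (h B hB).symm, fun h B hB => (h B hB).symm⟩
  have harc : ∀ u v, arc (P.part u) (P.part v) ↔ ∃ B, IsArc 𝓑 B u v := by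
    refine fun u v => ⟨?_, fun ⟨B, hB⟩ => ⟨u, v, B, hB, rfl, rfl⟩⟩
    rintro ⟨u', v', B, hB, hu, hv⟩
    rw [hP] at hu hv
    exact ⟨B, hB.1, (hu B hB.1).2 hB.2.1, fun h => hB.2.2.1 ((hv B hB.1).1 h),
      fun C hC hne => by rw [hu C hC, hv C hC]; exact hB.2.2.2 C hC hne⟩
  let f : V → {U : Finset V // U ∈ P.parts} := fun v => ⟨P.part v, P.part_mem.2 (Finset.mem_univ v)⟩
  have hasymm : ∀ s t, arc s t → ¬ arc t s := by
    rintro _ _ ⟨u, v, B, hB, rfl, rfl⟩ ha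
    obtain ⟨C, hC⟩ := (harc _ _).1 ha
    by_cases hCB : C = B
    · subst hCB
      exact hC.2.2.1 hB.2.1
    · exact hC.2.2.1 ((hB.2.2.2 C hC.1 hCB).2 hC.2.1)
  have hD : IsDualTree 𝓑 (arcGraph P.parts arc) (fun s t => arc s.1 t.1) f :=
    { surjective := fun n => by
        obtain ⟨v, hv⟩ := P.nonempty_of_mem_parts n.2
        exact ⟨v, Subtype.ext (P.part_eq_of_mem n.2 hv)⟩
      eq_iff := fun u v => by rw [← hP, Subtype.ext_iff]
      arc_iff := harc
      adj_iff := fun s t => by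
        rw [arcGraph, SimpleGraph.fromRel_adj]
        refine and_iff_right_of_imp ?_
        rintro h rfl
        rcases h with h | h <;> exact hasymm _ _ h h }
  let S : LabeledDirectedTree V :=
    { nodes := P
      arc := arc
      mem_of_arc := by
        rintro _ _ ⟨u, v, B, hB, rfl, rfl⟩
        exact ⟨P.part_mem.2 (Finset.mem_univ u), P.part_mem.2 (Finset.mem_univ v)⟩
      arc_asymm := hasymm
      isTree := hD.isTree h }
  exact ⟨⟨S, forall_localCondition_iff.2 (hD.isSpine h)⟩, hD.sourceFamily_eq h⟩

/-- The spine fan consists of the cones of the nested families. -/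
theorem spineFan_eq (T : SignedTree V) :
    T.spineFan = {C | ∃ 𝓑, T.IsNested 𝓑 ∧ C = familyCone 𝓑} := by
  ext C
  constructor
  · rintro ⟨S, rfl⟩
    exact ⟨S.family, S.isNested_family, S.cone_eq⟩
  · rintro ⟨𝓑, h, rfl⟩
    obtain ⟨S, rfl⟩ := h.exists_signedSpine
    exact ⟨S, S.cone_eq.symm⟩

end SignedTree

/-! ### Maximal signed spines -/

namespace SignedSpine

open LabeledDirectedTree SignedTree

variable {V : Type*} [Fintype V] [DecidableEq V] {T : SignedTree V} {S S' : SignedSpine T}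
  {𝓑 : Set (Finset V)} {B : Finset V} {u v : V}

theorem nodeOf_le_iff {n : S.Node} : (S'.nodeOf v).1 ⊆ n.1 ↔
    ∀ u, S'.nodeOf u = S'.nodeOf v → S.nodeOf u = n := by
  simp only [nodeOf_eq_iff, Finset.subset_iff]

/-- Spines with smaller families are contractions: the arcs of the members that are left out are
contracted. -/
theorem isContractionOf_of_subset (h : S.family ⊆ S'.family) :
    S.toLabeledDirectedTree.IsContractionOf S'.toLabeledDirectedTree := by
  have heq : ∀ {u v}, S'.nodeOf u = S'.nodeOf v → S.nodeOf u = S.nodeOf v := fun he =>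
    nodeOf_eq_nodeOf_iff.2 fun B hB => nodeOf_eq_nodeOf_iff.1 he B (h hB)
  have hle : ∀ v, (S'.nodeOf v).1 ⊆ (S.nodeOf v).1 := fun v =>
    nodeOf_le_iff.2 fun u hu => heq hu
  have hle' : ∀ {v} {n : S.Node}, (S'.nodeOf v).1 ⊆ n.1 ↔ S.nodeOf v = n := fun {v n} =>
    ⟨fun hs => nodeOf_le_iff.1 hs v rfl, fun he => he ▸ hle v⟩
  refine ⟨?_, ?_, ?_⟩
  · intro p hp
    obtain ⟨v, hv⟩ := nodeOf_surjective (S := S'.toLabeledDirectedTree) ⟨p, hp⟩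
    refine ⟨(S.nodeOf v).1, (S.nodeOf v).2, ?_⟩
    have := hle v
    rw [hv] at this
    exact this
  · intro n
    have hreach : ∀ x y, S.nodeOf x = S.nodeOf y → ∀ (hx : (S'.nodeOf x).1 ⊆ n.1)
        (hy : (S'.nodeOf y).1 ⊆ n.1), (S'.graph.induce {n' : S'.Node | n'.1 ⊆ n.1}).Reachable
          ⟨S'.nodeOf x, hx⟩ ⟨S'.nodeOf y, hy⟩ := by
      refine S'.isNested_family.path_induction (fun x y he _ hx hy => ?_)
        fun x z y B hB hz ih hxy hx hy => ?_
      · have := S'.isSpine.separators_eq_empty_iff.1 he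
        have e : (⟨S'.nodeOf x, hx⟩ : {n' : S'.Node | n'.1 ⊆ n.1}) = ⟨S'.nodeOf y, hy⟩ :=
          Subtype.ext this
        rw [e]
      · have hzx : S.nodeOf z = S.nodeOf x := nodeOf_eq_nodeOf_iff.2 fun C hC =>
          hz C (h hC) (nodeOf_eq_nodeOf_iff.1 hxy C hC)
        have hzn : (S'.nodeOf z).1 ⊆ n.1 := hle'.2 (hzx.trans (hle'.1 hx))
        refine SimpleGraph.Reachable.trans (SimpleGraph.Adj.reachable ?_)
          (ih (hzx.trans hxy) hzn hy)
        rw [SimpleGraph.induce_adj, graph_adj, arc_iff, arc_iff]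
        exact (isArc_or_of_separators_eq hB).imp (fun h => ⟨B, h⟩) fun h => ⟨B, h⟩
    obtain ⟨v, rfl⟩ := nodeOf_surjective n
    have : Nonempty {n' : S'.Node | n'.1 ⊆ (S.nodeOf v).1} := ⟨⟨S'.nodeOf v, hle v⟩⟩
    refine SimpleGraph.Connected.mk ?_
    rintro ⟨a, ha⟩ ⟨b, hb⟩
    obtain ⟨x, rfl⟩ := nodeOf_surjective a
    obtain ⟨y, rfl⟩ := nodeOf_surjective b
    exact hreach x y ((hle'.1 ha).trans (hle'.1 hb).symm) ha hb
  · intro m n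
    constructor
    · intro hmn
      refine ⟨fun e => S.arc_asymm _ _ hmn (e ▸ hmn), ?_⟩
      obtain ⟨x, rfl⟩ := nodeOf_surjective m
      obtain ⟨y, rfl⟩ := nodeOf_surjective n
      obtain ⟨B, hB⟩ := arc_iff.1 hmn
      obtain ⟨u, v, ha⟩ := S'.isNested_family.exists_isArc (h hB.1)
      have ha' : IsArc S.family B u v := ha.of_subset h hB.1
      have hu : S.nodeOf u = S.nodeOf x :=
        nodeOf_eq_nodeOf_iff.2 fun C hC => (ha'.mem_iff S.isNested_family hB hC).1
      have hv : S.nodeOf v = S.nodeOf y :=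
        nodeOf_eq_nodeOf_iff.2 fun C hC => (ha'.mem_iff S.isNested_family hB hC).2
      exact ⟨S'.nodeOf u, S'.nodeOf v, hle'.2 hu, hle'.2 hv, arc_iff.2 ⟨B, ha⟩⟩
    · rintro ⟨hne, m', n', hm, hn, hA⟩
      obtain ⟨u, rfl⟩ := nodeOf_surjective m'
      obtain ⟨v, rfl⟩ := nodeOf_surjective n'
      obtain ⟨C, hC⟩ := arc_iff.1 hA
      obtain rfl := hle'.1 hm
      obtain rfl := hle'.1 hn
      rw [ne_eq, nodeOf_eq_nodeOf_iff] at hne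
      push Not at hne
      obtain ⟨B, hB, hsep⟩ := hne
      have hBC : B = C := by
        by_contra hBC
        have := hC.2.2.2 B (h hB) hBC
        tauto
      subst hBC
      exact arc_iff.2 ⟨B, hC.of_subset h hB⟩

theorem nodeOf_injective_iff : Function.Injective S.nodeOf ↔ IsSeparating S.family :=
  forall₂_congr fun _ _ => imp_congr_left nodeOf_eq_nodeOf_iff

theorem ext_of_arc (hn : S.nodes = S'.nodes) (ha : ∀ s t, S.arc s t ↔ S'.arc s t) : S = S' := by
  obtain ⟨⟨P, a, h1, h2, h3⟩, h4⟩ := S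
  obtain ⟨⟨P', a', h1', h2', h3'⟩, h4'⟩ := S'
  obtain rfl : P = P' := hn
  obtain rfl : a = a' := funext fun s => funext fun t => propext (ha s t)
  rfl

/-- The maximal signed spines are the spines whose nodes are labeled by single vertices. -/
theorem isMaximal_iff : S.IsMaximal ↔ IsSeparating S.family := by
  constructor
  · intro h
    obtain ⟨𝓑, h𝓑, hn, hs⟩ := S.isNested_family.exists_isSeparating
    obtain ⟨S', rfl⟩ := hn.exists_signedSpine
    rwa [← h S' (isContractionOf_of_subset h𝓑)]
  · rintro hs S' ⟨hle, -, harc⟩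
    rw [← nodeOf_injective_iff] at hs
    have hbot : S.nodes ≤ ⊥ := by
      intro p hp
      obtain ⟨v, hv⟩ := nodeOf_surjective (S := S.toLabeledDirectedTree) ⟨p, hp⟩
      refine ⟨{v}, Finpartition.mem_bot_iff.2 ⟨v, Finset.mem_univ v, rfl⟩, fun u hu => ?_⟩
      rw [Finset.mem_singleton]
      exact hs ((nodeOf_eq_iff (n := ⟨p, hp⟩).2 hu).trans hv.symm)
    have hnodes : S'.nodes = S.nodes :=
      le_antisymm hle (hbot.trans bot_le)
    have hpart : ∀ {m m' : Finset V}, m ∈ S.nodes.parts → m' ∈ S'.nodes.parts → m' ⊆ m →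
        m' = m := fun {m m'} hm hm' hs => by
      rw [hnodes] at hm'
      obtain ⟨x, hx⟩ := S.nodes.nonempty_of_mem_parts hm'
      exact S.nodes.eq_of_mem_parts hm' hm hx (hs hx)
    refine ext_of_arc hnodes fun s t => ⟨fun hst => ?_, fun hst => ?_⟩
    · obtain ⟨h1, h2⟩ := S'.mem_of_arc s t hst
      have h1' : s ∈ S.nodes.parts := hnodes ▸ h1
      have h2' : t ∈ S.nodes.parts := hnodes ▸ h2
      refine (harc ⟨s, h1'⟩ ⟨t, h2'⟩).2 ⟨fun e => ?_, ⟨s, h1⟩, ⟨t, h2⟩, subset_rfl, subset_rfl, hst⟩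
      obtain rfl : s = t := congrArg Subtype.val e
      exact S'.arc_asymm _ _ hst hst
    · obtain ⟨h1, h2⟩ := S.mem_of_arc s t hst
      obtain ⟨-, m', n', hm, hn, hA⟩ := (harc ⟨s, h1⟩ ⟨t, h2⟩).1 hst
      rwa [hpart h1 m'.2 hm, hpart h2 n'.2 hn] at hA

end SignedSpine

/-! ### Counting the paths through a vertex of a tree -/

namespace SimpleGraph

variable {N : Type*} [Fintype N] {G : SimpleGraph N} {n m m' k x y x' y' : N}

open Classical in
/-- The vertices of the branch at `n` of the tree `G` that starts with the neighbour `m` of `n`. -/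
noncomputable def branch (G : SimpleGraph N) (n m : N) : Finset N := {k | ¬ G.Btw m n k}

theorem mem_branch : k ∈ G.branch n m ↔ ¬ G.Btw m n k := by simp [branch]

theorem self_notMem_branch : n ∉ G.branch n m := by simp [mem_branch, btw_right]

theorem IsTree.mem_branch_iff (hG : G.IsTree) (h : G.Adj n m) :
    k ∈ G.branch n m ↔ G.Btw n m k := by
  rw [mem_branch, hG.not_btw_iff h.symm]

theorem IsTree.exists_mem_branch (hG : G.IsTree) (hk : k ≠ n) :
    ∃ m, G.Adj n m ∧ k ∈ G.branch n m := by
  obtain ⟨m, hm, h1, h2⟩ := hG.exists_adj_btw hk.symm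
  exact ⟨m, hm, mem_branch.2 h2⟩

theorem IsTree.branch_unique (hG : G.IsTree) (h : G.Adj n m) (h' : G.Adj n m')
    (hk : k ∈ G.branch n m) (hk' : k ∈ G.branch n m') : m = m' := by
  rw [hG.mem_branch_iff h] at hk
  rw [hG.mem_branch_iff h'] at hk'
  rcases hG.btw_total hk hk' with e | e
  · exact (e.eq_or_of_adj h').resolve_left h.ne'
  · exact ((e.eq_or_of_adj h).resolve_left h'.ne').symm

theorem IsTree.disjoint_branch (hG : G.IsTree) (h : G.Adj n m) (h' : G.Adj n m') (hne : m ≠ m') :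
    Disjoint (G.branch n m) (G.branch n m') :=
  Finset.disjoint_left.2 fun _ hk hk' => hne (hG.branch_unique h h' hk hk')

theorem IsTree.not_btw_iff_branch (hG : G.IsTree) :
    ¬ G.Btw x n y ↔ ∃ m, G.Adj n m ∧ x ∈ G.branch n m ∧ y ∈ G.branch n m := by
  constructor
  · intro h
    obtain ⟨m, hm, hx⟩ := hG.exists_mem_branch (n := n) (k := x)
      fun e => h (e ▸ btw_left)
    exact ⟨m, hm, hx, mem_branch.2 fun hc => (hc.split x).elim (mem_branch.1 hx) h⟩
  · rintro ⟨m, hm, hx, hy⟩ hb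
    exact (hb.split m).elim (fun e => mem_branch.1 hx e.symm) (mem_branch.1 hy)

/-- A path through `n` uses the edge from `n` to `m` if and only if one of its ends belongs to the
branch of `m`. -/
theorem IsTree.toSubgraph_adj_iff (hG : G.IsTree) {p : G.Walk x y} (hp : p.IsPath)
    (hn : G.Btw x n y) (h : G.Adj n m) :
    p.toSubgraph.Adj n m ↔ x ∈ G.branch n m ∨ y ∈ G.branch n m := by
  classical
  rw [← Subgraph.mem_edgeSet, Walk.mem_edges_toSubgraph, hG.mem_branch_iff h, hG.mem_branch_iff h]
  constructor
  · intro he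
    have hm := (hG.mem_support_iff_btw hp).1 (p.snd_mem_support_of_mem_edges he)
    exact (hm.split n).imp Btw.symm id
  · intro hxy
    by_contra he
    have key : ∀ {k} (q : G.Walk k n), (∀ e ∈ q.edges, e ∈ p.edges) → ¬ G.Btw n m k := by
      intro k q hq
      rw [← hG.reachable_deleteEdges_iff h]
      refine ⟨(q.toDeleteEdges {s(n, m)} fun e heq hs => he ?_).reverse⟩
      rw [Set.mem_singleton_iff] at hs
      exact hs ▸ hq e heq
    have hns := (hG.mem_support_iff_btw hp).2 hn
    rcases hxy with e | e
    · exact key (p.takeUntil n hns) (fun e he => p.edges_takeUntil_subset_edges hns he) e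
    · refine key (p.dropUntil n hns).reverse (fun e he => p.edges_dropUntil_subset_edges hns ?_) e
      simpa using he

theorem IsTree.eq_of_forall_btw_iff (hG : G.IsTree) (h : ∀ k, G.Btw x k y ↔ G.Btw x' k y') :
    s(x, y) = s(x', y') := by
  have hC := hG.connected
  have hx := (h x).1 btw_left
  have hy := (h y).1 btw_right
  have hx' := (h x').2 btw_left
  have hy' := (h y').2 btw_right
  rw [Sym2.eq_iff]
  rcases hG.btw_total hx' hy' with e | e
  · have h1 : x = x' := hx.symm.antisymm hC e.symm
    subst h1
    exact Or.inl ⟨rfl, hy'.antisymm hC hy |>.symm⟩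
  · have h1 : x = y' := hx.antisymm hC e.symm
    subst h1
    exact Or.inr ⟨rfl, (hx'.antisymm hC hy.symm).symm⟩

/-- In a tree, the undirected paths correspond to the unordered pairs of vertices. -/
theorem IsTree.exists_sym2_path (hG : G.IsTree) : ∃ Φ : Sym2 N → G.Subgraph,
    Function.Injective Φ ∧ ∀ x y (p : G.Walk x y), p.IsPath → Φ s(x, y) = p.toSubgraph := by
  choose P hP using fun x y => hG.connected.exists_isPath x y
  have huniq : ∀ {x y} (p : G.Walk x y), p.IsPath → P x y = p := fun {x y} p hp =>
    congrArg Subtype.val ((hG.isAcyclic.subsingleton_path x y).elim ⟨P x y, hP x y⟩ ⟨p, hp⟩)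
  refine ⟨Sym2.lift ⟨fun x y => (P x y).toSubgraph, fun x y => ?_⟩, ?_, fun x y p hp => ?_⟩
  · change (P x y).toSubgraph = (P y x).toSubgraph
    rw [huniq (P y x).reverse (hP y x).reverse, Walk.toSubgraph_reverse]
  · intro a b
    induction a using Sym2.inductionOn with | _ x y
    induction b using Sym2.inductionOn with | _ x' y'
    intro hab
    refine hG.eq_of_forall_btw_iff fun k => ?_
    rw [← hG.mem_support_iff_btw (hP x y), ← hG.mem_support_iff_btw (hP x' y'),
      ← Walk.mem_verts_toSubgraph, ← Walk.mem_verts_toSubgraph]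
    have : (P x y).toSubgraph = (P x' y').toSubgraph := hab
    rw [this]
  · change (P x y).toSubgraph = _
    rw [huniq p hp]

variable {M : Finset N} {E : Set N}

open Classical in
theorem IsTree.eq_insert_biUnion_branch (hG : G.IsTree)
    (hM : ∀ m, m ∈ M ↔ G.Adj n m ∧ m ∉ E) (hE : ∀ e ∈ E, G.Adj n e) :
    ({k | ∀ e ∈ E, k ∉ G.branch n e} : Finset N) = insert n (M.biUnion (G.branch n)) := by
  ext k
  simp only [Finset.mem_filter, Finset.mem_univ, true_and, Finset.mem_insert, Finset.mem_biUnion]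
  constructor
  · intro hk
    by_cases hkn : k = n
    · exact Or.inl hkn
    · obtain ⟨m, hm, hkm⟩ := hG.exists_mem_branch hkn
      exact Or.inr ⟨m, (hM m).2 ⟨hm, fun he => hk m he hkm⟩, hkm⟩
  · rintro (rfl | ⟨m, hm, hkm⟩) e he hke
    · exact self_notMem_branch hke
    · rw [hM] at hm
      exact hm.2 (hG.branch_unique hm.1 (hE e he) hkm hke ▸ he)

theorem IsTree.card_insert_biUnion_branch (hG : G.IsTree) [DecidableEq N]
    (hM : ∀ m ∈ M, G.Adj n m) :
    (insert n (M.biUnion (G.branch n))).card = 1 + ∑ m ∈ M, (G.branch n m).card := by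
  rw [Finset.card_insert_of_notMem, Finset.card_biUnion, add_comm]
  · exact fun m hm m' hm' hne => hG.disjoint_branch (hM m hm) (hM m' hm') hne
  · simp [self_notMem_branch]

/-- The number of paths through `n` which avoid a given set of edges at `n`: the paths through `n`
correspond to the pairs of vertices which are not in a common branch at `n`. -/
theorem IsTree.ncard_paths (hG : G.IsTree) (hM : ∀ m, m ∈ M ↔ G.Adj n m ∧ m ∉ E)
    (hE : ∀ e ∈ E, G.Adj n e) :
    {π : G.Subgraph | (∃ (x y : N) (p : G.Walk x y), p.IsPath ∧ π = p.toSubgraph) ∧ n ∈ π.verts ∧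
      ∀ e ∈ E, ¬ π.Adj n e}.ncard + ∑ m ∈ M, ((G.branch n m).card + 1).choose 2 =
      (1 + (∑ m ∈ M, (G.branch n m).card) + 1).choose 2 := by
  classical
  obtain ⟨Φ, hΦ, hp⟩ := hG.exists_sym2_path
  set X : Finset N := {k | ∀ e ∈ E, k ∉ G.branch n e} with hX
  have hXM := hG.eq_insert_biUnion_branch hM hE
  have hMadj : ∀ m ∈ M, G.Adj n m := fun m hm => ((hM m).1 hm).1
  set Y := X.sym2 \ M.biUnion fun m => (G.branch n m).sym2 with hY
  have himage : {π : G.Subgraph | (∃ (x y : N) (p : G.Walk x y), p.IsPath ∧ π = p.toSubgraph) ∧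
      n ∈ π.verts ∧ ∀ e ∈ E, ¬ π.Adj n e} = Φ '' (Y : Set (Sym2 N)) := by
    have hmem : ∀ x y, s(x, y) ∈ Y ↔ x ∈ X ∧ y ∈ X ∧ G.Btw x n y := by
      intro x y
      rw [hY, Finset.mem_sdiff, Finset.mk_mem_sym2_iff, and_assoc]
      refine and_congr_right fun hx => and_congr_right fun hy => ?_
      rw [← not_iff_not, not_not, hG.not_btw_iff_branch, Finset.mem_biUnion]
      refine exists_congr fun m => ?_
      rw [Finset.mk_mem_sym2_iff, hM, and_assoc]
      refine and_congr_right fun hm => ⟨fun h => h.2, fun h => ⟨fun he => ?_, h⟩⟩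
      rw [hX, Finset.mem_filter] at hx
      exact hx.2 m he h.1
    have hcond : ∀ {x y : N} (p : G.Walk x y), p.IsPath →
        ((n ∈ p.toSubgraph.verts ∧ ∀ e ∈ E, ¬ p.toSubgraph.Adj n e) ↔ s(x, y) ∈ Y) := by
      intro x y p hp
      rw [hmem, Walk.mem_verts_toSubgraph, hG.mem_support_iff_btw hp, ← and_assoc, and_comm]
      refine and_congr_left fun hb => ?_
      simp only [hX, Finset.mem_filter, Finset.mem_univ, true_and]
      rw [← forall₂_and]
      refine forall₂_congr fun e he => ?_
      rw [hG.toSubgraph_adj_iff hp hb (hE e he), not_or]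
    ext π
    constructor
    · rintro ⟨⟨x, y, p, hpp, rfl⟩, h⟩
      exact ⟨s(x, y), (hcond p hpp).1 h, hp x y p hpp⟩
    · rintro ⟨z, hz, rfl⟩
      induction z using Sym2.inductionOn with | _ x y
      obtain ⟨p, hpp⟩ := hG.connected.exists_isPath x y
      rw [hp x y p hpp]
      exact ⟨⟨x, y, p, hpp, rfl⟩, (hcond p hpp).2 hz⟩
  rw [himage, Set.ncard_image_of_injective _ hΦ, Set.ncard_coe_finset, hY,
    ← hG.card_insert_biUnion_branch hMadj, ← hXM, ← hX, ← Finset.card_sym2 X]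
  have hsum : (M.biUnion fun m => (G.branch n m).sym2).card =
      ∑ m ∈ M, ((G.branch n m).card + 1).choose 2 := by
    rw [Finset.card_biUnion]
    · exact Finset.sum_congr rfl fun m _ => Finset.card_sym2 _
    · intro m hm m' hm' hne
      rw [Function.onFun, Finset.disjoint_left]
      intro z
      induction z using Sym2.inductionOn with | _ x y
      rw [Finset.mk_mem_sym2_iff, Finset.mk_mem_sym2_iff]
      exact fun h h' => hne (hG.branch_unique (hMadj m hm) (hMadj m' hm') h.1 h'.1)
  rw [← hsum]
  refine Finset.card_sdiff_add_card_eq_card ?_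
  rw [Finset.biUnion_subset]
  intro m hm
  refine Finset.sym2_mono ?_
  rw [hX, hXM]
  exact (Finset.subset_biUnion_of_mem (G.branch n) hm).trans (Finset.subset_insert _ _)


/-- The number of paths through `n` which avoid the edge from `n` to the only element of `M'`, if
there is one. -/
theorem IsTree.ncard_paths_eq (hG : G.IsTree) {M M' : Finset N} (hd : Disjoint M M')
    (hM : ∀ m, G.Adj n m ↔ m ∈ M ∨ m ∈ M') (hM' : ∀ m ∈ M', ∀ m' ∈ M', m = m') :
    ({π : G.Subgraph | (∃ (x y : N) (p : G.Walk x y), p.IsPath ∧ π = p.toSubgraph) ∧ n ∈ π.verts ∧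
      ∀ e ∈ M', ¬ π.Adj n e}.ncard : ℝ) = ((Fintype.card N : ℝ) + 1) / 2 +
      (∑ m ∈ M, ((G.branch n m).card : ℝ) * (Fintype.card N - (G.branch n m).card) -
        ∑ m ∈ M', ((G.branch n m).card : ℝ) * (Fintype.card N - (G.branch n m).card)) / 2 := by
  classical
  have h1 := hG.ncard_paths (n := n) (M := M) (E := (M' : Set N))
    (fun m => by
      rw [hM]
      have : m ∈ M → m ∉ M' := fun h => Finset.disjoint_left.1 hd h
      simp only [Finset.mem_coe]
      tauto)
    (fun e he => (hM e).2 (Or.inr he))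
  have h2 : Fintype.card N =
      1 + (∑ m ∈ M, (G.branch n m).card + ∑ m ∈ M', (G.branch n m).card) := by
    rw [← Finset.sum_union hd, ← hG.card_insert_biUnion_branch (n := n)
      (fun m hm => (hM m).2 (Finset.mem_union.1 hm)), ← hG.eq_insert_biUnion_branch (E := ∅)]
    · simp
    · intro m
      simp [hM]
    · simp
  have h3 : ∑ m ∈ M', ((G.branch n m).card : ℝ) * (Fintype.card N - (G.branch n m).card) =
      (∑ m ∈ M', ((G.branch n m).card : ℝ)) *
        (Fintype.card N - ∑ m ∈ M', ((G.branch n m).card : ℝ)) := by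
    rcases M'.eq_empty_or_nonempty with rfl | ⟨m, hm⟩
    · simp
    · rw [Finset.eq_singleton_iff_unique_mem.2 ⟨hm, fun m' hm' => hM' m' hm' m hm⟩]
      simp
  have h1' := congrArg (Nat.cast : ℕ → ℝ) h1
  have h2' := congrArg (Nat.cast : ℕ → ℝ) h2
  have h4 : ∑ m ∈ M, ((G.branch n m).card : ℝ) * (Fintype.card N - (G.branch n m).card) =
      Fintype.card N * ∑ m ∈ M, ((G.branch n m).card : ℝ) -
        ∑ m ∈ M, ((G.branch n m).card : ℝ) ^ 2 := by
    rw [Finset.mul_sum, ← Finset.sum_sub_distrib]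
    exact Finset.sum_congr rfl fun _ _ => by ring
  have h5 : ∑ m ∈ M, ((((G.branch n m).card + 1).choose 2 : ℕ) : ℝ) =
      (∑ m ∈ M, ((G.branch n m).card : ℝ) ^ 2 + ∑ m ∈ M, ((G.branch n m).card : ℝ)) / 2 := by
    rw [← Finset.sum_add_distrib, Finset.sum_div]
    exact Finset.sum_congr rfl fun _ _ => by rw [SignedTree.choose_two_eq]; ring
  rw [Nat.cast_add, Nat.cast_sum, h5, SignedTree.choose_two_eq] at h1'
  push_cast at h1' h2'
  rw [h3, h4, h2']
  linear_combination h1'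

end SimpleGraph

/-! ### The points of the maximal signed spines -/

namespace SignedSpine

open LabeledDirectedTree SignedTree

variable {V : Type*} [Fintype V] [DecidableEq V] {T : SignedTree V} {S : SignedSpine T}

open Classical in
/-- At a node of a maximal spine, the arcs correspond to the branches, and the block of an arc or
its complement is the set of labels in the branch. -/
theorem sum_incoming_eq (hs : IsSeparating S.family) (v : V) :
    ∑ B with ∃ u, IsArc S.family B u v, (B.card : ℝ) * (Fintype.card V - B.card) =
      ∑ m : S.Node with S.arc m.1 (S.nodeOf v).1, ((S.graph.branch (S.nodeOf v) m).card : ℝ) *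
        (Fintype.card S.Node - (S.graph.branch (S.nodeOf v) m).card) ∧
    ∑ B with ∃ w, IsArc S.family B v w, (B.card : ℝ) * (Fintype.card V - B.card) =
      ∑ m : S.Node with S.arc (S.nodeOf v).1 m.1, ((S.graph.branch (S.nodeOf v) m).card : ℝ) *
        (Fintype.card S.Node - (S.graph.branch (S.nodeOf v) m).card) := by
  have hG := S.isTree
  have hbij : Function.Bijective S.nodeOf := ⟨nodeOf_injective_iff.2 hs, nodeOf_surjective⟩
  have hcard : Fintype.card S.Node = Fintype.card V :=
    (Fintype.card_congr (Equiv.ofBijective _ hbij)).symm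
  set n := S.nodeOf v with hn
  let block : S.Node → Finset V := fun m => {x | S.nodeOf x ∈ S.graph.branch n m}
  have hblock : ∀ m x, x ∈ block m ↔ ¬ S.graph.Btw m n (S.nodeOf x) := fun m x => by
    simp [block, SimpleGraph.mem_branch]
  have hbc : ∀ m, (block m).card = (S.graph.branch n m).card := fun m => by
    refine Finset.card_nbij S.nodeOf (fun x hx => by simpa [block] using hx)
      hbij.1.injOn fun k hk => ?_
    obtain ⟨x, rfl⟩ := hbij.2 k
    exact ⟨x, by simpa [block] using hk, rfl⟩
  have hinj : ∀ m m', S.graph.Adj n m → S.graph.Adj n m' → block m = block m' → m = m' := by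
    intro m m' hm hm' he
    obtain ⟨x, hx⟩ := hbij.2 m
    have h1 : x ∈ block m := by
      simp only [block, Finset.mem_filter, Finset.mem_univ, true_and, hx]
      exact (hG.mem_branch_iff hm).2 SimpleGraph.btw_right
    have h2 : x ∈ block m' := he ▸ h1
    simp only [block, Finset.mem_filter, Finset.mem_univ, true_and] at h1 h2
    exact hG.branch_unique hm hm' h1 h2
  constructor
  · have hI : (Finset.univ.filter fun B => ∃ u, IsArc S.family B u v) =
        (Finset.univ.filter fun m : S.Node => S.arc m.1 n.1).image block := by
      ext B
      simp only [Finset.mem_filter, Finset.mem_univ, true_and, Finset.mem_image]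
      constructor
      · rintro ⟨u, hu⟩
        obtain ⟨hA, hm⟩ := S.isSpine.isArc_iff.1 hu
        exact ⟨S.nodeOf u, hA, Finset.ext fun x => (hblock _ x).trans (hm x).symm⟩
      · rintro ⟨m, hA, rfl⟩
        obtain ⟨u, rfl⟩ := hbij.2 m
        exact ⟨u, S.isSpine.isArc_iff.2 ⟨hA, hblock _⟩⟩
    rw [hI, Finset.sum_image]
    · exact Finset.sum_congr rfl fun m _ => by rw [hbc, hcard]
    · intro m hm m' hm'
      simp only [Finset.coe_filter, Finset.mem_univ, true_and, Set.mem_ofPred_eq] at hm hm'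
      exact hinj m m' (graph_adj.2 (Or.inr hm)) (graph_adj.2 (Or.inr hm'))
  · have hO : (Finset.univ.filter fun B => ∃ w, IsArc S.family B v w) =
        (Finset.univ.filter fun m : S.Node => S.arc n.1 m.1).image fun m => (block m)ᶜ := by
      ext B
      simp only [Finset.mem_filter, Finset.mem_univ, true_and, Finset.mem_image]
      have hc : ∀ m : S.Node, S.arc n.1 m.1 → ∀ x, x ∈ (block m)ᶜ ↔
          ¬ S.graph.Btw n m (S.nodeOf x) := fun m hA x => by
        rw [Finset.mem_compl, hblock, not_not, hG.not_btw_iff (graph_adj.2 (Or.inl hA))]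
      constructor
      · rintro ⟨u, hu⟩
        obtain ⟨hA, hm⟩ := S.isSpine.isArc_iff.1 hu
        exact ⟨S.nodeOf u, hA, Finset.ext fun x => (hc _ hA x).trans (hm x).symm⟩
      · rintro ⟨m, hA, rfl⟩
        obtain ⟨u, rfl⟩ := hbij.2 m
        exact ⟨u, S.isSpine.isArc_iff.2 ⟨hA, hc _ hA⟩⟩
    rw [hO, Finset.sum_image]
    · refine Finset.sum_congr rfl fun m _ => ?_
      rw [Finset.card_compl, Nat.cast_sub (Finset.card_le_univ _), hbc, hcard]
      ring
    · intro m hm m' hm' he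
      simp only [Finset.coe_filter, Finset.mem_univ, true_and, Set.mem_ofPred_eq] at hm hm'
      exact hinj m m' (graph_adj.2 (Or.inl hm)) (graph_adj.2 (Or.inl hm')) (compl_injective he)

theorem point_eq (hs : IsSeparating S.family) : S.point = vertexPoint S.family := by
  classical
  have hG := S.isTree
  have hbij : Function.Bijective S.nodeOf := ⟨nodeOf_injective_iff.2 hs, nodeOf_surjective⟩
  have hcard : Fintype.card S.Node = Fintype.card V :=
    (Fintype.card_congr (Equiv.ofBijective _ hbij)).symm
  funext v
  obtain ⟨hI, hO⟩ := sum_incoming_eq hs v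
  rw [vertexPoint, point, hI, hO]
  set n := S.nodeOf v with hn
  set I := Finset.univ.filter fun m : S.Node => S.arc m.1 n.1 with hIdef
  set O := Finset.univ.filter fun m : S.Node => S.arc n.1 m.1 with hOdef
  have hmI : ∀ m, m ∈ I ↔ S.arc m.1 n.1 := fun m => by simp [hIdef]
  have hmO : ∀ m, m ∈ O ↔ S.arc n.1 m.1 := fun m => by simp [hOdef]
  have hd : Disjoint I O := Finset.disjoint_left.2 fun m h1 h2 =>
    S.arc_asymm _ _ ((hmI m).1 h1) ((hmO m).1 h2)
  have hadj : ∀ m, S.graph.Adj n m ↔ m ∈ O ∨ m ∈ I := fun m => by rw [hmI, hmO, graph_adj]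
  have hself : ∀ {s : S.Node} {x}, S.graph.Adj s n → S.nodeOf x = s →
      ¬ S.graph.Btw s n (S.nodeOf x) :=
    fun {s x} ha hx e => ha.ne' (SimpleGraph.Btw.eq_of_self (hx ▸ e))
  by_cases hv : v ∈ T.neg
  · have huniq : ∀ m ∈ O, ∀ m' ∈ O, m = m' := by
      intro m hm m' hm'
      by_contra hne
      obtain ⟨x, hx⟩ := hbij.2 m
      obtain ⟨y, hy⟩ := hbij.2 m'
      obtain ⟨w, hw, hwn, -⟩ := S.isSpine.exists_pos n m m' x y ((hmO m).1 hm) ((hmO m').1 hm') hne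
        (hself ((hadj m).2 (Or.inl hm)).symm hx) (hself ((hadj m').2 (Or.inl hm')).symm hy)
      exact hwn (hbij.1 hw ▸ hv)
    have h := hG.ncard_paths_eq hd (fun m => (hadj m).trans or_comm) huniq
    have hset : S.avoidingPaths v = {π : S.graph.Subgraph | (∃ (x y : S.Node)
        (p : S.graph.Walk x y), p.IsPath ∧ π = p.toSubgraph) ∧ n ∈ π.verts ∧
        ∀ e ∈ O, ¬ π.Adj n e} := by
      ext π
      refine and_congr_right fun _ => and_congr_right fun _ => ?_
      simp only [hmO]
      exact ⟨fun h => h.1 hv, fun h => ⟨fun _ => h, fun hp => absurd hv hp⟩⟩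
    rw [if_pos hv, hset, h, hcard]
  · have huniq : ∀ m ∈ I, ∀ m' ∈ I, m = m' := by
      intro m hm m' hm'
      by_contra hne
      obtain ⟨x, hx⟩ := hbij.2 m
      obtain ⟨y, hy⟩ := hbij.2 m'
      obtain ⟨w, hw, hwn, -⟩ := S.isSpine.exists_neg n m m' x y ((hmI m).1 hm) ((hmI m').1 hm') hne
        (hself ((hadj m).2 (Or.inr hm)).symm hx) (hself ((hadj m').2 (Or.inr hm')).symm hy)
      exact hv (hbij.1 hw ▸ hwn)
    have h := hG.ncard_paths_eq hd.symm hadj huniq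
    have hset : S.avoidingPaths v = {π : S.graph.Subgraph | (∃ (x y : S.Node)
        (p : S.graph.Walk x y), p.IsPath ∧ π = p.toSubgraph) ∧ n ∈ π.verts ∧
        ∀ e ∈ I, ¬ π.Adj n e} := by
      ext π
      refine and_congr_right fun _ => and_congr_right fun _ => ?_
      simp only [hmI]
      exact ⟨fun h e he ha => h.2 hv e he ha.symm,
        fun h => ⟨fun hp => absurd hp hv, fun _ e he ha => h e he ha.symm⟩⟩
    rw [if_neg hv, hset, h, hcard]
    ring

end SignedSpine

theorem theorem56 {V : Type*} [Fintype V] [DecidableEq V] (T : SignedTree V) :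
    T.asso = T.assoFacets ∧
    normalFan T.asso = T.spineFan ∧
    ∀ o ∈ intrinsicInterior ℝ T.asso,
      Nonempty (boundaryComplex (polarAt o T.asso) ≃o T.signedNestedComplex) := by
  have hpoints : {x | ∃ S : SignedSpine T, S.IsMaximal ∧ x = S.point} =
      {x | ∃ 𝓑, T.IsNested 𝓑 ∧ SignedTree.IsSeparating 𝓑 ∧ x = SignedTree.vertexPoint 𝓑} := by
    ext x
    constructor
    · rintro ⟨S, hS, rfl⟩
      have hs := SignedSpine.isMaximal_iff.1 hS
      exact ⟨S.family, S.isNested_family, hs, SignedSpine.point_eq hs⟩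
    · rintro ⟨𝓑, hn, hs, rfl⟩
      obtain ⟨S, rfl⟩ := hn.exists_signedSpine
      exact ⟨S, SignedSpine.isMaximal_iff.2 hs, (SignedSpine.point_eq hs).symm⟩
  have hasso : T.asso = T.assoFacets := by
    rw [SignedTree.asso, hpoints]
    exact SignedTree.convexHull_vertexPoint T
  rw [hasso]
  refine ⟨rfl, ?_, fun o ho => ?_⟩
  · rw [SignedTree.normalFan_assoFacets, SignedTree.spineFan_eq]
  · obtain ⟨e⟩ := SignedTree.exists_boundaryComplex_iso ho
    obtain ⟨e'⟩ := T.exists_signedNestedComplex_iso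
    exact ⟨e.trans e'⟩
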